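/- Let $\Bbbk$ be an algebraically closed field of characteristic zero. Let $H$ be a cosemisimple Hopf algebra with bijective antipode and let $(g_i,\chi_i)_{i\in\mathbb I}$, $\mathbb I=\{1,\dots,\theta\}$, be YD-pairs for $H$: $g_i\in G(H)$, $\chi_i\in\mathrm{Alg}(H,\Bbbk)$ and $\chi_i(h)g_i=\chi_i(h_{(2)})h_{(1)}g_i\mathcal S(h_{(3)})$. Let $V\in{}^H_H\mathcal{YD}$ be the Yetter-Drinfeld module with basis $(x_i)_{i\in\mathbb I}$, action $h\cdot x_i=\chi_i(h)x_i$ and coaction $x_i\mapsto g_i\otimes x_i$, a braided vector space of diagonal type with matrix $q_{ij}=\chi_j(g_i)$. Assume that its Nichols algebra $\mathfrak B(V)=T(V)/\mathcal J(V)$ is finite-dimensional and that its generalized Dynkin diagram is connected. Put $\mathbb I(i)=\{j: g_j=g_i,\ \chi_j=\chi_i\}$. Let $\mathcal G=\mathcal G_0\sqcup\dots\sqcup\mathcal G_\ell$ be a finite stratified set of $\mathbb Z^\theta$-homogeneous generators of $\mathcal J(V)$ such that the elements of $\mathcal G_n$ are primitive in $\mathfrak B_n=T(V)/\langle\mathcal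 G_0\cup\dots\cup\mathcal G_{n-1}\rangle$; write $\mathcal H_n=\mathfrak B_n\#H$. If $r\in\mathcal G$ has degree $(d_i)$, put $g_r=\prod g_i^{d_i}$, $\chi_r=\prod\chi_i^{d_i}$. For $\Lambda=(\lambda_r)\in\Bbbk^{\mathcal G}$ define recursively quotient algebras of $T(V)\#H$: $\mathcal A_0=\mathcal L_0=T(V)\#H$, $$\mathcal A_{n+1}=\mathcal A_n/\langle r'-\lambda_r: r\in\mathcal G_n\rangle,\qquad \mathcal L_{n+1}=\mathcal L_n/\langle\tilde r-\lambda_r(1-g_r): r\in\mathcal G_n\rangle .$$ Here $r'\in\mathcal A_n$ is a fixed element, chosen for each algebra $\mathcal A_n$, on which $H$ acts by $\chi_r$ and such that $\rho(r')=r'\otimes1+g_r\otimes r$, and $\tilde r\in\mathcal L_n$ is given by $\delta(r')=\tilde r\otimes 1+g_r\otimes r'$, where $\rho:\mathcal A_n\to\mathcal A_n\otimes\mathcal H_n$ and $\delta:\mathcal A_n\to\mathcal L_n\otimes\mathcal A_n$ are induced by the comultiplication of $T(V)\#H$. Let $\mathcal R$ be the set of those $\Lambda$ such that $\mathcal A_n\ne0$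 for all $n\le\ell+1$ and $\lambda_r=0$ whenever $g_r=1$. Put $\mathcal A(\Lambda)=\mathcal A_{\ell+1}$, $\mathcal L(\Lambda)=\mathcal L_{\ell+1}$; let $y_i$, $a_i$ be the images of $x_i$ in them. Let $H'$, $\theta'$, $V'$, $(g'_i,\chi'_i)_{i\in\mathbb I'}$, $q'_{ij}$, $\mathcal G'$, $\mathcal R'$, … be a second set of such data, where connectedness is not required. Let $\Lambda\in\mathcal R$ and $\Lambda'\in\mathcal R'$. Then $\mathcal L(\Lambda)$ and $\mathcal L(\Lambda')$ are quotient Hopf algebras of $T(V)\#H$ and $T(V')\#H'$. A *lifting data isomorphism* $(H,V,\Lambda)\to(H',V',\Lambda')$ is a triple $(\varphi,\sigma,s)$ where * $\varphi:H\to H'$ is a Hopf algebra isomorphism and $\sigma:\mathbb I'\to\mathbb I$ is a bijection with $q'_{ij}=q_{\sigma(i)\sigma(j)}$ (so a permutation preserving the braiding matrix, if $q'=q$), $g'_i=\varphi(g_{\sigma(i)})$ and $\chi'_i\circ\varphi=\chi_{\sigma(i)}$ for all $i,j$; * $s\in\mathbf L=\{s\in \mathrm{GL}_{\theta'}(\Bbbk):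 s_{ij}=0\text{ if } j\notin\mathbb I'(i)\}$; * $\Lambda'=s\cdot\Lambda^\sigma$, which means: there is $c\in\Bbbk^{\mathcal G'}$ such that $\varphi(h)\mapsto h$, $y'_i\mapsto\sum_{j} s_{ij}\,y_{\sigma(j)}$ defines an algebra isomorphism $\mathcal A(c)\to\mathcal A(\Lambda)$, and such that $c$ and $\Lambda'$ define the same quotient $\mathcal L(c)=\mathcal L(\Lambda')$ of $T(V')\#H'$ (if $g'_r\neq1$ for all $r\in\mathcal G'$ then this says $c=\Lambda'$). Every lifting data isomorphism $(\varphi,\sigma,s)$ determines a Hopf algebra isomorphism $\psi:\mathcal L(\Lambda)\to\mathcal L(\Lambda')$ with $\psi|_H=\varphi$ and $\psi^{-1}(a'_i)=\sum_{j}s_{ij}\,a_{\sigma(j)}$, $i\in\mathbb I'$. Every Hopf algebra isomorphism $\mathcal L(\Lambda)\to\mathcal L(\Lambda')$ arises in this way. Two triples $(\varphi_1,\sigma_1,s)$ and $(\varphi_2,\sigma_2,t)$ determine the same isomorphism if and only if $\varphi_1=\varphi_2$ and there is a permutation $\tau$ of $\mathbb I'$ with $\tau(i)\in\mathbb I'(i)$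 for all $i$, $\sigma_2=\sigma_1\tau$ and $t_{ij}=s_{i\tau(j)}$. Thus Hopf algebra isomorphisms $\mathcal L(\Lambda)\to\mathcal L(\Lambda')$ are in bijection with lifting data isomorphisms up to this change of $(\sigma,s)$; in particular, if $|\mathbb I(i)|=1$ for all $i\in\mathbb I$, then they are in bijection with lifting data isomorphisms. -/

import Mathlib

open scoped TensorProduct

noncomputable section

namespace DiagonalLifting

/-! ### Hopf algebras: cosemisimplicity, Yetter-Drinfeld pairs -/

section Hopf

variable (k : Type*) [Field k] (H : Type*) [Ring H] [HopfAlgebra k H]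

variable {k H} in
/-- `C` is a subcoalgebra: `Δ(C) ⊆ C ⊗ C`. -/
def IsSubcoalgebra (C : Submodule k H) : Prop :=
  ∀ c ∈ C, Coalgebra.comul (R := k) c ∈ LinearMap.range (TensorProduct.map C.subtype C.subtype)

variable {k H} in
/-- A nonzero subcoalgebra without proper nonzero subcoalgebras. -/
def IsSimpleSubcoalgebra (C : Submodule k H) : Prop :=
  IsSubcoalgebra C ∧ C ≠ ⊥ ∧ ∀ D ≤ C, IsSubcoalgebra D → D = ⊥ ∨ D = C

/-- `H` is the sum of its simple subcoalgebras. -/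
def IsCosemisimple : Prop :=
  sSup {C : Submodule k H | IsSimpleSubcoalgebra C} = ⊤

variable {k H}

/-- `h ↦ χ(h₁) h₂`. -/
def leftTwist (χ : H →ₐ[k] k) : H →ₗ[k] H :=
  (TensorProduct.lid k H).toLinearMap ∘ₗ
    TensorProduct.map χ.toLinearMap LinearMap.id ∘ₗ Coalgebra.comul

/-- `h ↦ h₁ χ(h₂)`. -/
def rightTwist (χ : H →ₐ[k] k) : H →ₗ[k] H :=
  (TensorProduct.rid k H).toLinearMap ∘ₗ
    TensorProduct.map LinearMap.id χ.toLinearMap ∘ₗ Coalgebra.comul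

variable (k H) in
/-- A YD-pair `(g, χ)` for `H`: a group-like element and a character such that the one-dimensional
vector space with action `χ` and coaction `g` is a Yetter-Drinfeld module. The compatibility
`h₁ χ(h₂) g = g χ(h₁) h₂` is the usual one, `h₁ v₋₁ ⊗ h₂ v₀ = (h₁ v)₋₁ h₂ ⊗ (h₁ v)₀`; convolving
with the antipode, it is the same as `χ(h) g = χ(h₂) h₁ g S(h₃)`. -/
structure YDPair where
  g : H
  χ : H →ₐ[k] k
  isGroupLike : IsGroupLikeElem k g
  compat : ∀ h : H, rightTwist χ h * g = g * leftTwist χ h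

end Hopf

/-! ### Braided vector spaces of diagonal type and their Nichols algebras -/

section Nichols

variable {k : Type*} [Field k] {θ : ℕ} (q : Fin θ → Fin θ → k)

/-- The underlying graph of the generalized Dynkin diagram of the braiding matrix `q`. -/
def dynkinGraph : SimpleGraph (Fin θ) where
  Adj i j := i ≠ j ∧ q i j * q j i ≠ 1
  symm := ⟨fun _ _ h => ⟨h.1.symm, by rw [mul_comm]; exact h.2⟩⟩
  loopless := ⟨fun _ h => h.1 rfl⟩

/-- `x ↦ (x, ∂ᵢ x; 0, gᵢ · x)`, where `gᵢ · xⱼ = q i j xⱼ` and `∂ᵢ` is the skew derivation of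
`T(V)` with `∂ᵢ xⱼ = δᵢⱼ` and `∂ᵢ(x y) = x ∂ᵢ(y) + ∂ᵢ(x) (gᵢ · y)`. -/
def skewDerMatrix (i : Fin θ) :
    FreeAlgebra k (Fin θ) →ₐ[k] Matrix (Fin 2) (Fin 2) (FreeAlgebra k (Fin θ)) :=
  FreeAlgebra.lift k fun j =>
    !![FreeAlgebra.ι k j, if i = j then 1 else 0; 0, q i j • FreeAlgebra.ι k j]

/-- The skew derivation `∂ᵢ` of `T(V)`. -/
def skewDer (i : Fin θ) : Module.End k (FreeAlgebra k (Fin θ)) :=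
  Matrix.entryLinearMap k (FreeAlgebra k (Fin θ)) 0 1 ∘ₗ (skewDerMatrix q i).toLinearMap

/-- The defining ideal `𝒥(V)` of the Nichols algebra `𝔅(V) = T(V)/𝒥(V)`: the elements `x` such
that every iterated skew derivative `∂_{i₁} ⋯ ∂_{iₙ} x`, `n ≥ 0`, has zero constant term
(equivalently, the sum of the kernels of the quantum symmetrizers). -/
def nicholsIdeal : Submodule k (FreeAlgebra k (Fin θ)) :=
  ⨅ w : List (Fin θ),
    LinearMap.ker ((FreeAlgebra.algebraMapInv (R := k) (X := Fin θ)).toLinearMap ∘ₗ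
      (w.map (skewDer q)).prod)

/-- The component of multidegree `d ∈ ℕ^θ` of `T(V)`. -/
def homogeneousPart (k : Type*) [Field k] {θ : ℕ} (d : Fin θ → ℕ) :
    Submodule k (FreeAlgebra k (Fin θ)) :=
  Submodule.span k {x | ∃ w : List (Fin θ), (∀ i, w.count i = d i) ∧
    x = (w.map (FreeAlgebra.ι k)).prod}

end Nichols

/-! ### The bosonization `T(V) # H` -/

section Bosonization

variable {k : Type*} [Field k] {H : Type*} [Ring H] [HopfAlgebra k H] {θ : ℕ}

/-- The matrix `q_{ij} = χ_j(g_i)` of the braided vector space with principal realization `X`. -/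
def braidingMatrix (X : Fin θ → YDPair k H) (i j : Fin θ) : k := (X j).χ (X i).g

/-- The block `𝕀(i)` of `i`. -/
def block (X : Fin θ → YDPair k H) (i : Fin θ) : Set (Fin θ) :=
  {j | (X j).g = (X i).g ∧ (X j).χ = (X i).χ}

/-- The block group `𝐋`. -/
def blockGroup (X : Fin θ → YDPair k H) : Set (GL (Fin θ) k) :=
  {s | ∀ i j, j ∉ block X i → s i j = 0}

/-- Relations defining `T(V) # H` in the free algebra on the symbols `x_i` and `h ∈ H`: those of
the algebra `H`, and `h x_i = χ_i(h₁) x_i h₂`. -/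
inductive BosRel (X : Fin θ → YDPair k H) :
    FreeAlgebra k (Fin θ ⊕ H) → FreeAlgebra k (Fin θ ⊕ H) → Prop
  | one : BosRel X (FreeAlgebra.ι k (Sum.inr 1)) 1
  | mul (a b : H) : BosRel X (FreeAlgebra.ι k (Sum.inr (a * b)))
      (FreeAlgebra.ι k (Sum.inr a) * FreeAlgebra.ι k (Sum.inr b))
  | add (a b : H) : BosRel X (FreeAlgebra.ι k (Sum.inr (a + b)))
      (FreeAlgebra.ι k (Sum.inr a) + FreeAlgebra.ι k (Sum.inr b))
  | smul (c : k) (a : H) : BosRel X (FreeAlgebra.ι k (Sum.inr (c • a)))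
      (c • FreeAlgebra.ι k (Sum.inr a))
  | comm (i : Fin θ) (h : H) : BosRel X
      (FreeAlgebra.ι k (Sum.inr h) * FreeAlgebra.ι k (Sum.inl i))
      (FreeAlgebra.ι k (Sum.inl i) * FreeAlgebra.ι k (Sum.inr (leftTwist (X i).χ h)))

/-- The bosonization `𝒯(V) = T(V) # H`, where `V` has the basis `x_i`, `i < θ`, with action
`h · x_i = χ_i(h) x_i` and coaction `x_i ↦ g_i ⊗ x_i`. -/
def Bos (X : Fin θ → YDPair k H) : Type _ := RingQuot (BosRel X)

namespace Bos

variable (X : Fin θ → YDPair k H)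

instance : Ring (Bos X) := inferInstanceAs (Ring (RingQuot (BosRel X)))

instance : Algebra k (Bos X) := inferInstanceAs (Algebra k (RingQuot (BosRel X)))

/-- The projection from the free algebra. -/
def proj : FreeAlgebra k (Fin θ ⊕ H) →ₐ[k] Bos X := RingQuot.mkAlgHom k (BosRel X)

/-- The inclusion `H → T(V) # H`. -/
def ofH : H →ₐ[k] Bos X :=
  AlgHom.ofLinearMap
    { toFun := fun h => proj X (FreeAlgebra.ι k (Sum.inr h))
      map_add' := fun a b => by
        rw [← map_add]; exact RingQuot.mkAlgHom_rel k (BosRel.add a b)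
      map_smul' := fun c a => by
        rw [RingHom.id_apply, ← map_smul]; exact RingQuot.mkAlgHom_rel k (BosRel.smul c a) }
    ((RingQuot.mkAlgHom_rel k BosRel.one).trans (map_one (proj X)))
    (fun a b => (RingQuot.mkAlgHom_rel k (BosRel.mul a b)).trans (map_mul (proj X) _ _))

/-- The generators `x_i` of `T(V) # H`. -/
def x (i : Fin θ) : Bos X := proj X (FreeAlgebra.ι k (Sum.inl i))

/-- The inclusion `T(V) → T(V) # H`. -/
def ofV : FreeAlgebra k (Fin θ) →ₐ[k] Bos X := FreeAlgebra.lift k (x X)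

lemma ofH_mul_x (i : Fin θ) (h : H) :
    ofH X h * x X i = x X i * ofH X (leftTwist (X i).χ h) :=
  ((map_mul (proj X) _ _).symm.trans (RingQuot.mkAlgHom_rel k (BosRel.comm i h))).trans
    (map_mul (proj X) _ _)

variable {X}

variable {B : Type*} [Ring B] [Algebra k B]

/-- The universal property of `T(V) # H`. -/
def lift (f : H →ₐ[k] B) (v : Fin θ → B)
    (hv : ∀ i h, f h * v i = v i * f (leftTwist (X i).χ h)) : Bos X →ₐ[k] B :=
  RingQuot.liftAlgHom k ⟨FreeAlgebra.lift k (Sum.elim v f), by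
    intro a b hab
    cases hab <;> simp [hv]⟩

@[simp] lemma lift_ofH (f : H →ₐ[k] B) (v : Fin θ → B)
    (hv : ∀ i h, f h * v i = v i * f (leftTwist (X i).χ h)) (h : H) :
    lift f v hv (ofH X h) = f h := by
  change RingQuot.liftAlgHom k _ (RingQuot.mkAlgHom k (BosRel X) _) = _
  rw [RingQuot.liftAlgHom_mkAlgHom_apply]
  simp

@[simp] lemma lift_x (f : H →ₐ[k] B) (v : Fin θ → B)
    (hv : ∀ i h, f h * v i = v i * f (leftTwist (X i).χ h)) (i : Fin θ) :
    lift f v hv (x X i) = v i := by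
  change RingQuot.liftAlgHom k _ (RingQuot.mkAlgHom k (BosRel X) _) = _
  rw [RingQuot.liftAlgHom_mkAlgHom_apply]
  simp

lemma algHom_ext {f g : Bos X →ₐ[k] B} (hH : ∀ h, f (ofH X h) = g (ofH X h))
    (hx : ∀ i, f (x X i) = g (x X i)) : f = g := by
  apply RingQuot.ringQuot_ext'
  apply FreeAlgebra.hom_ext
  funext a
  cases a with
  | inl i => exact hx i
  | inr h => exact hH h

end Bos

lemma leftTwist_comul (χ : H →ₐ[k] k) (h : H) :
    TensorProduct.map (leftTwist χ) LinearMap.id (Coalgebra.comul (R := k) h) =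
      Coalgebra.comul (R := k) (leftTwist χ h) := by
  have h1 : ∀ z : H ⊗[k] H, TensorProduct.map (leftTwist χ) LinearMap.id z =
      TensorProduct.lid k (H ⊗[k] H) (TensorProduct.map χ.toLinearMap LinearMap.id
        (TensorProduct.assoc k H H H (TensorProduct.map Coalgebra.comul LinearMap.id z))) := by
    intro z
    induction z with
    | zero => simp
    | add a b ha hb => simp only [map_add, ha, hb]
    | tmul a b =>
      simp only [TensorProduct.map_tmul, leftTwist, LinearMap.comp_apply, LinearMap.id_apply]
      generalize Coalgebra.comul (R := k) a = w
      induction w with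
      | zero => simp
      | add a b ha hb => simp only [map_add, TensorProduct.add_tmul, ha, hb]
      | tmul c d => simp [TensorProduct.smul_tmul']
  have h2 : ∀ z : H ⊗[k] H, TensorProduct.lid k (H ⊗[k] H)
      (TensorProduct.map χ.toLinearMap LinearMap.id
        (TensorProduct.map LinearMap.id Coalgebra.comul z)) =
      Coalgebra.comul (R := k) (TensorProduct.lid k H
        (TensorProduct.map χ.toLinearMap LinearMap.id z)) := by
    intro z
    induction z with
    | zero => simp
    | add a b ha hb => simp only [map_add, ha, hb]
    | tmul a b => simp
  rw [h1]
  exact (congrArg (fun z => TensorProduct.lid k (H ⊗[k] H)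
    (TensorProduct.map χ.toLinearMap LinearMap.id z)) (Coalgebra.coassoc_apply h)).trans (h2 _)

lemma rightTwist_comul (χ : H →ₐ[k] k) (h : H) :
    TensorProduct.map LinearMap.id (leftTwist χ) (Coalgebra.comul (R := k) h) =
      TensorProduct.map (rightTwist χ) LinearMap.id (Coalgebra.comul (R := k) h) := by
  let G : H ⊗[k] (H ⊗[k] H) →ₗ[k] H ⊗[k] H :=
    TensorProduct.map LinearMap.id ((TensorProduct.lid k H).toLinearMap ∘ₗ
      TensorProduct.map χ.toLinearMap LinearMap.id)
  have h1 : ∀ z : H ⊗[k] H, TensorProduct.map (rightTwist χ) LinearMap.id z =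
      G (TensorProduct.assoc k H H H (TensorProduct.map Coalgebra.comul LinearMap.id z)) := by
    intro z
    induction z with
    | zero => simp
    | add a b ha hb => simp only [map_add, ha, hb]
    | tmul a b =>
      simp only [TensorProduct.map_tmul, rightTwist, LinearMap.comp_apply, LinearMap.id_apply]
      generalize Coalgebra.comul (R := k) a = w
      induction w with
      | zero => simp
      | add a b ha hb => simp only [map_add, TensorProduct.add_tmul, ha, hb]
      | tmul c d => simp [G, TensorProduct.smul_tmul]
  have h2 : ∀ z : H ⊗[k] H, TensorProduct.map LinearMap.id (leftTwist χ) z =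
      G (TensorProduct.map LinearMap.id Coalgebra.comul z) := by
    intro z
    induction z with
    | zero => simp
    | add a b ha hb => simp only [map_add, ha, hb]
    | tmul a b => simp [G, leftTwist]
  rw [h1, h2]
  exact (congrArg G (Coalgebra.coassoc_apply h)).symm

lemma leftTwist_mul (χ : H →ₐ[k] k) (a b : H) :
    leftTwist χ (a * b) = leftTwist χ a * leftTwist χ b :=
  map_mul ((Algebra.TensorProduct.lid k H).toAlgHom.comp
    ((Algebra.TensorProduct.map χ (.id k H)).comp (Bialgebra.comulAlgHom k H))) a b

lemma leftTwist_antipode_rightTwist (χ : H →ₐ[k] k) (h : H) :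
    leftTwist χ (HopfAlgebra.antipode k (rightTwist χ h)) = HopfAlgebra.antipode k h := by
  have key : (WithConv.toConv
      (leftTwist χ ∘ₗ HopfAlgebra.antipode k ∘ₗ rightTwist χ) : WithConv (H →ₗ[k] H)) =
      WithConv.toConv (HopfAlgebra.antipode k) := by
    refine left_inv_eq_right_inv (a := WithConv.toConv LinearMap.id) ?_
      LinearMap.id_mul_antipode
    ext h
    rw [LinearMap.convMul_apply, LinearMap.convOne_apply]
    have h1 : ∀ z : H ⊗[k] H, LinearMap.mul' k H (TensorProduct.map
        (leftTwist χ ∘ₗ HopfAlgebra.antipode k ∘ₗ rightTwist χ) LinearMap.id z) =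
        LinearMap.mul' k H (TensorProduct.map (leftTwist χ ∘ₗ HopfAlgebra.antipode k)
          LinearMap.id (TensorProduct.map (rightTwist χ) LinearMap.id z)) := by
      intro z
      rw [← LinearMap.comp_apply (TensorProduct.map _ _), ← TensorProduct.map_comp]
      rfl
    have h2 : ∀ z : H ⊗[k] H, LinearMap.mul' k H
        (TensorProduct.map (leftTwist χ ∘ₗ HopfAlgebra.antipode k) LinearMap.id
          (TensorProduct.map LinearMap.id (leftTwist χ) z)) =
        leftTwist χ (LinearMap.mul' k H ((HopfAlgebra.antipode k).rTensor H z)) := by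
      intro z
      induction z with
      | zero => simp
      | add a b ha hb => simp only [map_add, ha, hb]
      | tmul a b => simp [leftTwist_mul]
    refine (h1 _).trans ?_
    rw [← rightTwist_comul, h2, HopfAlgebra.mul_antipode_rTensor_comul_apply,
      Algebra.algebraMap_eq_smul_one, map_smul]
    simp [leftTwist, Algebra.TensorProduct.one_def]
  exact congrArg (fun f : WithConv (H →ₗ[k] H) => f h) key

namespace Bos

variable (X : Fin θ → YDPair k H)

/-- The inclusion of `H ⊗ H`. -/
def ofHH : H ⊗[k] H →ₐ[k] Bos X ⊗[k] Bos X := Algebra.TensorProduct.map (ofH X) (ofH X)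

lemma comul_aux (i : Fin θ) (h : H) :
    ofHH X (Coalgebra.comul (R := k) h) *
        (x X i ⊗ₜ[k] 1 + ofH X (X i).g ⊗ₜ[k] x X i) =
      (x X i ⊗ₜ[k] 1 + ofH X (X i).g ⊗ₜ[k] x X i) *
        ofHH X (Coalgebra.comul (R := k) (leftTwist (X i).χ h)) := by
  have h1 : ∀ z : H ⊗[k] H, ofHH X z * (x X i ⊗ₜ[k] 1) =
      (x X i ⊗ₜ[k] 1) * ofHH X (TensorProduct.map (leftTwist (X i).χ) LinearMap.id z) := by
    intro z
    induction z with
    | zero => simp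
    | add a b ha hb => simp only [map_add, add_mul, mul_add, ha, hb]
    | tmul a b => simp [ofHH, ofH_mul_x]
  have h2 : ∀ z : H ⊗[k] H, ofHH X z * (ofH X (X i).g ⊗ₜ[k] x X i) =
      (1 ⊗ₜ[k] x X i) * ofHH X (TensorProduct.map (LinearMap.mulRight k (X i).g) LinearMap.id
        (TensorProduct.map LinearMap.id (leftTwist (X i).χ) z)) := by
    intro z
    induction z with
    | zero => simp
    | add a b ha hb => simp only [map_add, add_mul, mul_add, ha, hb]
    | tmul a b => simp [ofHH, ofH_mul_x]
  have h3 : ∀ z : H ⊗[k] H, TensorProduct.map (LinearMap.mulRight k (X i).g) LinearMap.id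
      (TensorProduct.map (rightTwist (X i).χ) LinearMap.id z) =
      ((X i).g ⊗ₜ[k] 1) * TensorProduct.map (leftTwist (X i).χ) LinearMap.id z := by
    intro z
    induction z with
    | zero => simp
    | add a b ha hb => simp only [map_add, mul_add, ha, hb]
    | tmul a b => simp [(X i).compat]
  rw [mul_add, h1, h2, rightTwist_comul, h3, leftTwist_comul, map_mul, ← mul_assoc, ← add_mul]
  simp [ofHH]

/-- The comultiplication: that of `H`, and `Δ(x_i) = x_i ⊗ 1 + g_i ⊗ x_i`. -/
def comulHom : Bos X →ₐ[k] Bos X ⊗[k] Bos X :=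
  lift ((ofHH X).comp (Bialgebra.comulAlgHom k H))
    (fun i => x X i ⊗ₜ[k] 1 + ofH X (X i).g ⊗ₜ[k] x X i) (comul_aux X)

/-- The counit: that of `H`, and `ε(x_i) = 0`. -/
def counitHom : Bos X →ₐ[k] k :=
  lift (Bialgebra.counitAlgHom k H) (fun _ => 0) (by simp)

@[simp] lemma comulHom_ofH (h : H) :
    comulHom X (ofH X h) = ofHH X (Coalgebra.comul (R := k) h) :=
  lift_ofH _ _ (comul_aux X) h

@[simp] lemma comulHom_x (i : Fin θ) :
    comulHom X (x X i) = x X i ⊗ₜ[k] 1 + ofH X (X i).g ⊗ₜ[k] x X i :=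
  lift_x _ _ (comul_aux X) i

@[simp] lemma counitHom_ofH (h : H) : counitHom X (ofH X h) = Coalgebra.counit (R := k) h :=
  lift_ofH _ _ _ h

@[simp] lemma counitHom_x (i : Fin θ) : counitHom X (x X i) = 0 :=
  lift_x _ _ _ i

instance : Bialgebra k (Bos X) :=
  Bialgebra.ofAlgHom (comulHom X) (counitHom X)
    (by
      apply algHom_ext
      · intro h
        have h1 : ∀ z : H ⊗[k] H, Algebra.TensorProduct.assoc k k k (Bos X) (Bos X) (Bos X)
            (Algebra.TensorProduct.map (comulHom X) (.id k (Bos X)) (ofHH X z)) =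
            Algebra.TensorProduct.map (ofH X) (ofHH X) (TensorProduct.assoc k H H H
              (TensorProduct.map Coalgebra.comul LinearMap.id z)) := by
          intro z
          induction z with
          | zero => simp
          | add a b ha hb => simp only [map_add, ha, hb]
          | tmul a b =>
            simp only [ofHH, comulHom_ofH, Algebra.TensorProduct.map_tmul, AlgHom.id_apply,
              TensorProduct.map_tmul, LinearMap.id_apply]
            generalize Coalgebra.comul (R := k) a = w
            induction w with
            | zero => simp
            | add a b ha hb => simp only [map_add, TensorProduct.add_tmul, ha, hb]
            | tmul c d => simp
        have h2 : ∀ z : H ⊗[k] H,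
            Algebra.TensorProduct.map (.id k (Bos X)) (comulHom X) (ofHH X z) =
            Algebra.TensorProduct.map (ofH X) (ofHH X)
              (TensorProduct.map LinearMap.id Coalgebra.comul z) := by
          intro z
          induction z with
          | zero => simp
          | add a b ha hb => simp only [map_add, ha, hb]
          | tmul a b => simp [ofHH]
        change Algebra.TensorProduct.assoc k k k (Bos X) (Bos X) (Bos X)
          (Algebra.TensorProduct.map (comulHom X) (.id k (Bos X)) (comulHom X (ofH X h))) =
          Algebra.TensorProduct.map (.id k (Bos X)) (comulHom X) (comulHom X (ofH X h))
        rw [comulHom_ofH, h1, h2]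
        exact congrArg _ (Coalgebra.coassoc_apply h)
      · intro i
        simp [(X i).isGroupLike.comul_eq_tmul_self, ofHH, TensorProduct.add_tmul,
          TensorProduct.tmul_add, Algebra.TensorProduct.one_def, add_assoc])
    (by
      apply algHom_ext
      · intro h
        have h1 : ∀ z : H ⊗[k] H,
            Algebra.TensorProduct.map (counitHom X) (.id k (Bos X)) (ofHH X z) =
            Algebra.TensorProduct.map (.id k k) (ofH X)
              (TensorProduct.map Coalgebra.counit LinearMap.id z) := by
          intro z
          induction z with
          | zero => simp
          | add a b ha hb => simp only [map_add, ha, hb]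
          | tmul a b => simp [ofHH]
        rw [AlgHom.comp_apply, comulHom_ofH, h1]
        refine (congrArg _ (Coalgebra.rTensor_counit_comul (R := k) h)).trans ?_
        simp
      · intro i
        simp [(X i).isGroupLike.counit_eq_one])
    (by
      apply algHom_ext
      · intro h
        have h1 : ∀ z : H ⊗[k] H,
            Algebra.TensorProduct.map (.id k (Bos X)) (counitHom X) (ofHH X z) =
            Algebra.TensorProduct.map (ofH X) (.id k k)
              (TensorProduct.map LinearMap.id Coalgebra.counit z) := by
          intro z
          induction z with
          | zero => simp
          | add a b ha hb => simp only [map_add, ha, hb]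
          | tmul a b => simp [ofHH]
        rw [AlgHom.comp_apply, comulHom_ofH, h1]
        refine (congrArg _ (Coalgebra.lTensor_counit_comul (R := k) h)).trans ?_
        simp
      · intro i
        simp)

lemma induction {P : Bos X → Prop} (hH : ∀ h, P (ofH X h)) (hx : ∀ i, P (x X i))
    (hadd : ∀ a b, P a → P b → P (a + b)) (hmul : ∀ a b, P a → P b → P (a * b)) (a : Bos X) :
    P a := by
  obtain ⟨b, rfl⟩ := RingQuot.mkAlgHom_surjective k (BosRel X) a
  induction b using FreeAlgebra.induction with
  | grade0 c =>
    have : P (algebraMap k (Bos X) c) := by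
      rw [← (ofH X).commutes]; exact hH _
    rwa [← (proj X).commutes] at this
  | grade1 a =>
    cases a with
    | inl i => exact hx i
    | inr h => exact hH h
  | mul a b ha hb => rw [map_mul]; exact hmul _ _ ha hb
  | add a b ha hb => rw [map_add]; exact hadd _ _ ha hb

/-- The antipode as an algebra map to the opposite algebra: that of `H`, and
`S(x_i) = - S(g_i) x_i`. -/
def antipodeHom : Bos X →ₐ[k] (Bos X)ᵐᵒᵖ :=
  lift ((AlgHom.op (ofH X)).comp (HopfAlgebra.antipodeAlgHomOp k H))
    (fun i => MulOpposite.op (-(ofH X (HopfAlgebra.antipode k (X i).g) * x X i))) (by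
      intro i h
      apply MulOpposite.unop_injective
      have h1 : HopfAlgebra.antipode k (leftTwist (X i).χ h) *
          HopfAlgebra.antipode k (X i).g = HopfAlgebra.antipode k (X i).g *
            HopfAlgebra.antipode k (rightTwist (X i).χ h) := by
        rw [← HopfAlgebra.antipode_mul_antidistrib, ← (X i).compat,
          HopfAlgebra.antipode_mul_antidistrib]
      simp only [AlgHom.comp_apply, MulOpposite.unop_mul, MulOpposite.unop_op, AlgHom.op_apply_apply,
        HopfAlgebra.antipodeAlgHomOp_apply, neg_mul, mul_neg, neg_inj]
      rw [← mul_assoc, ← map_mul, h1, ofH_mul_x, ofH_mul_x, leftTwist_mul,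
        leftTwist_antipode_rightTwist, map_mul, mul_assoc])

@[simp] lemma antipodeHom_ofH (h : H) :
    antipodeHom X (ofH X h) = MulOpposite.op (ofH X (HopfAlgebra.antipode k h)) :=
  lift_ofH _ _ _ h

@[simp] lemma antipodeHom_x (i : Fin θ) : antipodeHom X (x X i) =
    MulOpposite.op (-(ofH X (HopfAlgebra.antipode k (X i).g) * x X i)) :=
  lift_x _ _ _ i

/-- The antipode of `T(V) # H`. -/
def antipodeMap : Bos X →ₗ[k] Bos X :=
  (MulOpposite.opLinearEquiv k).symm.toLinearMap ∘ₗ (antipodeHom X).toLinearMap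

lemma antipodeMap_mul (a b : Bos X) :
    antipodeMap X (a * b) = antipodeMap X b * antipodeMap X a := by
  simp [antipodeMap]

@[simp] lemma antipodeMap_ofH (h : H) :
    antipodeMap X (ofH X h) = ofH X (HopfAlgebra.antipode k h) := by
  simp [antipodeMap]

@[simp] lemma antipodeMap_x (i : Fin θ) :
    antipodeMap X (x X i) = -(ofH X (HopfAlgebra.antipode k (X i).g) * x X i) := by
  simp [antipodeMap]

lemma comul_ofH (h : H) :
    Coalgebra.comul (R := k) (ofH X h) = ofHH X (Coalgebra.comul (R := k) h) :=
  comulHom_ofH X h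

lemma comul_x (i : Fin θ) :
    Coalgebra.comul (R := k) (x X i) = x X i ⊗ₜ[k] 1 + ofH X (X i).g ⊗ₜ[k] x X i :=
  comulHom_x X i

lemma counit_ofH (h : H) :
    Coalgebra.counit (R := k) (ofH X h) = Coalgebra.counit (R := k) h := counitHom_ofH X h

lemma counit_x (i : Fin θ) : Coalgebra.counit (R := k) (x X i) = 0 := counitHom_x X i

instance : HopfAlgebra k (Bos X) where
  antipode := antipodeMap X
  mul_antipode_rTensor_comul := by
    ext a
    simp only [LinearMap.comp_apply]
    induction a using induction with
    | hH h =>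
      have h1 : ∀ z : H ⊗[k] H, LinearMap.mul' k (Bos X)
          ((antipodeMap X).rTensor (Bos X) (ofHH X z)) = ofH X (LinearMap.mul' k H
            ((HopfAlgebra.antipode k).rTensor H z)) := by
        intro z
        induction z with
        | zero => simp
        | add a b ha hb => simp only [map_add, ha, hb]
        | tmul a b => simp [ofHH]
      rw [comul_ofH, h1, HopfAlgebra.mul_antipode_rTensor_comul_apply, counit_ofH]
      simp
    | hx i => simp [comul_x, counit_x]
    | hadd a b ha hb => simp only [map_add, ha, hb]
    | hmul a b ha hb =>
      have h1 : ∀ z w : Bos X ⊗[k] Bos X, LinearMap.mul' k (Bos X)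
          ((antipodeMap X).rTensor (Bos X) (z * w)) = LinearMap.mul' k (Bos X)
            ((antipodeMap X).rTensor (Bos X)
              ((1 ⊗ₜ[k] LinearMap.mul' k (Bos X) ((antipodeMap X).rTensor (Bos X) z)) * w)) := by
        intro z w
        induction w with
        | zero => simp
        | add a b ha hb => simp only [mul_add, map_add, ha, hb]
        | tmul c d =>
          induction z with
          | zero => simp
          | add a b ha hb => simp only [TensorProduct.tmul_add, add_mul, map_add, ha, hb]
          | tmul a b => simp [antipodeMap_mul, mul_assoc]
      rw [Bialgebra.comul_mul, h1, ha, Bialgebra.counit_mul]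
      have h2 : (1 : Bos X) ⊗ₜ[k] (Algebra.linearMap k (Bos X) (Coalgebra.counit (R := k) a)) =
          Coalgebra.counit (R := k) a • (1 : Bos X ⊗[k] Bos X) := by
        simp [Algebra.algebraMap_eq_smul_one, Algebra.TensorProduct.one_def]
      rw [h2, smul_mul_assoc, one_mul, map_smul, map_smul, hb]
      simp [Algebra.algebraMap_eq_smul_one, smul_smul]
  mul_antipode_lTensor_comul := by
    ext a
    simp only [LinearMap.comp_apply]
    induction a using induction with
    | hH h =>
      have h1 : ∀ z : H ⊗[k] H, LinearMap.mul' k (Bos X)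
          ((antipodeMap X).lTensor (Bos X) (ofHH X z)) = ofH X (LinearMap.mul' k H
            ((HopfAlgebra.antipode k).lTensor H z)) := by
        intro z
        induction z with
        | zero => simp
        | add a b ha hb => simp only [map_add, ha, hb]
        | tmul a b => simp [ofHH]
      rw [comul_ofH, h1, HopfAlgebra.mul_antipode_lTensor_comul_apply, counit_ofH]
      simp
    | hx i =>
      have hg : (X i).g * HopfAlgebra.antipode k (X i).g = 1 := by
        have := HopfAlgebra.mul_antipode_lTensor_comul_apply (R := k) (X i).g
        rw [(X i).isGroupLike.comul_eq_tmul_self, (X i).isGroupLike.counit_eq_one] at this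
        simpa using this
      have h1 : antipodeMap X (1 : Bos X) = 1 := by
        rw [← map_one (ofH X), antipodeMap_ofH, HopfAlgebra.antipode_one]
      simp [comul_x, counit_x, h1, ← mul_assoc, ← map_mul, hg]
    | hadd a b ha hb => simp only [map_add, ha, hb]
    | hmul a b ha hb =>
      have h1 : ∀ z w : Bos X ⊗[k] Bos X, LinearMap.mul' k (Bos X)
          ((antipodeMap X).lTensor (Bos X) (z * w)) = LinearMap.mul' k (Bos X)
            ((antipodeMap X).lTensor (Bos X)
              (z * (LinearMap.mul' k (Bos X) ((antipodeMap X).lTensor (Bos X) w) ⊗ₜ[k] 1))) := by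
        intro z w
        induction z with
        | zero => simp
        | add a b ha hb => simp only [add_mul, map_add, ha, hb]
        | tmul c d =>
          induction w with
          | zero => simp
          | add a b ha hb => simp only [TensorProduct.add_tmul, mul_add, map_add, ha, hb]
          | tmul a b => simp [antipodeMap_mul, mul_assoc]
      rw [Bialgebra.comul_mul, h1, hb, Bialgebra.counit_mul]
      have h2 : (Algebra.linearMap k (Bos X) (Coalgebra.counit (R := k) b)) ⊗ₜ[k] (1 : Bos X) =
          Coalgebra.counit (R := k) b • (1 : Bos X ⊗[k] Bos X) := by
        simp [Algebra.algebraMap_eq_smul_one, Algebra.TensorProduct.one_def,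
          TensorProduct.smul_tmul']
      rw [h2, mul_smul_comm, mul_one, map_smul, map_smul, ha]
      simp [Algebra.algebraMap_eq_smul_one, smul_smul, mul_comm]

end Bos

end Bosonization

/-! ### Cleft objects and liftings as quotients of `T(V) # H` -/

section Lifting

variable {k : Type*} [Field k] {H : Type*} [Ring H] [HopfAlgebra k H] {θ : ℕ}

/-- The projection of `T(V) # H` onto its quotient by a two-sided ideal. -/
def quot {X : Fin θ → YDPair k H} (I : TwoSidedIdeal (Bos X)) : Bos X →ₐ[k] Bos X ⧸ I.asIdeal :=
  Ideal.Quotient.mkₐ k I.asIdeal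

/-- The comultiplication of `𝒯 = T(V) # H` followed by the projection onto `𝒯/I ⊗ 𝒯/J`. It computes
the coactions and comultiplications of the quotients of `𝒯`. -/
def quotComul {X : Fin θ → YDPair k H} (I J : TwoSidedIdeal (Bos X)) :
    Bos X →ₐ[k] (Bos X ⧸ I.asIdeal) ⊗[k] (Bos X ⧸ J.asIdeal) :=
  (Algebra.TensorProduct.map (quot I) (quot J)).comp (Bialgebra.comulAlgHom k (Bos X))

/-- The group-like element `∏ᵢ gᵢ ^ dᵢ` (the `gᵢ` commute with each other). -/
def groupLike (X : Fin θ → YDPair k H) (d : Fin θ → ℕ) : H :=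
  (List.ofFn fun i => (X i).g ^ d i).prod

/-- The map `h ↦ χ(h₁) h₂` for the character `χ = ∏ᵢ χᵢ ^ dᵢ` (the `χᵢ` commute with each other
under convolution). -/
def twist (X : Fin θ → YDPair k H) (d : Fin θ → ℕ) : Module.End k H :=
  (List.ofFn fun i => (leftTwist (X i).χ : Module.End k H) ^ d i).prod

/-- For a family `rel` of elements of `T(V)` with levels in `ℕ`: the ideal of `T(V) # H` generated by
the relations of level `< n`. The quotient by it is `ℋ_n = 𝔅_n # H`. -/
def preNicholsIdeal (X : Fin θ → YDPair k H) {ι : Type*} (rel : ι → FreeAlgebra k (Fin θ))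
    (level : ι → ℕ) (n : ℕ) : TwoSidedIdeal (Bos X) :=
  TwoSidedIdeal.span {z | ∃ r, level r < n ∧ z = Bos.ofV X (rel r)}

/-- A stratified set `𝒢 = 𝒢_0 ⊔ ⋯ ⊔ 𝒢_{len - 1}` of `ℤ^θ`-homogeneous generators of the ideal `𝒥(V)`
defining the Nichols algebra of `V`, such that the elements of `𝒢_n` are primitive in
`𝔅_n = T(V)/⟨𝒢_0 ∪ ⋯ ∪ 𝒢_{n-1}⟩`, that is, `(g_r, 1)`-primitive in `ℋ_n = 𝔅_n # H`. -/
structure Relations (X : Fin θ → YDPair k H) (ι : Type*) where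
  rel : ι → FreeAlgebra k (Fin θ)
  deg : ι → Fin θ → ℕ
  rel_mem : ∀ r, rel r ∈ homogeneousPart k (deg r)
  level : ι → ℕ
  len : ℕ
  level_lt : ∀ r, level r < len
  primitive : ∀ r,
    quotComul (preNicholsIdeal X rel level (level r)) (preNicholsIdeal X rel level (level r))
        (Bos.ofV X (rel r)) =
      quot _ (Bos.ofV X (rel r)) ⊗ₜ[k] 1 +
        quot _ (Bos.ofH X (groupLike X (deg r))) ⊗ₜ[k] quot _ (Bos.ofV X (rel r))
  generate : ∀ z, z ∈ TwoSidedIdeal.span (Set.range rel) ↔ z ∈ nicholsIdeal (braidingMatrix X)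

namespace Relations

variable {X : Fin θ → YDPair k H} {ι : Type*} (𝒢 : Relations X ι)

/-- The group-like element `g_r`. -/
def g (r : ι) : H := groupLike X (𝒢.deg r)

/-- Let `𝒜 = 𝒯/I` with coaction `ρ : 𝒜 → 𝒜 ⊗ ℋ_n` and `r ∈ 𝒢_n`. The class `r'` of `t` in `𝒜`
satisfies `ρ(r') = r' ⊗ 1 + g_r ⊗ r`, and `H` acts on it by the character `χ_r`, that is,
`h r' = χ_r(h₁) r' h₂`. -/
def IsLift (I : TwoSidedIdeal (Bos X)) (r : ι) (t : Bos X) : Prop :=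
  quotComul I (preNicholsIdeal X 𝒢.rel 𝒢.level (𝒢.level r)) t =
      quot I t ⊗ₜ[k] 1 + quot I (Bos.ofH X (𝒢.g r)) ⊗ₜ[k] quot _ (Bos.ofV X (𝒢.rel r)) ∧
    ∀ h : H, quot I (Bos.ofH X h * t) = quot I (t * Bos.ofH X (twist X (𝒢.deg r) h))

/-- A choice of the elements `r' = γ(r)`, in each quotient `𝒜` of `T(V) # H` in which such an element
exists. (The defining conditions determine `r'` up to an additive constant.) -/
structure Sections where
  lift : TwoSidedIdeal (Bos X) → ι → Bos X
  isLift : ∀ I r, (∃ t, 𝒢.IsLift I r t) → 𝒢.IsLift I r (lift I r)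

variable {𝒢} (γ : 𝒢.Sections) (Λ : ι → k)

/-- The ideals defining `𝒜_n(Λ)`: `𝒜_0 = 𝒯` and `𝒜_{n+1} = 𝒜_n/⟨r' - λ_r : r ∈ 𝒢_n⟩`. -/
def cleftIdeal : ℕ → TwoSidedIdeal (Bos X)
  | 0 => ⊥
  | n + 1 => cleftIdeal n ⊔ TwoSidedIdeal.span
      {z | ∃ r, 𝒢.level r = n ∧ z = γ.lift (cleftIdeal n) r - algebraMap k (Bos X) (Λ r)}

/-- The ideals defining `ℒ_n(Λ)`: `ℒ_0 = 𝒯` and `ℒ_{n+1} = ℒ_n/⟨r̃ - λ_r (1 - g_r) : r ∈ 𝒢_n⟩`, where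
`r̃ ∈ ℒ_n` is determined by `δ(r') = r̃ ⊗ 1 + g_r ⊗ r'` for the coaction
`δ : 𝒜_n → ℒ_n ⊗ 𝒜_n`. -/
def liftingIdeal : ℕ → TwoSidedIdeal (Bos X)
  | 0 => ⊥
  | n + 1 => liftingIdeal n ⊔ TwoSidedIdeal.span
      {z | ∃ r u, 𝒢.level r = n ∧
        quotComul (liftingIdeal n) (cleftIdeal γ Λ n) (γ.lift (cleftIdeal γ Λ n) r) =
          quot _ u ⊗ₜ[k] 1 + quot _ (Bos.ofH X (𝒢.g r)) ⊗ₜ[k]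
            quot _ (γ.lift (cleftIdeal γ Λ n) r) ∧
        z = u - Λ r • (1 - Bos.ofH X (𝒢.g r))}

/-- The set `ℛ` of deformation parameters. -/
def parameters : Set (ι → k) :=
  {Λ | (∀ n ≤ 𝒢.len, cleftIdeal γ Λ n ≠ ⊤) ∧ ∀ r, 𝒢.g r = 1 → Λ r = 0}

/-- The cleft object `𝒜(Λ)`. -/
abbrev Cleft : Type _ := Bos X ⧸ (cleftIdeal γ Λ 𝒢.len).asIdeal

/-- The lifting `ℒ(Λ)`. -/
abbrev Lifting : Type _ := Bos X ⧸ (liftingIdeal γ Λ 𝒢.len).asIdeal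

/-- The ideal of `T(V) # H` defining `ℒ(Λ)` is a Hopf ideal, so that `ℒ(Λ)` is a quotient Hopf
algebra of `T(V) # H`. -/
abbrev IsHopfQuotient : Prop :=
  (liftingIdeal γ Λ 𝒢.len).asIdeal.IsHopfIdeal k

/-- The map `H → ℒ(Λ)`. -/
def Lifting.ofH : H →ₐ[k] Lifting γ Λ := (quot (liftingIdeal γ Λ 𝒢.len)).comp (Bos.ofH X)

/-- The generators `a_i` of `ℒ(Λ)`. -/
def Lifting.a (i : Fin θ) : Lifting γ Λ := quot (liftingIdeal γ Λ 𝒢.len) (Bos.x X i)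

/-- The map `H → 𝒜(Λ)`. -/
def Cleft.ofH : H →ₐ[k] Cleft γ Λ := (quot (cleftIdeal γ Λ 𝒢.len)).comp (Bos.ofH X)

/-- The generators `y_i` of `𝒜(Λ)`. -/
def Cleft.y (i : Fin θ) : Cleft γ Λ := quot (cleftIdeal γ Λ 𝒢.len) (Bos.x X i)

end Relations

end Lifting

/-! ### Lifting data isomorphisms -/

section Isomorphisms

open Relations

variable {k : Type*} [Field k] {H H' : Type*} [Ring H] [HopfAlgebra k H] [Ring H']
  [HopfAlgebra k H'] {θ θ' : ℕ} {X : Fin θ → YDPair k H} {X' : Fin θ' → YDPair k H'}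
  {ι ι' : Type*} {𝒢 : Relations X ι} {𝒢' : Relations X' ι'}

/-- `c = s · Λ^σ` (transported to `H'` along `φ`): the family of scalars `c` such that
`h' ↦ φ⁻¹(h')`, `y'_i ↦ ∑_j s_{ij} y_{σ(j)}` induces an isomorphism `𝒜'(c) ≃ 𝒜(Λ)`. -/
def IsTransform (γ : 𝒢.Sections) (γ' : 𝒢'.Sections) (φ : H ≃ₐc[k] H') (σ : Fin θ' ≃ Fin θ)
    (s : GL (Fin θ') k) (Λ : ι → k) (c : ι' → k) : Prop :=
  ∃ f : Cleft γ' c ≃ₐ[k] Cleft γ Λ,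
    (∀ h, f (Cleft.ofH γ' c (φ h)) = Cleft.ofH γ Λ h) ∧
    ∀ i, f (Cleft.y γ' c i) = ∑ j, s i j • Cleft.y γ Λ (σ j)

/-- `c` and `Λ` have the same lifting: `ℒ(c) = ℒ(Λ)` as quotients of `T(V) # H`. -/
def SameLifting (γ : 𝒢.Sections) (c Λ : ι → k) : Prop :=
  liftingIdeal γ c 𝒢.len = liftingIdeal γ Λ 𝒢.len

/-- Lifting data isomorphisms `(φ, σ, s) : (H, V, Λ) → (H', V', Λ')`. The last condition is
`Λ' = s · Λ^σ`, where the right hand side is normalized: the coordinates of a family of scalars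
at those `r` with `g_r = 1`, which are set to zero in `ℛ'`, do not matter for `ℒ`. -/
structure LiftingDataIso (γ : 𝒢.Sections) (γ' : 𝒢'.Sections) (Λ : ι → k) (Λ' : ι' → k) where
  φ : H ≃ₐc[k] H'
  σ : Fin θ' ≃ Fin θ
  s : GL (Fin θ') k
  s_mem : s ∈ blockGroup X'
  braiding : ∀ i j, braidingMatrix X' i j = braidingMatrix X (σ i) (σ j)
  groupLike : ∀ i, (X' i).g = φ (X (σ i)).g
  character : ∀ i h, (X' i).χ (φ h) = (X (σ i)).χ h
  parameter : ∃ c, IsTransform γ γ' φ σ s Λ c ∧ SameLifting γ' c Λ'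

/-- Two triples that differ by a permutation `τ` preserving the blocks:
`(φ, σ, s)` and `(φ, σ τ, (s_{i τ(j)}))`. -/
def LiftingDataIso.BlockEquiv {γ : 𝒢.Sections} {γ' : 𝒢'.Sections} {Λ : ι → k} {Λ' : ι' → k}
    (a b : LiftingDataIso γ γ' Λ Λ') : Prop :=
  ∃ τ : Equiv.Perm (Fin θ'), (∀ i, τ i ∈ block X' i) ∧
    b.φ = a.φ ∧ b.σ = τ.trans a.σ ∧ ∀ i j, b.s i j = a.s i (τ j)

end Isomorphisms

end DiagonalLifting

end

/-! Write 𝒯 = T(V) # H. The cleft object 𝒜 = 𝒯/I, the graded Hopf algebra 𝒯/K coacting on it from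
the right and the Hopf algebra 𝒯/J coacting on it from the left are all quotients of 𝒯, so the
argument is about triples of two-sided ideals (`IsBigalois`). The coactions are induced by Δ. That 𝒜
is a Galois object on both sides is expressed by two translation maps: t ↦ S(t₁) ⊗ t₂ must kill K
and t ↦ t₁ ⊗ S(t₂) must kill J, with both tensor factors in 𝒜. If I is proper, it follows that
coinvariants are scalars, that a map of Galois objects with nonzero target is injective, and that J
is the kernel of the second map, so I determines J (`IsBigalois.mem_iff`). Imposing the relations of
one stratum preserves the whole package (`IsBigalois.sup`). Since every relation r has a lift r' of
weight χ_r in each nonzero stage (`exists_isLift`), induction gives `isBigalois` and the Hopf ideal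
property of J.

The size of ℒ(Λ) is controlled by skew derivations. They are contractions with functionals, hence
descend to 𝒜. This shows that the leading symbols of J lie in 𝒥(V) # H; conversely each relation r
is the leading symbol of an element of J. So ℒ(Λ) is filtered with associated graded 𝔅(V) # H
(`IsLiftingIdeal`). Consequently H ⊕ V # H embeds in ℒ(Λ), simple subcoalgebras lie in H, and
skew-primitive elements have degree at most one. A cosemisimple H has only trivial skew-primitives,
and q_ii ≠ 1 because 𝔅(V) is finite-dimensional in characteristic zero. Together this shows that a
(g, χ)-skew-primitive element with χ(g) ≠ 1 is a combination of the a_j with (g_j, χ_j) = (g, χ)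
(`exists_eq_sum`).

An isomorphism of liftings therefore restricts to an isomorphism of H with H' and is linear on the
generators. A nonzero term of the determinant of its matrix provides σ, and the permuted matrix s is
supported on blocks. The matrix defines an isomorphism of bosonizations. The preimage of 𝒜(Λ) under
it is a biGalois object over 𝔅(V') # H', hence equal to some 𝒜(c) (`exists_cleftIdeal_eq`), and its
left Hopf algebra is ℒ(c). In the other direction an isomorphism 𝒜(c) ≃ 𝒜(Λ) identifies the left
Hopf algebras, again because I determines J. Finally the a_j are linearly independent, so an
isomorphism determines φ and the matrix, and the matrix determines (σ, s) up to a permutation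
preserving blocks. -/

open scoped TensorProduct Polynomial

noncomputable section

namespace DiagonalLifting

/-! ### Translation maps and Galois objects over a Hopf algebra -/

section Translation

variable {k : Type*} [Field k] {T : Type*} [Ring T] [HopfAlgebra k T]
  {A B L P Q : Type*} [Ring A] [Algebra k A] [Ring B] [Algebra k B] [Ring L] [Algebra k L]
  [Ring P] [Algebra k P] [Ring Q] [Algebra k Q]

/-- `t ↦ p(t₁) ⊗ q(t₂)`. -/
def coact (p : T →ₐ[k] P) (q : T →ₐ[k] Q) : T →ₐ[k] P ⊗[k] Q :=
  (Algebra.TensorProduct.map p q).comp (Bialgebra.comulAlgHom k T)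

/-- `t ↦ p(S(t₁)) ⊗ q(t₂)`. -/
def transl (p : T →ₐ[k] P) (q : T →ₐ[k] Q) : T →ₐ[k] Pᵐᵒᵖ ⊗[k] Q :=
  (Algebra.TensorProduct.map ((AlgHom.op p).comp (HopfAlgebra.antipodeAlgHomOp k T)) q).comp
    (Bialgebra.comulAlgHom k T)

/-- `t ↦ p(t₁) ⊗ q(S(t₂))`. -/
def cotransl (p : T →ₐ[k] P) (q : T →ₐ[k] Q) : T →ₐ[k] P ⊗[k] Qᵐᵒᵖ :=
  (Algebra.TensorProduct.map p ((AlgHom.op q).comp (HopfAlgebra.antipodeAlgHomOp k T))).comp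
    (Bialgebra.comulAlgHom k T)

lemma coact_eq (p : T →ₐ[k] P) (q : T →ₐ[k] Q) (t : T) :
    coact p q t = TensorProduct.map p.toLinearMap q.toLinearMap (Coalgebra.comul (R := k) t) :=
  rfl

/-- The linear form supports induction on tensors. The algebra form, which needs the opposite
algebra because the antipode reverses products, makes the kernel a two-sided ideal, so vanishing on
an ideal can be tested on generators. -/
lemma transl_eq (p : T →ₐ[k] P) (q : T →ₐ[k] Q) (t : T) :
    transl p q t = TensorProduct.map ((MulOpposite.opLinearEquiv k).toLinearMap ∘ₗ p.toLinearMap ∘ₗ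
      HopfAlgebra.antipode k) q.toLinearMap (Coalgebra.comul (R := k) t) :=
  rfl

lemma cotransl_eq (p : T →ₐ[k] P) (q : T →ₐ[k] Q) (t : T) :
    cotransl p q t = TensorProduct.map p.toLinearMap ((MulOpposite.opLinearEquiv k).toLinearMap ∘ₗ
      q.toLinearMap ∘ₗ HopfAlgebra.antipode k) (Coalgebra.comul (R := k) t) :=
  rfl

lemma coact_groupLike (p : T →ₐ[k] P) (q : T →ₐ[k] Q) {g : T} (hg : IsGroupLikeElem k g) :
    coact p q g = p g ⊗ₜ q g := by
  simp [coact_eq, hg.comul_eq_tmul_self]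

lemma transl_groupLike (p : T →ₐ[k] P) (q : T →ₐ[k] Q) {g : T} (hg : IsGroupLikeElem k g) :
    transl p q g = MulOpposite.op (p (HopfAlgebra.antipode k g)) ⊗ₜ q g := by
  simp [transl_eq, hg.comul_eq_tmul_self]

variable (k P Q) in
/-- `x ⊗ (y ⊗ z) ↦ x y ⊗ z`. -/
def insertLeft : P ⊗[k] (Pᵐᵒᵖ ⊗[k] Q) →ₗ[k] P ⊗[k] Q :=
  LinearMap.rTensor Q (LinearMap.mul' k P ∘ₗ
    LinearMap.lTensor P (MulOpposite.opLinearEquiv k).symm.toLinearMap) ∘ₗ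
    (TensorProduct.assoc k P Pᵐᵒᵖ Q).symm.toLinearMap

@[simp] lemma insertLeft_tmul (x : P) (y : Pᵐᵒᵖ) (z : Q) :
    insertLeft k P Q (x ⊗ₜ (y ⊗ₜ z)) = (x * y.unop) ⊗ₜ z := by
  simp [insertLeft]

variable (k P Q) in
/-- `(x ⊗ y) ⊗ z ↦ x ⊗ y z`. -/
def insertRight : (P ⊗[k] Qᵐᵒᵖ) ⊗[k] Q →ₗ[k] P ⊗[k] Q :=
  LinearMap.lTensor P (LinearMap.mul' k Q ∘ₗ
    LinearMap.rTensor Q (MulOpposite.opLinearEquiv k).symm.toLinearMap) ∘ₗ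
    (TensorProduct.assoc k P Qᵐᵒᵖ Q).toLinearMap

@[simp] lemma insertRight_tmul (x : P) (y : Qᵐᵒᵖ) (z : Q) :
    insertRight k P Q ((x ⊗ₜ y) ⊗ₜ z) = x ⊗ₜ (y.unop * z) := by
  simp [insertRight]

variable (k P Q) in
/-- `(x ⊗ y) ⊗ z ↦ x ⊗ z y`, for the opposite multiplication. -/
def absorbRight : (P ⊗[k] Q) ⊗[k] Qᵐᵒᵖ →ₗ[k] P ⊗[k] Q :=
  LinearMap.lTensor P (LinearMap.mul' k Q ∘ₗ
    LinearMap.lTensor Q (MulOpposite.opLinearEquiv k).symm.toLinearMap) ∘ₗ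
    (TensorProduct.assoc k P Q Qᵐᵒᵖ).toLinearMap

@[simp] lemma absorbRight_tmul (x : P) (y : Q) (z : Qᵐᵒᵖ) :
    absorbRight k P Q ((x ⊗ₜ y) ⊗ₜ z) = x ⊗ₜ (y * z.unop) := by
  simp [absorbRight]

/-- `t₁ S(t₂) ⊗ t₃ = 1 ⊗ t`. -/
lemma insertLeft_transl (p : T →ₐ[k] P) (q : T →ₐ[k] Q) (t : T) :
    insertLeft k P Q (TensorProduct.map p.toLinearMap (transl p q).toLinearMap
      (Coalgebra.comul (R := k) t)) = 1 ⊗ₜ q t := by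
  have h1 : ∀ z : T ⊗[k] T, insertLeft k P Q
      (TensorProduct.map p.toLinearMap (transl p q).toLinearMap z) =
      TensorProduct.map (p.toLinearMap ∘ₗ LinearMap.mul' k T ∘ₗ
        LinearMap.lTensor T (HopfAlgebra.antipode k)) q.toLinearMap
        ((TensorProduct.assoc k T T T).symm (LinearMap.lTensor T Coalgebra.comul z)) := by
    intro z
    induction z with
    | zero => simp
    | add a b ha hb => simp only [map_add, ha, hb]
    | tmul a b =>
      simp only [TensorProduct.map_tmul, LinearMap.lTensor_tmul, AlgHom.toLinearMap_apply, transl_eq]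
      generalize Coalgebra.comul (R := k) b = w
      induction w with
      | zero => simp
      | add a b ha hb => simp only [map_add, TensorProduct.tmul_add, ha, hb]
      | tmul c d => simp
  have h2 : ∀ z : T ⊗[k] T, TensorProduct.map (p.toLinearMap ∘ₗ LinearMap.mul' k T ∘ₗ
        LinearMap.lTensor T (HopfAlgebra.antipode k)) q.toLinearMap
        (LinearMap.rTensor T Coalgebra.comul z) =
      1 ⊗ₜ q (TensorProduct.lid k T (LinearMap.rTensor T Coalgebra.counit z)) := by
    intro z
    induction z with
    | zero => simp
    | add a b ha hb => simp only [map_add, TensorProduct.tmul_add, ha, hb]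
    | tmul a b =>
      simp only [LinearMap.rTensor_tmul, TensorProduct.map_tmul, LinearMap.comp_apply,
        HopfAlgebra.mul_antipode_lTensor_comul_apply]
      simp [Algebra.algebraMap_eq_smul_one, TensorProduct.smul_tmul']
  rw [h1, Coalgebra.coassoc_symm_apply, h2, Coalgebra.rTensor_counit_comul]
  simp

/-- `t₁ ⊗ S(t₂) t₃ = t ⊗ 1`. -/
lemma insertRight_cotransl (p : T →ₐ[k] P) (q : T →ₐ[k] Q) (t : T) :
    insertRight k P Q (TensorProduct.map (cotransl p q).toLinearMap q.toLinearMap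
      (Coalgebra.comul (R := k) t)) = p t ⊗ₜ 1 := by
  have h1 : ∀ z : T ⊗[k] T, insertRight k P Q
      (TensorProduct.map (cotransl p q).toLinearMap q.toLinearMap z) =
      TensorProduct.map p.toLinearMap (q.toLinearMap ∘ₗ LinearMap.mul' k T ∘ₗ
        LinearMap.rTensor T (HopfAlgebra.antipode k))
        (TensorProduct.assoc k T T T (LinearMap.rTensor T Coalgebra.comul z)) := by
    intro z
    induction z with
    | zero => simp
    | add a b ha hb => simp only [map_add, ha, hb]
    | tmul a b =>
      simp only [TensorProduct.map_tmul, LinearMap.rTensor_tmul, AlgHom.toLinearMap_apply,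
        cotransl_eq]
      generalize Coalgebra.comul (R := k) a = w
      induction w with
      | zero => simp
      | add a b ha hb => simp only [map_add, TensorProduct.add_tmul, ha, hb]
      | tmul c d => simp
  have h2 : ∀ z : T ⊗[k] T, TensorProduct.map p.toLinearMap (q.toLinearMap ∘ₗ LinearMap.mul' k T ∘ₗ
        LinearMap.rTensor T (HopfAlgebra.antipode k))
        (LinearMap.lTensor T Coalgebra.comul z) =
      p (TensorProduct.rid k T (LinearMap.lTensor T Coalgebra.counit z)) ⊗ₜ 1 := by
    intro z
    induction z with
    | zero => simp
    | add a b ha hb => simp only [map_add, TensorProduct.add_tmul, ha, hb]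
    | tmul a b =>
      simp only [LinearMap.lTensor_tmul, TensorProduct.map_tmul, LinearMap.comp_apply,
        HopfAlgebra.mul_antipode_rTensor_comul_apply]
      simp [Algebra.algebraMap_eq_smul_one, TensorProduct.smul_tmul']
  rw [h1, Coalgebra.coassoc_apply, h2, Coalgebra.lTensor_counit_comul]
  simp

/-- `t₁ ⊗ t₂ S(t₃) = t ⊗ 1`. -/
lemma absorbRight_coact (p : T →ₐ[k] P) (q : T →ₐ[k] Q) (t : T) :
    absorbRight k P Q (TensorProduct.map (coact p q).toLinearMap
      ((MulOpposite.opLinearEquiv k).toLinearMap ∘ₗ q.toLinearMap ∘ₗ HopfAlgebra.antipode k)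
      (Coalgebra.comul (R := k) t)) = p t ⊗ₜ 1 := by
  have h1 : ∀ z : T ⊗[k] T, absorbRight k P Q
      (TensorProduct.map (coact p q).toLinearMap
        ((MulOpposite.opLinearEquiv k).toLinearMap ∘ₗ q.toLinearMap ∘ₗ HopfAlgebra.antipode k) z) =
      TensorProduct.map p.toLinearMap (q.toLinearMap ∘ₗ LinearMap.mul' k T ∘ₗ
        LinearMap.lTensor T (HopfAlgebra.antipode k))
        (TensorProduct.assoc k T T T (LinearMap.rTensor T Coalgebra.comul z)) := by
    intro z
    induction z with
    | zero => simp
    | add a b ha hb => simp only [map_add, ha, hb]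
    | tmul a b =>
      simp only [TensorProduct.map_tmul, LinearMap.rTensor_tmul, AlgHom.toLinearMap_apply,
        coact_eq]
      generalize Coalgebra.comul (R := k) a = w
      induction w with
      | zero => simp
      | add a b ha hb => simp only [map_add, TensorProduct.add_tmul, ha, hb]
      | tmul c d => simp
  have h2 : ∀ z : T ⊗[k] T, TensorProduct.map p.toLinearMap (q.toLinearMap ∘ₗ LinearMap.mul' k T ∘ₗ
        LinearMap.lTensor T (HopfAlgebra.antipode k))
        (LinearMap.lTensor T Coalgebra.comul z) =
      p (TensorProduct.rid k T (LinearMap.lTensor T Coalgebra.counit z)) ⊗ₜ 1 := by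
    intro z
    induction z with
    | zero => simp
    | add a b ha hb => simp only [map_add, TensorProduct.add_tmul, ha, hb]
    | tmul a b =>
      simp only [LinearMap.lTensor_tmul, TensorProduct.map_tmul, LinearMap.comp_apply,
        HopfAlgebra.mul_antipode_lTensor_comul_apply]
      simp [Algebra.algebraMap_eq_smul_one, TensorProduct.smul_tmul']
  rw [h1, Coalgebra.coassoc_apply, h2, Coalgebra.lTensor_counit_comul]
  simp

/-- A linear map that vanishes on the kernel of a linear surjection factors through it. -/
lemma exists_factor {M N : Type*} [AddCommGroup M] [Module k M] [AddCommGroup N] [Module k N]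
    {V : Type*} [AddCommGroup V] [Module k V]
    {p : M →ₗ[k] N} (hp : Function.Surjective p) (f : M →ₗ[k] V) (hf : ∀ t, p t = 0 → f t = 0) :
    ∃ g : N →ₗ[k] V, ∀ t, g (p t) = f t := by
  obtain ⟨s, hs⟩ := p.exists_rightInverse_of_surjective (LinearMap.range_eq_top.mpr hp)
  refine ⟨f ∘ₗ s, fun t => ?_⟩
  have : p (s (p t) - t) = 0 := by
    rw [map_sub, ← LinearMap.comp_apply p s, hs]; simp
  have := hf _ this
  rw [map_sub, sub_eq_zero] at this
  exact this

/-- Nonvanishing of a quotient enters below through such a functional: applied to one factor of 1 ⊗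
y it returns y. -/
lemma exists_functional_one (A : Type*) [Ring A] [Algebra k A] [Nontrivial A] :
    ∃ f : A →ₗ[k] k, f 1 = 1 := by
  obtain ⟨f, hf⟩ := LinearMap.exists_leftInverse_of_injective (Algebra.linearMap k A)
    (LinearMap.ker_eq_bot.mpr (algebraMap k A).injective)
  refine ⟨f, ?_⟩
  have := LinearMap.congr_fun hf 1
  simpa using this

/-- Functoriality for maps known only by their values along `p` and `q`. This is how computations
move between the tensor square of 𝒯 and those of its quotients. -/
lemma map_factor {M N M' N' V W : Type*} [AddCommGroup M] [Module k M] [AddCommGroup N]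
    [Module k N] [AddCommGroup M'] [Module k M'] [AddCommGroup N'] [Module k N']
    [AddCommGroup V] [Module k V] [AddCommGroup W] [Module k W]
    {p : M →ₗ[k] M'} {q : N →ₗ[k] N'} {f : M →ₗ[k] V} {h : N →ₗ[k] W} {f' : M' →ₗ[k] V}
    {h' : N' →ₗ[k] W} (hf : ∀ t, f' (p t) = f t) (hh : ∀ t, h' (q t) = h t) (z : M ⊗[k] N) :
    TensorProduct.map f' h' (TensorProduct.map p q z) = TensorProduct.map f h z := by
  induction z with
  | zero => simp
  | add a b ha hb => simp only [map_add, ha, hb]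
  | tmul a b => simp [hf, hh]

/-- The coinvariants of a nonzero Galois object are the scalars. -/
lemma exists_scalar_of_coact {a : T →ₐ[k] A} {b : T →ₐ[k] B} [Nontrivial A]
    (hb : Function.Surjective b) (htr : ∀ t, b t = 0 → transl a a t = 0) {t : T}
    (ht : coact a b t = a t ⊗ₜ 1) : ∃ c : k, a t = algebraMap k A c := by
  obtain ⟨l, hl⟩ := exists_factor (p := b.toLinearMap) hb (transl a a).toLinearMap htr
  obtain ⟨f, hf⟩ := exists_functional_one (k := k) A
  -- Since the translation map factors through `b`, the identity t₁ S(t₂) ⊗ t₃ = 1 ⊗ t depends on t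
  -- only through its coaction. A coinvariant thus satisfies t ⊗ 1 = 1 ⊗ t in A ⊗ A, and `f` on the
  -- first factor makes it a scalar.
  have h1 := insertLeft_transl a a t
  rw [← map_factor (p := a.toLinearMap) (q := b.toLinearMap) (f' := LinearMap.id)
    (fun t => rfl) hl, ← coact_eq, ht, TensorProduct.map_tmul] at h1
  have h2 : l 1 = 1 := by
    have := hl 1
    simpa using this
  rw [h2, Algebra.TensorProduct.one_def] at h1
  refine ⟨f (a t), ?_⟩
  have h3 := congrArg (fun z => TensorProduct.lid k A (LinearMap.rTensor A f z)) h1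
  simp [hf] at h3
  rw [Algebra.algebraMap_eq_smul_one, h3]

lemma transl_map {P' Q' : Type*} [Ring P'] [Algebra k P'] [Ring Q'] [Algebra k Q']
    {p : T →ₐ[k] P} {q : T →ₐ[k] Q} {p' : T →ₐ[k] P'} {q' : T →ₐ[k] Q'} {e : P →ₗ[k] P'}
    {f : Q →ₗ[k] Q'} (he : ∀ t, e (p t) = p' t) (hf : ∀ t, f (q t) = q' t) (t : T) :
    TensorProduct.map ((MulOpposite.opLinearEquiv k).toLinearMap ∘ₗ e ∘ₗ
      (MulOpposite.opLinearEquiv k).symm.toLinearMap) f (transl p q t) = transl p' q' t := by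
  rw [transl_eq, transl_eq]
  exact map_factor (fun t => by simp [he]) hf _

lemma cotransl_map {P' Q' : Type*} [Ring P'] [Algebra k P'] [Ring Q'] [Algebra k Q']
    {p : T →ₐ[k] P} {q : T →ₐ[k] Q} {p' : T →ₐ[k] P'} {q' : T →ₐ[k] Q'} {e : P →ₗ[k] P'}
    {f : Q →ₗ[k] Q'} (he : ∀ t, e (p t) = p' t) (hf : ∀ t, f (q t) = q' t) (t : T) :
    TensorProduct.map e ((MulOpposite.opLinearEquiv k).toLinearMap ∘ₗ f ∘ₗ
      (MulOpposite.opLinearEquiv k).symm.toLinearMap) (cotransl p q t) = cotransl p' q' t := by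
  rw [cotransl_eq, cotransl_eq]
  exact map_factor he (fun t => by simp [hf]) _

lemma coact_map {P' Q' : Type*} [Ring P'] [Algebra k P'] [Ring Q'] [Algebra k Q']
    {p : T →ₐ[k] P} {q : T →ₐ[k] Q} {p' : T →ₐ[k] P'} {q' : T →ₐ[k] Q'} {e : P →ₗ[k] P'}
    {f : Q →ₗ[k] Q'} (he : ∀ t, e (p t) = p' t) (hf : ∀ t, f (q t) = q' t) (t : T) :
    TensorProduct.map e f (coact p q t) = coact p' q' t := by
  rw [coact_eq, coact_eq]
  exact map_factor he hf _

/-- If `ρ(t) = t ⊗ 1 + g ⊗ r`, then the translation map sends `r` to `g⁻¹ ⊗ t - g⁻¹ t ⊗ 1`. -/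
lemma insertLeft_transl_of_coact {a : T →ₐ[k] A} {b : T →ₐ[k] B}
    (hb : Function.Surjective b) (htr : ∀ t, b t = 0 → transl a a t = 0) {t r g : T}
    (ht : coact a b t = a t ⊗ₜ 1 + a g ⊗ₜ b r) :
    a t ⊗ₜ 1 + insertLeft k A A (a g ⊗ₜ transl a a r) = 1 ⊗ₜ[k] a t := by
  obtain ⟨l, hl⟩ := exists_factor (p := b.toLinearMap) hb (transl a a).toLinearMap htr
  have h1 := insertLeft_transl a a t
  rw [← map_factor (p := a.toLinearMap) (q := b.toLinearMap) (f' := LinearMap.id)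
    (fun t => rfl) hl, ← coact_eq, ht, map_add, TensorProduct.map_tmul, TensorProduct.map_tmul]
    at h1
  have h2 : l 1 = 1 := by
    have := hl 1
    simpa using this
  have h3 : l (b r) = transl a a r := hl r
  rw [h2, h3, Algebra.TensorProduct.one_def] at h1
  simpa using h1

/-- Once t becomes a scalar, t ⊗ 1 and 1 ⊗ t agree, so the translation of r vanishes after
multiplication by the unit g. Imposing t = c on the Galois object is thus compatible with imposing r
= 0 on the Hopf algebra coacting from the right. -/
lemma transl_eq_zero_of_coact {A' : Type*} [Ring A'] [Algebra k A'] {a : T →ₐ[k] A}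
    {a' : T →ₐ[k] A'} {b : T →ₐ[k] B} (ha : Function.Surjective a)
    (haa : ∀ t, a t = 0 → a' t = 0) (hb : Function.Surjective b)
    (htr : ∀ t, b t = 0 → transl a a t = 0) {t r g : T} (hg : IsGroupLikeElem k g)
    (ht : coact a b t = a t ⊗ₜ 1 + a g ⊗ₜ b r) {c : k} (hc : a' t = algebraMap k A' c) :
    transl a' a' r = 0 := by
  obtain ⟨e, he⟩ := exists_factor (p := a.toLinearMap) ha a'.toLinearMap haa
  have he1 : e 1 = 1 := by
    have := he 1
    simpa using this
  have h1 := congrArg (TensorProduct.map e e) (insertLeft_transl_of_coact hb htr ht)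
  have h3 : TensorProduct.map e e (insertLeft k A A (a g ⊗ₜ transl a a r)) =
      insertLeft k A' A' (a' g ⊗ₜ transl a' a' r) := by
    rw [transl_eq, transl_eq]
    generalize Coalgebra.comul (R := k) r = w
    induction w with
    | zero => simp
    | add x y hx hy => simp only [map_add, TensorProduct.tmul_add, hx, hy]
    | tmul x y =>
      have h4 : e (a g * a (HopfAlgebra.antipode k x)) = a' g * a' (HopfAlgebra.antipode k x) := by
        rw [← map_mul, ← map_mul]; exact he _
      have h5 : e (a y) = a' y := he y
      simp [h4, h5]
  rw [map_add, h3, TensorProduct.map_tmul, TensorProduct.map_tmul, he1] at h1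
  have h4 : e (a t) = algebraMap k A' c := (he t).trans hc
  rw [h4, Algebra.algebraMap_eq_smul_one, TensorProduct.smul_tmul, add_eq_left] at h1
  -- Left multiplication by S(g) undoes the insertion of g.
  have h6 : ∀ z : A'ᵐᵒᵖ ⊗[k] A', LinearMap.rTensor A' (MulOpposite.opLinearEquiv k).toLinearMap
      (LinearMap.rTensor A' (LinearMap.mulLeft k (a' (HopfAlgebra.antipode k g)))
      (insertLeft k A' A' (a' g ⊗ₜ z))) = z := by
    intro z
    induction z with
    | zero => simp
    | add x y hx hy => simp only [map_add, TensorProduct.tmul_add, hx, hy]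
    | tmul x y =>
      simp only [insertLeft_tmul, LinearMap.rTensor_tmul, LinearMap.mulLeft_apply, ← mul_assoc,
        ← map_mul, hg.antipode_mul_cancel]
      simp
  rw [← h6 (transl a' a' r), h1]
  simp

/-- The identity t₁ ⊗ S(t₂) t₃ = t ⊗ 1, evaluated on δ(t) = u ⊗ 1 + g ⊗ t. -/
lemma insertRight_cotransl_of_coact {a : T →ₐ[k] A} {l : T →ₐ[k] L}
    (hl : Function.Surjective l) (hct : ∀ t, l t = 0 → cotransl a a t = 0) {t u g : T}
    (ht : coact l a t = l u ⊗ₜ 1 + l g ⊗ₜ a t) :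
    insertRight k A A (cotransl a a u ⊗ₜ 1) + insertRight k A A (cotransl a a g ⊗ₜ a t) =
      a t ⊗ₜ[k] 1 := by
  obtain ⟨f, hf⟩ := exists_factor (p := l.toLinearMap) hl (cotransl a a).toLinearMap hct
  have h1 := insertRight_cotransl a a t
  rw [← map_factor (p := l.toLinearMap) (q := a.toLinearMap) (h' := LinearMap.id) hf
    (fun t => rfl), ← coact_eq, ht, map_add, TensorProduct.map_tmul, TensorProduct.map_tmul,
    map_add] at h1
  have h3 : f (l u) = cotransl a a u := hf u
  have h4 : f (l g) = cotransl a a g := hf g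
  rwa [h3, h4] at h1

/-- Let κ be the map t ↦ t₁ ⊗ S(t₂). If t becomes the scalar c, the preceding identity reads κ(u) +
c κ(g) = c. This is why the relation imposed on the left Hopf algebra is u = c (1 - g). -/
lemma cotransl_eq_zero_of_coact {A' : Type*} [Ring A'] [Algebra k A'] {a : T →ₐ[k] A}
    {a' : T →ₐ[k] A'} {l : T →ₐ[k] L} (ha : Function.Surjective a)
    (haa : ∀ t, a t = 0 → a' t = 0) (hl : Function.Surjective l)
    (hct : ∀ t, l t = 0 → cotransl a a t = 0) {t u g : T}
    (ht : coact l a t = l u ⊗ₜ 1 + l g ⊗ₜ a t) {c : k} (hc : a' t = algebraMap k A' c) :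
    cotransl a' a' (u - c • (1 - g)) = 0 := by
  obtain ⟨e, he⟩ := exists_factor (p := a.toLinearMap) ha a'.toLinearMap haa
  have he1 : e 1 = 1 := by
    have := he 1
    simpa using this
  have h1 := congrArg (TensorProduct.map e e) (insertRight_cotransl_of_coact hl hct ht)
  have h3 : ∀ u s, TensorProduct.map e e (insertRight k A A (cotransl a a u ⊗ₜ a s)) =
      insertRight k A' A' (cotransl a' a' u ⊗ₜ a' s) := by
    intro u s
    rw [cotransl_eq, cotransl_eq]
    generalize Coalgebra.comul (R := k) u = w
    induction w with
    | zero => simp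
    | add x y hx hy => simp only [map_add, TensorProduct.add_tmul, hx, hy]
    | tmul x y =>
      have h4 : e (a (HopfAlgebra.antipode k y) * a s) = a' (HopfAlgebra.antipode k y) * a' s := by
        rw [← map_mul, ← map_mul]; exact he _
      have h5 : e (a x) = a' x := he x
      simp [h4, h5]
  have h3' := h3 u 1
  rw [map_one, map_one] at h3'
  have h4 : e (a t) = algebraMap k A' c := (he t).trans hc
  rw [map_add, h3, h3', TensorProduct.map_tmul, he1, hc, h4, Algebra.algebraMap_eq_smul_one,
    TensorProduct.tmul_smul, map_smul] at h1
  have h6 : ∀ z : A' ⊗[k] A'ᵐᵒᵖ, LinearMap.lTensor A' (MulOpposite.opLinearEquiv k).toLinearMap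
      (insertRight k A' A' (z ⊗ₜ 1)) = z := by
    intro z
    induction z with
    | zero => simp
    | add x y hx hy => simp only [map_add, TensorProduct.add_tmul, hx, hy]
    | tmul x y => simp
  have h7 := congrArg (LinearMap.lTensor A' (MulOpposite.opLinearEquiv k).toLinearMap) h1
  rw [map_add, map_smul, h6, h6] at h7
  rw [map_sub, map_smul, map_sub, map_one, eq_sub_of_add_eq h7]
  simp [smul_sub, Algebra.TensorProduct.one_def, TensorProduct.smul_tmul']

/-- The kernel of `t ↦ a(t₁) ⊗ a(S(t₂))` is contained in that of `l`, if `a` coacts from the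
left. -/
lemma eq_zero_of_cotransl {a : T →ₐ[k] A} [Nontrivial A] {l : T →ₐ[k] L}
    (ha : Function.Surjective a) (hd : ∀ t, a t = 0 → coact l a t = 0) {t : T}
    (ht : cotransl a a t = 0) : l t = 0 := by
  obtain ⟨d, hd⟩ := exists_factor (p := a.toLinearMap) ha (coact l a).toLinearMap hd
  obtain ⟨f, hf⟩ := exists_functional_one (k := k) A
  -- In t₁ ⊗ t₂ S(t₃) = t ⊗ 1 the left side is obtained from t₁ ⊗ S(t₂) by applying the coaction to
  -- the first factor, hence it vanishes.
  have h1 := absorbRight_coact l a t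
  rw [← map_factor (p := a.toLinearMap) (q := (MulOpposite.opLinearEquiv k).toLinearMap ∘ₗ
    a.toLinearMap ∘ₗ HopfAlgebra.antipode k) (h' := LinearMap.id) hd (fun t => rfl),
    ← cotransl_eq, ht, map_zero, map_zero] at h1
  have h3 := congrArg (fun z => TensorProduct.rid k L (LinearMap.lTensor L f z)) h1
  simpa [hf] using h3.symm

/-- A morphism between Galois objects with nonzero target is injective. -/
lemma eq_zero_of_galois {A' : Type*} [Ring A'] [Algebra k A'] [Nontrivial A'] {a : T →ₐ[k] A}
    {a' : T →ₐ[k] A'} {b : T →ₐ[k] B} (ha : Function.Surjective a)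
    (haa : ∀ t, a t = 0 → a' t = 0) (hb : Function.Surjective b)
    (htr : ∀ t, b t = 0 → transl a a t = 0) (hco : ∀ t, a' t = 0 → coact a' b t = 0) {t : T}
    (ht : a' t = 0) : a t = 0 := by
  obtain ⟨e, he⟩ := exists_factor (p := a.toLinearMap) ha a'.toLinearMap haa
  obtain ⟨f, hf⟩ := exists_functional_one (k := k) A'
  -- The mixed translation map into A'ᵒᵖ ⊗ A is the image of that of A under `e`, so it also factors
  -- through `b`. Then 1 ⊗ a(t) can be computed from the coaction of a'(t).
  obtain ⟨m, hm⟩ := exists_factor (p := b.toLinearMap) hb (transl a' a).toLinearMap (by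
    intro s hs
    have := transl_map (q := a) (p' := a') (q' := a) he (f := LinearMap.id) (fun t => rfl) s
    rw [htr s hs, map_zero] at this
    exact this.symm)
  have h1 := insertLeft_transl a' a t
  rw [← map_factor (p := a'.toLinearMap) (q := b.toLinearMap) (f' := LinearMap.id)
    (fun t => rfl) hm, ← coact_eq, hco t ht, map_zero, map_zero] at h1
  have h3 := congrArg (fun z => TensorProduct.lid k A (LinearMap.rTensor A f z)) h1
  simpa [hf] using h3.symm

/-- `t ↦ ξ(t₁) t₂`. -/
def lcontr (ξ : T →ₗ[k] k) : T →ₗ[k] T :=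
  (TensorProduct.lid k T).toLinearMap ∘ₗ LinearMap.rTensor T ξ ∘ₗ Coalgebra.comul

/-- `t ↦ t₁ ξ(t₂)`. -/
def rcontr (ξ : T →ₗ[k] k) : T →ₗ[k] T :=
  (TensorProduct.rid k T).toLinearMap ∘ₗ LinearMap.lTensor T ξ ∘ₗ Coalgebra.comul

lemma comul_lcontr (ξ : T →ₗ[k] k) (t : T) :
    Coalgebra.comul (R := k) (lcontr ξ t) =
      LinearMap.rTensor T (lcontr ξ) (Coalgebra.comul (R := k) t) := by
  have h1 : ∀ z : T ⊗[k] T, Coalgebra.comul (R := k) (TensorProduct.lid k T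
      (LinearMap.rTensor T ξ z)) = TensorProduct.lid k (T ⊗[k] T) (LinearMap.rTensor (T ⊗[k] T) ξ
        (LinearMap.lTensor T Coalgebra.comul z)) := by
    intro z
    induction z with
    | zero => simp
    | add a b ha hb => simp only [map_add, ha, hb]
    | tmul a b => simp
  have h2 : ∀ z : T ⊗[k] T, LinearMap.rTensor T (lcontr ξ) z =
      TensorProduct.lid k (T ⊗[k] T) (LinearMap.rTensor (T ⊗[k] T) ξ
        (TensorProduct.assoc k T T T (LinearMap.rTensor T Coalgebra.comul z))) := by
    intro z
    induction z with
    | zero => simp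
    | add a b ha hb => simp only [map_add, ha, hb]
    | tmul a b =>
      simp only [LinearMap.rTensor_tmul, lcontr, LinearMap.comp_apply]
      generalize Coalgebra.comul (R := k) a = w
      induction w with
      | zero => simp
      | add a b ha hb => simp only [map_add, TensorProduct.add_tmul, ha, hb]
      | tmul c d => simp [TensorProduct.smul_tmul']
  rw [h2, Coalgebra.coassoc_apply]
  exact h1 _

lemma comul_rcontr (ξ : T →ₗ[k] k) (t : T) :
    Coalgebra.comul (R := k) (rcontr ξ t) =
      LinearMap.lTensor T (rcontr ξ) (Coalgebra.comul (R := k) t) := by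
  have h1 : ∀ z : T ⊗[k] T, Coalgebra.comul (R := k) (TensorProduct.rid k T
      (LinearMap.lTensor T ξ z)) = TensorProduct.rid k (T ⊗[k] T) (LinearMap.lTensor (T ⊗[k] T) ξ
        (LinearMap.rTensor T Coalgebra.comul z)) := by
    intro z
    induction z with
    | zero => simp
    | add a b ha hb => simp only [map_add, ha, hb]
    | tmul a b => simp
  have h2 : ∀ z : T ⊗[k] T, LinearMap.lTensor T (rcontr ξ) z =
      TensorProduct.rid k (T ⊗[k] T) (LinearMap.lTensor (T ⊗[k] T) ξ
        ((TensorProduct.assoc k T T T).symm (LinearMap.lTensor T Coalgebra.comul z))) := by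
    intro z
    induction z with
    | zero => simp
    | add a b ha hb => simp only [map_add, ha, hb]
    | tmul a b =>
      simp only [LinearMap.lTensor_tmul, rcontr, LinearMap.comp_apply]
      generalize Coalgebra.comul (R := k) b = w
      induction w with
      | zero => simp
      | add a b ha hb => simp only [map_add, TensorProduct.tmul_add, ha, hb]
      | tmul c d => simp
  rw [h2, Coalgebra.coassoc_symm_apply]
  exact h1 _

/-- Functionals that vanish on the kernel of `b` preserve the kernel of `a`. -/
lemma rcontr_mem {a : T →ₐ[k] A} {b : T →ₐ[k] B} (hb : Function.Surjective b) {t : T}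
    (ht : coact a b t = 0) {ξ : T →ₗ[k] k} (hξ : ∀ t, b t = 0 → ξ t = 0) : a (rcontr ξ t) = 0 := by
  obtain ⟨η, hη⟩ := exists_factor (p := b.toLinearMap) hb ξ hξ
  have h1 : ∀ z : T ⊗[k] T, a (TensorProduct.rid k T (LinearMap.lTensor T ξ z)) =
      TensorProduct.rid k A (TensorProduct.map a.toLinearMap ξ z) := by
    intro z
    induction z with
    | zero => simp
    | add a b ha hb => simp only [map_add, ha, hb]
    | tmul a b => simp
  refine (h1 _).trans ?_
  rw [← map_factor (p := a.toLinearMap) (q := b.toLinearMap) (f' := LinearMap.id)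
    (fun t => rfl) hη, ← coact_eq, ht]
  simp

/-- Lifting of a skew-primitive element `r` to the Galois object, for a functional `f` on it. -/
lemma coact_lcontr {a : T →ₐ[k] A} {b : T →ₐ[k] B} (hb : Function.Surjective b)
    (htr : ∀ t, b t = 0 → transl a a t = 0) {f : A →ₗ[k] k} (hf : f 1 = 1) {r g : T}
    (hg : IsGroupLikeElem k g) (hr : coact b b r = b r ⊗ₜ 1 + b g ⊗ₜ b r) :
    coact a b (lcontr (f ∘ₗ a.toLinearMap ∘ₗ LinearMap.mulLeft k g ∘ₗ HopfAlgebra.antipode k) r) =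
      a (lcontr (f ∘ₗ a.toLinearMap ∘ₗ LinearMap.mulLeft k g ∘ₗ HopfAlgebra.antipode k) r) ⊗ₜ 1 +
        a g ⊗ₜ b r := by
  obtain ⟨l, hl⟩ := exists_factor (p := b.toLinearMap) hb (transl a a).toLinearMap htr
  set ξ := f ∘ₗ a.toLinearMap ∘ₗ LinearMap.mulLeft k g ∘ₗ HopfAlgebra.antipode k with hξ
  -- F(x ⊗ y) = f(g x) y turns the translation map into contraction by `ξ`. The factor g together
  -- with f(1) = 1 normalises it so that g ↦ g.
  let F : Aᵐᵒᵖ ⊗[k] A →ₗ[k] A := (TensorProduct.lid k A).toLinearMap ∘ₗ LinearMap.rTensor A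
    (f ∘ₗ LinearMap.mulLeft k (a g) ∘ₗ (MulOpposite.opLinearEquiv k).symm.toLinearMap)
  have h1 : ∀ s, F (transl a a s) = a (lcontr ξ s) := by
    intro s
    have : ∀ z : T ⊗[k] T, F (TensorProduct.map ((MulOpposite.opLinearEquiv k).toLinearMap ∘ₗ
        a.toLinearMap ∘ₗ HopfAlgebra.antipode k) a.toLinearMap z) =
        a (TensorProduct.lid k T (LinearMap.rTensor T ξ z)) := by
      intro z
      induction z with
      | zero => simp
      | add a b ha hb => simp only [map_add, ha, hb]
      | tmul a b => simp [F, hξ]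
    exact this _
  have hFg : F (transl a a g) = a g := by
    rw [transl_groupLike _ _ hg]
    simp [F, ← map_mul, hg.mul_antipode_cancel, hf]
  clear_value F
  have h3 : ∀ s, l (b s) = transl a a s := hl
  have h2 : coact a b (lcontr ξ r) = LinearMap.rTensor B (F ∘ₗ l) (coact b b r) := by
    rw [coact_eq, comul_lcontr, coact_eq]
    generalize Coalgebra.comul (R := k) r = w
    induction w with
    | zero => simp
    | add a b ha hb => simp only [map_add, ha, hb]
    | tmul c d => simp [h3, h1]
  rw [h2, hr, map_add, LinearMap.rTensor_tmul, LinearMap.rTensor_tmul, LinearMap.comp_apply,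
    LinearMap.comp_apply, h3, h3, h1, hFg]

/-- The element `r̃` attached to a lift `t` of `r`. -/
lemma coact_rcontr {a : T →ₐ[k] A} {b : T →ₐ[k] B} {l : T →ₐ[k] L} (ha : Function.Surjective a)
    (hb : Function.Surjective b) (htr : ∀ t, b t = 0 → transl a a t = 0)
    (hd : ∀ t, a t = 0 → coact l a t = 0) {f : A →ₗ[k] k} (hf : f 1 = 1) {t r g : T}
    (hg : IsGroupLikeElem k g) (ht : coact a b t = a t ⊗ₜ 1 + a g ⊗ₜ b r) :
    coact l a t = l (rcontr (f ∘ₗ a.toLinearMap) t - f (a t) • g) ⊗ₜ 1 + l g ⊗ₜ a t := by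
  obtain ⟨m, hm⟩ := exists_factor (p := b.toLinearMap) hb (transl a a).toLinearMap htr
  obtain ⟨d, hd⟩ := exists_factor (p := a.toLinearMap) ha (coact l a).toLinearMap hd
  -- P(x ⊗ b(y)) = f(x S(y₁)) y₂ is a left inverse of the right coaction. Hence δ(t) is recovered by
  -- applying P to t₁ ⊗ ρ(t₂), which by coassociativity is δ ⊗ id applied to ρ(t) = t ⊗ 1 + g ⊗ r.
  let P : A ⊗[k] B →ₗ[k] A := (TensorProduct.lid k A).toLinearMap ∘ₗ LinearMap.rTensor A f ∘ₗ
    insertLeft k A A ∘ₗ LinearMap.lTensor A m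
  have hP : ∀ s, P (coact a b s) = a s := by
    intro s
    have h1 := insertLeft_transl a a s
    rw [← map_factor (p := a.toLinearMap) (q := b.toLinearMap) (f' := LinearMap.id)
      (fun t => rfl) hm, ← coact_eq] at h1
    change TensorProduct.lid k A (LinearMap.rTensor A f (insertLeft k A A
      (TensorProduct.map LinearMap.id m (coact a b s)))) = a s
    rw [h1]
    simp [hf]
  have hm1 : m 1 = 1 := by
    have := hm 1
    simpa using this
  have hP1 : ∀ x, P (x ⊗ₜ 1) = f x • 1 := by
    intro x
    simp [P, hm1, Algebra.TensorProduct.one_def]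
  -- The scalar f(t) subtracted here is the source of the correction - f(t) g in the statement.
  have hPr : P (a g ⊗ₜ b r) = a t - f (a t) • 1 := by
    rw [← hP1, eq_sub_iff_add_eq, add_comm, ← map_add, ← ht, hP]
  clear_value P
  have h1 : LinearMap.lTensor L P (TensorProduct.map l.toLinearMap (coact a b).toLinearMap
      (Coalgebra.comul (R := k) t)) = coact l a t := by
    rw [coact_eq]
    generalize Coalgebra.comul (R := k) t = w
    induction w with
    | zero => simp
    | add a b ha hb => simp only [map_add, ha, hb]
    | tmul c d => simp [hP]
  have h2 : TensorProduct.map l.toLinearMap (coact a b).toLinearMap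
      (Coalgebra.comul (R := k) t) = TensorProduct.assoc k L A B (TensorProduct.map
        (coact l a).toLinearMap b.toLinearMap (Coalgebra.comul (R := k) t)) := by
    have h3 : ∀ z : T ⊗[k] T, TensorProduct.map l.toLinearMap (coact a b).toLinearMap z =
        TensorProduct.map l.toLinearMap (TensorProduct.map a.toLinearMap b.toLinearMap)
          (LinearMap.lTensor T Coalgebra.comul z) := by
      intro z
      induction z with
      | zero => simp
      | add a b ha hb => simp only [map_add, ha, hb]
      | tmul a b => simp [coact_eq]
    have h4 : ∀ z : T ⊗[k] T, TensorProduct.assoc k L A B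
        (TensorProduct.map (coact l a).toLinearMap b.toLinearMap z) =
        TensorProduct.map l.toLinearMap (TensorProduct.map a.toLinearMap b.toLinearMap)
          (TensorProduct.assoc k T T T (LinearMap.rTensor T Coalgebra.comul z)) := by
      intro z
      induction z with
      | zero => simp
      | add a b ha hb => simp only [map_add, ha, hb]
      | tmul a b =>
        simp only [TensorProduct.map_tmul, LinearMap.rTensor_tmul, AlgHom.toLinearMap_apply,
          coact_eq]
        generalize Coalgebra.comul (R := k) a = w
        induction w with
        | zero => simp
        | add a b ha hb => simp only [map_add, TensorProduct.add_tmul, ha, hb]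
        | tmul c d => simp
    rw [h3, h4, Coalgebra.coassoc_apply]
  have h5 : TensorProduct.map (coact l a).toLinearMap b.toLinearMap (Coalgebra.comul (R := k) t) =
      coact l a t ⊗ₜ 1 + (l g ⊗ₜ a g) ⊗ₜ b r := by
    rw [← map_factor (p := a.toLinearMap) (q := b.toLinearMap) (h' := LinearMap.id) hd
      (fun t => rfl), ← coact_eq, ht, map_add, TensorProduct.map_tmul, TensorProduct.map_tmul]
    have h6 : ∀ s, d (a s) = coact l a s := hd
    rw [h6, h6, coact_groupLike l a hg]
    simp
  have h7 : LinearMap.lTensor L P (TensorProduct.assoc k L A B (coact l a t ⊗ₜ 1)) =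
      l (rcontr (f ∘ₗ a.toLinearMap) t) ⊗ₜ 1 := by
    change _ = l (TensorProduct.rid k T (LinearMap.lTensor T (f ∘ₗ a.toLinearMap)
      (Coalgebra.comul (R := k) t))) ⊗ₜ 1
    rw [coact_eq]
    generalize Coalgebra.comul (R := k) t = w
    induction w with
    | zero => simp
    | add a b ha hb => simp only [map_add, TensorProduct.add_tmul, ha, hb]
    | tmul c d => simp [hP1, TensorProduct.smul_tmul']
  rw [← h1, h2, h5, map_add, map_add, h7, TensorProduct.assoc_tmul, LinearMap.lTensor_tmul, hPr]
  simp [TensorProduct.tmul_sub, TensorProduct.sub_tmul, TensorProduct.smul_tmul']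
  abel

/-- The element `r̃` is skew-primitive. -/
lemma coact_self_of_coact {a : T →ₐ[k] A} [Nontrivial A] {l : T →ₐ[k] L}
    (ha : Function.Surjective a) (hl : Function.Surjective l)
    (hd : ∀ t, a t = 0 → coact l a t = 0) (hll : ∀ t, l t = 0 → coact l l t = 0) {t u g : T}
    (hg : IsGroupLikeElem k g) (ht : coact l a t = l u ⊗ₜ 1 + l g ⊗ₜ a t) :
    coact l l u = l u ⊗ₜ 1 + l g ⊗ₜ l u := by
  obtain ⟨d, hd⟩ := exists_factor (p := a.toLinearMap) ha (coact l a).toLinearMap hd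
  obtain ⟨e, he⟩ := exists_factor (p := l.toLinearMap) hl (coact l l).toLinearMap hll
  obtain ⟨f, hf⟩ := exists_functional_one (k := k) A
  have hd' : ∀ s, d (a s) = coact l a s := hd
  have he' : ∀ s, e (l s) = coact l l s := he
  have hd1 : d 1 = 1 := by
    have := hd' 1
    simpa using this
  -- Coassociativity of the left coaction, evaluated on t. The terms g ⊗ g ⊗ t cancel, and what
  -- remains ends in ⊗ 1, which `f` removes.
  have h0 : TensorProduct.map (coact l l).toLinearMap a.toLinearMap (Coalgebra.comul (R := k) t) =
      (TensorProduct.assoc k L L A).symm (TensorProduct.map l.toLinearMap (coact l a).toLinearMap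
        (Coalgebra.comul (R := k) t)) := by
    have h3 : ∀ z : T ⊗[k] T, TensorProduct.map l.toLinearMap (coact l a).toLinearMap z =
        TensorProduct.map l.toLinearMap (TensorProduct.map l.toLinearMap a.toLinearMap)
          (LinearMap.lTensor T Coalgebra.comul z) := by
      intro z
      induction z with
      | zero => simp
      | add a b ha hb => simp only [map_add, ha, hb]
      | tmul a b => simp [coact_eq]
    have h4 : ∀ z : T ⊗[k] T, TensorProduct.assoc k L L A
        (TensorProduct.map (coact l l).toLinearMap a.toLinearMap z) =
        TensorProduct.map l.toLinearMap (TensorProduct.map l.toLinearMap a.toLinearMap)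
          (TensorProduct.assoc k T T T (LinearMap.rTensor T Coalgebra.comul z)) := by
      intro z
      induction z with
      | zero => simp
      | add a b ha hb => simp only [map_add, ha, hb]
      | tmul a b =>
        simp only [TensorProduct.map_tmul, LinearMap.rTensor_tmul, AlgHom.toLinearMap_apply,
          coact_eq]
        generalize Coalgebra.comul (R := k) a = w
        induction w with
        | zero => simp
        | add a b ha hb => simp only [map_add, TensorProduct.add_tmul, ha, hb]
        | tmul c d => simp
    rw [LinearEquiv.eq_symm_apply, h3, h4, Coalgebra.coassoc_apply]
  rw [← map_factor (p := l.toLinearMap) (q := a.toLinearMap) (h' := LinearMap.id) he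
      (fun t => rfl), ← map_factor (p := l.toLinearMap) (q := a.toLinearMap) (f' := LinearMap.id)
      (fun t => rfl) hd, ← coact_eq, ht] at h0
  simp only [map_add, TensorProduct.map_tmul, he', hd', ht, hd1, LinearMap.id_apply,
    coact_groupLike l l hg, TensorProduct.tmul_add, Algebra.TensorProduct.one_def,
    TensorProduct.assoc_symm_tmul] at h0
  rw [← add_assoc, add_left_inj, ← TensorProduct.add_tmul] at h0
  have h3 := congrArg (fun z => TensorProduct.rid k _ (LinearMap.lTensor _ f z)) h0
  simpa [hf] using h3

end Translation

/-! ### Triples of ideals of T(V) # H defining biGalois objects -/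

section Ideals

variable {k : Type*} [Field k] {H : Type*} [Ring H] [HopfAlgebra k H] {θ : ℕ}
  {X : Fin θ → YDPair k H}

lemma quot_surjective (I : TwoSidedIdeal (Bos X)) : Function.Surjective (quot I) :=
  Ideal.Quotient.mkₐ_surjective k I.asIdeal

lemma quot_eq_zero {I : TwoSidedIdeal (Bos X)} {t : Bos X} : quot I t = 0 ↔ t ∈ I :=
  Ideal.Quotient.eq_zero_iff_mem.trans TwoSidedIdeal.mem_asIdeal

lemma quot_eq_quot {I : TwoSidedIdeal (Bos X)} {s t : Bos X} :
    quot I s = quot I t ↔ s - t ∈ I := by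
  rw [← quot_eq_zero, map_sub, sub_eq_zero]

lemma quotComul_eq (I J : TwoSidedIdeal (Bos X)) : quotComul I J = coact (quot I) (quot J) := rfl

lemma nontrivial_quot {I : TwoSidedIdeal (Bos X)} (hI : I ≠ ⊤) :
    Nontrivial (Bos X ⧸ I.asIdeal) := by
  refine Ideal.Quotient.nontrivial_iff.mpr fun h => hI ?_
  refine TwoSidedIdeal.ext fun x => ⟨fun _ => trivial, fun _ => ?_⟩
  rw [← TwoSidedIdeal.mem_asIdeal, h]
  trivial

lemma TwoSidedIdeal.smul_mem' {I : TwoSidedIdeal (Bos X)} (c : k) {t : Bos X} (ht : t ∈ I) :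
    c • t ∈ I := by
  rw [← quot_eq_zero] at ht ⊢
  rw [map_smul, ht, smul_zero]

/-- An algebra map that vanishes on `I` and on `s` vanishes on the ideal generated by them. -/
lemma forall_mem_sup_span {R S : Type*} [Ring R] [Ring S] (f : R →+* S) {I : TwoSidedIdeal R}
    {s : Set R} (hI : ∀ t ∈ I, f t = 0) (hs : ∀ t ∈ s, f t = 0) :
    ∀ t ∈ I ⊔ TwoSidedIdeal.span s, f t = 0 := by
  have : I ⊔ TwoSidedIdeal.span s ≤ TwoSidedIdeal.ker f :=
    sup_le (fun t ht => (TwoSidedIdeal.mem_ker f).mpr (hI t ht))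
      (TwoSidedIdeal.span_le.mpr fun t ht => (TwoSidedIdeal.mem_ker f).mpr (hs t ht))
  exact fun t ht => (TwoSidedIdeal.mem_ker f).mp (this ht)

lemma exists_quot_map {I I' : TwoSidedIdeal (Bos X)} (h : I ≤ I') :
    ∃ e : (Bos X ⧸ I.asIdeal) →ₗ[k] (Bos X ⧸ I'.asIdeal), ∀ t, e (quot I t) = quot I' t :=
  exists_factor (p := (quot I).toLinearMap) (quot_surjective I) (quot I').toLinearMap
    fun _ ht => quot_eq_zero.mpr (h (quot_eq_zero.mp ht))

lemma quot_map_one {I I' : TwoSidedIdeal (Bos X)}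
    {e : (Bos X ⧸ I.asIdeal) →ₗ[k] (Bos X ⧸ I'.asIdeal)} (he : ∀ t, e (quot I t) = quot I' t) :
    e 1 = 1 := by
  have := he 1
  rwa [map_one (quot I), map_one (quot I')] at this

lemma quotComul_eq_zero_of_le {I I' J J' : TwoSidedIdeal (Bos X)} (hI : I ≤ I') (hJ : J ≤ J')
    {t : Bos X} (ht : quotComul I J t = 0) : quotComul I' J' t = 0 := by
  obtain ⟨e, he⟩ := exists_quot_map hI
  obtain ⟨f, hf⟩ := exists_quot_map hJ
  rw [quotComul_eq, ← coact_map he hf, ← quotComul_eq, ht, map_zero]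

lemma quotComul_of_le {I I' J J' : TwoSidedIdeal (Bos X)} (hI : I ≤ I') (hJ : J ≤ J')
    {t x g y : Bos X}
    (ht : quotComul I J t = quot I x ⊗ₜ 1 + quot I g ⊗ₜ quot J y) :
    quotComul I' J' t = quot I' x ⊗ₜ 1 + quot I' g ⊗ₜ quot J' y := by
  obtain ⟨e, he⟩ := exists_quot_map hI
  obtain ⟨f, hf⟩ := exists_quot_map hJ
  rw [quotComul_eq, ← coact_map he hf, ← quotComul_eq, ht, map_add, TensorProduct.map_tmul,
    TensorProduct.map_tmul, he, he, hf, quot_map_one hf]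

/-- The ideals `I`, `K`, `J` define a cleft object `𝒯/I`, a graded Hopf algebra `𝒯/K` that coacts on
it from the right, and a Hopf algebra `𝒯/J` that coacts on it from the left. -/
structure IsBigalois (I K J : TwoSidedIdeal (Bos X)) : Prop where
  rho : ∀ t ∈ I, quotComul I K t = 0
  tra : ∀ t ∈ K, transl (quot I) (quot I) t = 0
  del : ∀ t ∈ I, quotComul J I t = 0
  cot : ∀ t ∈ J, cotransl (quot I) (quot I) t = 0
  comul : ∀ t ∈ J, quotComul J J t = 0
  counit : ∀ t ∈ J, Coalgebra.counit (R := k) t = 0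
  antipode : ∀ t ∈ J, HopfAlgebra.antipode k t ∈ J

lemma isBigalois_bot : IsBigalois (⊥ : TwoSidedIdeal (Bos X)) ⊥ ⊥ := by
  constructor <;> intro t ht <;> rw [TwoSidedIdeal.mem_bot] at ht <;> subst ht <;>
    exact map_zero _

/-- Since ε factors through 𝒯/J, applying ε ⊗ ε to the skew-primitive formula gives ε(u) = 2 ε(u).
-/
lemma counit_eq_zero_of_quotComul {J : TwoSidedIdeal (Bos X)}
    (hJ : ∀ t ∈ J, Coalgebra.counit (R := k) t = 0) {g u : Bos X} (hg : IsGroupLikeElem k g)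
    (hu : quotComul J J u = quot J u ⊗ₜ 1 + quot J g ⊗ₜ quot J u) :
    Coalgebra.counit (R := k) u = 0 := by
  obtain ⟨e, he⟩ := exists_factor (p := (quot J).toLinearMap) (quot_surjective J)
    (Coalgebra.counit (R := k)) fun t ht => hJ t (quot_eq_zero.mp ht)
  have he' : ∀ t, e (quot J t) = Coalgebra.counit (R := k) t := he
  have h1 : e 1 = 1 := by
    have := he' 1
    rwa [map_one, Bialgebra.counit_one] at this
  have h2 := congrArg (fun z => TensorProduct.lid k k (TensorProduct.map e e z)) hu
  have h3 : TensorProduct.lid k k (TensorProduct.map e e (quotComul J J u)) =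
      Coalgebra.counit (R := k) u := by
    rw [quotComul_eq, coact_eq, map_factor he he]
    have : ∀ z : Bos X ⊗[k] Bos X, TensorProduct.lid k k (TensorProduct.map (Coalgebra.counit)
        (Coalgebra.counit) z) = Coalgebra.counit (R := k) (TensorProduct.lid k (Bos X)
          (LinearMap.rTensor (Bos X) Coalgebra.counit z)) := by
      intro z
      induction z with
      | zero => simp
      | add a b ha hb => simp only [map_add, ha, hb]
      | tmul a b => simp
    rw [this, Coalgebra.rTensor_counit_comul]
    simp
  simp only [h3, map_add, TensorProduct.map_tmul, he', h1, TensorProduct.lid_tmul,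
    hg.counit_eq_one] at h2
  simpa using h2

/-- Multiply out S(u₁) u₂ = ε(u) = 0 modulo J. The formula is needed to see that adding relations
keeps the ideal stable under the antipode. -/
lemma antipode_of_quotComul {J : TwoSidedIdeal (Bos X)}
    (hJ : ∀ t ∈ J, Coalgebra.counit (R := k) t = 0)
    (hS : ∀ t ∈ J, HopfAlgebra.antipode k t ∈ J) {g u : Bos X} (hg : IsGroupLikeElem k g)
    (hu : quotComul J J u = quot J u ⊗ₜ 1 + quot J g ⊗ₜ quot J u) :
    quot J (HopfAlgebra.antipode k u) = - quot J (HopfAlgebra.antipode k g * u) := by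
  obtain ⟨e, he⟩ := exists_factor (p := (quot J).toLinearMap) (quot_surjective J)
    ((quot J).toLinearMap ∘ₗ HopfAlgebra.antipode k)
    fun t ht => quot_eq_zero.mpr (hS t (quot_eq_zero.mp ht))
  have he' : ∀ t, e (quot J t) = quot J (HopfAlgebra.antipode k t) := he
  have h2 := congrArg (fun z => LinearMap.mul' k _ (TensorProduct.map e LinearMap.id z)) hu
  have h3 : LinearMap.mul' k _ (TensorProduct.map e LinearMap.id (quotComul J J u)) = 0 := by
    rw [quotComul_eq, coact_eq, map_factor he (h := (quot J).toLinearMap) (fun t => rfl)]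
    have : ∀ z : Bos X ⊗[k] Bos X, LinearMap.mul' k _ (TensorProduct.map ((quot J).toLinearMap ∘ₗ
        HopfAlgebra.antipode k) (quot J).toLinearMap z) = quot J (LinearMap.mul' k (Bos X)
          (LinearMap.rTensor (Bos X) (HopfAlgebra.antipode k) z)) := by
      intro z
      induction z with
      | zero => simp
      | add a b ha hb => simp only [map_add, ha, hb]
      | tmul a b => simp
    rw [this, HopfAlgebra.mul_antipode_rTensor_comul_apply,
      counit_eq_zero_of_quotComul hJ hg hu]
    simp
  have h1 : e 1 = 1 := by
    have := he' 1
    rwa [HopfAlgebra.antipode_one, map_one (quot J)] at this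
  simp only [h3, map_add, TensorProduct.map_tmul, he', LinearMap.mul'_apply, LinearMap.id_apply,
    mul_one, ← map_mul] at h2
  exact eq_neg_of_add_eq_zero_left h2.symm

/-- Adding the relations `r' = λ_r` to a cleft object, and the corresponding relations to the Hopf
algebras that coact on it. -/
lemma IsBigalois.sup {I K J : TwoSidedIdeal (Bos X)} (h : IsBigalois I K J) (hI : I ≠ ⊤)
    {sI sK sJ : Set (Bos X)}
    (hsI : ∀ x ∈ sI, ∃ g t r u, ∃ c : k, IsGroupLikeElem k g ∧ x = t - algebraMap k (Bos X) c ∧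
      r ∈ sK ∧ u - c • (1 - g) ∈ sJ ∧
      quotComul I K t = quot I t ⊗ₜ 1 + quot I g ⊗ₜ quot K r ∧
      quotComul J I t = quot J u ⊗ₜ 1 + quot J g ⊗ₜ quot I t)
    (hsK : ∀ r ∈ sK, ∃ g t, ∃ c : k, IsGroupLikeElem k g ∧ t - algebraMap k (Bos X) c ∈ sI ∧
      quotComul I K t = quot I t ⊗ₜ 1 + quot I g ⊗ₜ quot K r)
    (hsJ : ∀ z ∈ sJ, ∃ g t u, ∃ c : k, IsGroupLikeElem k g ∧ t - algebraMap k (Bos X) c ∈ sI ∧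
      z = u - c • (1 - g) ∧
      quotComul J I t = quot J u ⊗ₜ 1 + quot J g ⊗ₜ quot I t) :
    IsBigalois (I ⊔ TwoSidedIdeal.span sI) (K ⊔ TwoSidedIdeal.span sK)
      (J ⊔ TwoSidedIdeal.span sJ) := by
  have hI' := nontrivial_quot hI
  set I' := I ⊔ TwoSidedIdeal.span sI with hI'd
  set K' := K ⊔ TwoSidedIdeal.span sK
  set J' := J ⊔ TwoSidedIdeal.span sJ
  have hII : I ≤ I' := le_sup_left
  have hKK : K ≤ K' := le_sup_left
  have hJJ : J ≤ J' := le_sup_left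
  have mI : ∀ x ∈ sI, x ∈ I' := fun x hx =>
    TwoSidedIdeal.mem_sup_right (TwoSidedIdeal.subset_span hx)
  have mK : ∀ x ∈ sK, x ∈ K' := fun x hx =>
    TwoSidedIdeal.mem_sup_right (TwoSidedIdeal.subset_span hx)
  have mJ : ∀ x ∈ sJ, x ∈ J' := fun x hx =>
    TwoSidedIdeal.mem_sup_right (TwoSidedIdeal.subset_span hx)
  have qI : ∀ t (c : k), t - algebraMap k (Bos X) c ∈ sI →
      quot I' t = algebraMap k (Bos X ⧸ I'.asIdeal) c := by
    intro t c hx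
    have := quot_eq_zero.mpr (mI _ hx)
    rwa [map_sub, AlgHom.commutes, sub_eq_zero] at this
  obtain ⟨eI, heI⟩ := exists_quot_map hII
  obtain ⟨eJ, heJ⟩ := exists_quot_map hJJ
  have hkI : ∀ t, quot I t = 0 → quot I' t = 0 := fun t ht =>
    quot_eq_zero.mpr (hII (quot_eq_zero.mp ht))
  -- Skew-primitivity of u holds already modulo `J`. It yields the three Hopf ideal conditions for
  -- the new generators.
  have hprim : ∀ z ∈ sJ, ∃ g u, ∃ c : k, IsGroupLikeElem k g ∧ z = u - c • (1 - g) ∧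
      quotComul J J u = quot J u ⊗ₜ 1 + quot J g ⊗ₜ quot J u := by
    intro z hz
    obtain ⟨g, t, u, c, hg, ht, hz, hu⟩ := hsJ z hz
    exact ⟨g, u, c, hg, hz, coact_self_of_coact (quot_surjective I) (quot_surjective J)
      (fun t ht => h.del t (quot_eq_zero.mp ht)) (fun t ht => h.comul t (quot_eq_zero.mp ht)) hg hu⟩
  refine ⟨?_, ?_, ?_, ?_, ?_, ?_, ?_⟩
  · refine forall_mem_sup_span (quotComul I' K').toRingHom
      (fun t ht => quotComul_eq_zero_of_le hII hKK (h.rho t ht)) ?_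
    intro x hx
    obtain ⟨g, t, r, u, c, hg, rfl, hr, hu, h1, h2⟩ := hsI x hx
    -- With r = 0 on the right, ρ(t) = t ⊗ 1, so t - c coacts as (t - c) ⊗ 1 = 0.
    have h3 := quotComul_of_le hII hKK h1
    rw [quot_eq_zero.mpr (mK r hr), TensorProduct.tmul_zero, add_zero, qI t c hx] at h3
    change quotComul I' K' (t - algebraMap k (Bos X) c) = 0
    rw [map_sub, h3, AlgHom.commutes]
    simp [Algebra.TensorProduct.algebraMap_apply]
  · refine forall_mem_sup_span (transl (quot I') (quot I')).toRingHom
      (fun t ht => ?_) ?_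
    · have := transl_map heI heI t
      rw [h.tra t ht, map_zero] at this
      exact this.symm
    · intro r hr
      obtain ⟨g, t, c, hg, ht, h1⟩ := hsK r hr
      exact transl_eq_zero_of_coact (quot_surjective I) hkI (quot_surjective K)
        (fun t ht => h.tra t (quot_eq_zero.mp ht)) hg h1 (qI t c ht)
  · refine forall_mem_sup_span (quotComul J' I').toRingHom
      (fun t ht => quotComul_eq_zero_of_le hJJ hII (h.del t ht)) ?_
    intro x hx
    obtain ⟨g, t, r, u, c, hg, rfl, hr, hu, h1, h2⟩ := hsI x hx
    -- With u = c (1 - g) and t = c, δ(t) = c (1 - g) ⊗ 1 + g ⊗ c = c.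
    have h3 := quotComul_of_le hJJ hII h2
    have h4 := quot_eq_zero.mpr (mJ _ hu)
    rw [map_sub, sub_eq_zero] at h4
    rw [h4, qI t c hx] at h3
    change quotComul J' I' (t - algebraMap k (Bos X) c) = 0
    rw [map_sub, h3, AlgHom.commutes]
    simp only [Algebra.algebraMap_eq_smul_one, map_smul, Algebra.TensorProduct.one_def, map_sub,
      map_one, TensorProduct.tmul_smul, TensorProduct.smul_tmul', TensorProduct.sub_tmul,
      smul_sub]
    abel
  · refine forall_mem_sup_span (cotransl (quot I') (quot I')).toRingHom
      (fun t ht => ?_) ?_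
    · have := cotransl_map heI heI t
      rw [h.cot t ht, map_zero] at this
      exact this.symm
    · intro z hz
      obtain ⟨g, t, u, c, hg, ht, rfl, h1⟩ := hsJ z hz
      exact cotransl_eq_zero_of_coact (quot_surjective I) hkI (quot_surjective J)
        (fun t ht => h.cot t (quot_eq_zero.mp ht)) h1 (qI t c ht)
  · refine forall_mem_sup_span (quotComul J' J').toRingHom
      (fun t ht => quotComul_eq_zero_of_le hJJ hJJ (h.comul t ht)) ?_
    intro z hz
    obtain ⟨g, u, c, hg, hz', h1⟩ := hprim z hz
    have h3 := quotComul_of_le hJJ hJJ h1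
    have h4 := quot_eq_zero.mpr (mJ _ hz)
    rw [hz', map_sub, sub_eq_zero] at h4
    have h5 : quotComul J' J' g = quot J' g ⊗ₜ quot J' g := coact_groupLike _ _ hg
    change quotComul J' J' z = 0
    rw [hz', map_sub, h3, h4]
    simp only [map_smul, map_sub, map_one, h5, TensorProduct.tmul_smul, TensorProduct.smul_tmul',
      TensorProduct.sub_tmul, TensorProduct.tmul_sub, smul_sub, Algebra.TensorProduct.one_def]
    abel
  · refine forall_mem_sup_span (Bialgebra.counitAlgHom k (Bos X)).toRingHom
      (fun t ht => h.counit t ht) ?_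
    intro z hz
    obtain ⟨g, u, c, hg, hz', h1⟩ := hprim z hz
    change Coalgebra.counit (R := k) z = 0
    simp [hz', counit_eq_zero_of_quotComul h.counit hg h1, hg.counit_eq_one]
  · intro t ht
    rw [← quot_eq_zero]
    -- The antipode is read as an algebra map to the opposite algebra, so that stability can be
    -- tested on generators.
    apply MulOpposite.op_injective
    refine forall_mem_sup_span ((AlgHom.op (quot J')).comp
      (HopfAlgebra.antipodeAlgHomOp k (Bos X))).toRingHom
      (fun t ht => ?_) ?_ t ht
    · change MulOpposite.op (quot J' (HopfAlgebra.antipode k t)) = 0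
      rw [quot_eq_zero.mpr (hJJ (h.antipode t ht)), MulOpposite.op_zero]
    · intro z hz
      obtain ⟨g, u, c, hg, hz', h1⟩ := hprim z hz
      have h2 := congrArg eJ (antipode_of_quotComul h.counit h.antipode hg h1)
      rw [map_neg, heJ, heJ] at h2
      have h4 := quot_eq_zero.mpr (mJ _ hz)
      rw [hz', map_sub, sub_eq_zero] at h4
      change MulOpposite.op (quot J' (HopfAlgebra.antipode k z)) = 0
      have h5 : quot J' (HopfAlgebra.antipode k g) * quot J' g = 1 := by
        rw [← map_mul, hg.antipode_mul_cancel, map_one]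
      rw [hz', map_sub, map_sub, h2, map_mul, h4, map_smul, map_smul, map_smul, mul_smul_comm,
        map_sub, map_sub, map_sub, mul_sub, h5, HopfAlgebra.antipode_one, map_one, mul_one,
        smul_sub, smul_sub]
      simp

/-- The ideal defining the Hopf algebra that coacts from the left is determined by that defining
the cleft object. -/
lemma IsBigalois.mem_iff {I K J : TwoSidedIdeal (Bos X)} (h : IsBigalois I K J) (hI : I ≠ ⊤)
    {t : Bos X} : t ∈ J ↔ cotransl (quot I) (quot I) t = 0 := by
  have hI' := nontrivial_quot hI
  refine ⟨h.cot t, fun ht => quot_eq_zero.mp ?_⟩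
  exact eq_zero_of_cotransl (quot_surjective I) (fun t ht => h.del t (quot_eq_zero.mp ht)) ht

lemma exists_scalar_of_quotComul {I K : TwoSidedIdeal (Bos X)} (hI : I ≠ ⊤)
    (htr : ∀ t ∈ K, transl (quot I) (quot I) t = 0) {t : Bos X}
    (ht : quotComul I K t = quot I t ⊗ₜ 1) : ∃ c : k, t - algebraMap k (Bos X) c ∈ I := by
  have hI' := nontrivial_quot hI
  obtain ⟨c, hc⟩ := exists_scalar_of_coact (quot_surjective K)
    (fun t ht => htr t (quot_eq_zero.mp ht)) ht
  refine ⟨c, ?_⟩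
  rw [← quot_eq_zero, map_sub, hc, AlgHom.commutes, sub_self]

end Ideals

/-! ### Word length and skew derivations in the free algebra -/

section FreeDegree

variable {k : Type*} [Field k] {θ : ℕ}

/-- The span of the words of length `n`. -/
def wordsEq (k : Type*) [Field k] (θ n : ℕ) : Submodule k (FreeAlgebra k (Fin θ)) :=
  Submodule.span k {v | ∃ w : List (Fin θ), w.length = n ∧ v = (w.map (FreeAlgebra.ι k)).prod}

/-- The span of the words of length less than `n`. -/
def wordsLT (k : Type*) [Field k] (θ n : ℕ) : Submodule k (FreeAlgebra k (Fin θ)) :=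
  Submodule.span k {v | ∃ w : List (Fin θ), w.length < n ∧ v = (w.map (FreeAlgebra.ι k)).prod}

lemma wordsLT_zero : wordsLT k θ 0 = ⊥ := by
  simp [wordsLT]

lemma wordsLT_mono {m n : ℕ} (h : m ≤ n) : wordsLT k θ m ≤ wordsLT k θ n :=
  Submodule.span_mono fun _ ⟨w, hw, hv⟩ => ⟨w, hw.trans_le h, hv⟩

lemma wordsEq_le {m n : ℕ} (h : m < n) : wordsEq k θ m ≤ wordsLT k θ n :=
  Submodule.span_mono fun _ ⟨w, hw, hv⟩ => ⟨w, hw ▸ h, hv⟩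

lemma wordsLT_succ (n : ℕ) : wordsLT k θ (n + 1) ≤ wordsEq k θ n ⊔ wordsLT k θ n := by
  refine Submodule.span_le.mpr ?_
  rintro _ ⟨w, hw, rfl⟩
  rcases (Nat.lt_succ_iff.mp hw).eq_or_lt with h | h
  · exact Submodule.mem_sup_left (Submodule.subset_span ⟨w, h, rfl⟩)
  · exact Submodule.mem_sup_right (Submodule.subset_span ⟨w, h, rfl⟩)

lemma ι_mul_mem_wordsLT (i : Fin θ) {n : ℕ} {v : FreeAlgebra k (Fin θ)} (hv : v ∈ wordsLT k θ n) :
    FreeAlgebra.ι k i * v ∈ wordsLT k θ (n + 1) := by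
  have : wordsLT k θ n ≤ (wordsLT k θ (n + 1)).comap (LinearMap.mulLeft k (FreeAlgebra.ι k i)) := by
    refine Submodule.span_le.mpr ?_
    rintro _ ⟨w, hw, rfl⟩
    exact Submodule.subset_span ⟨i :: w, by simpa using hw, by simp⟩
  exact this hv

lemma mul_ι_mem_wordsLT (i : Fin θ) {n : ℕ} {v : FreeAlgebra k (Fin θ)} (hv : v ∈ wordsLT k θ n) :
    v * FreeAlgebra.ι k i ∈ wordsLT k θ (n + 1) := by
  have : wordsLT k θ n ≤
      (wordsLT k θ (n + 1)).comap (LinearMap.mulRight k (FreeAlgebra.ι k i)) := by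
    refine Submodule.span_le.mpr ?_
    rintro _ ⟨w, hw, rfl⟩
    exact Submodule.subset_span ⟨w ++ [i], by simpa using hw, by simp⟩
  exact this hv

lemma exists_mem_wordsLT (v : FreeAlgebra k (Fin θ)) : ∃ n, v ∈ wordsLT k θ n := by
  have hmul : ∀ m n (a b : FreeAlgebra k (Fin θ)), a ∈ wordsLT k θ m → b ∈ wordsLT k θ n →
      a * b ∈ wordsLT k θ (m + n) := by
    intro m n a b ha hb
    induction ha using Submodule.span_induction with
    | zero => simp
    | add x y _ _ hx hy => rw [add_mul]; exact add_mem hx hy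
    | smul c x _ hx => rw [smul_mul_assoc]; exact Submodule.smul_mem _ _ hx
    | mem x hx =>
      obtain ⟨w, hw, rfl⟩ := hx
      induction hb using Submodule.span_induction with
      | zero => simp
      | add x y _ _ hx hy => rw [mul_add]; exact add_mem hx hy
      | smul c x _ hx => rw [mul_smul_comm]; exact Submodule.smul_mem _ _ hx
      | mem x hx =>
        obtain ⟨w', hw', rfl⟩ := hx
        exact Submodule.subset_span ⟨w ++ w', by simp; omega, by simp⟩
  induction v using FreeAlgebra.induction with
  | grade0 c =>
    refine ⟨1, ?_⟩
    rw [Algebra.algebraMap_eq_smul_one]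
    exact Submodule.smul_mem _ _ (Submodule.subset_span ⟨[], by simp, by simp⟩)
  | grade1 i => exact ⟨2, Submodule.subset_span ⟨[i], by simp, by simp⟩⟩
  | mul a b ha hb =>
    obtain ⟨m, hm⟩ := ha
    obtain ⟨n, hn⟩ := hb
    exact ⟨m + n, hmul m n a b hm hn⟩
  | add a b ha hb =>
    obtain ⟨m, hm⟩ := ha
    obtain ⟨n, hn⟩ := hb
    exact ⟨max m n, add_mem (wordsLT_mono (le_max_left _ _) hm)
      (wordsLT_mono (le_max_right _ _) hn)⟩

variable (q : Fin θ → Fin θ → k)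

/-- The diagonal action of `g_i` on `T(V)`. -/
def diagAct (i : Fin θ) (v : FreeAlgebra k (Fin θ)) : FreeAlgebra k (Fin θ) :=
  skewDerMatrix q i v 1 1

lemma skewDerMatrix_apply (i : Fin θ) (v : FreeAlgebra k (Fin θ)) :
    skewDerMatrix q i v 0 0 = v ∧ skewDerMatrix q i v 1 0 = 0 := by
  induction v using FreeAlgebra.induction with
  | grade0 c => simp [AlgHom.commutes, Matrix.algebraMap_matrix_apply]
  | grade1 j => simp [skewDerMatrix]
  | mul a b ha hb => simp [map_mul, Matrix.mul_apply, ha, hb]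
  | add a b ha hb => simp [map_add, ha, hb]

@[simp] lemma skewDer_ι (i j : Fin θ) :
    skewDer q i (FreeAlgebra.ι k j) = if i = j then 1 else 0 := by
  simp [skewDer, skewDerMatrix]

@[simp] lemma skewDer_algebraMap (i : Fin θ) (c : k) :
    skewDer q i (algebraMap k _ c) = 0 := by
  simp [skewDer, AlgHom.commutes, Matrix.algebraMap_matrix_apply]

@[simp] lemma skewDer_one (i : Fin θ) : skewDer q i 1 = 0 := by
  simp [skewDer]

lemma skewDer_mul (i : Fin θ) (a b : FreeAlgebra k (Fin θ)) :
    skewDer q i (a * b) = a * skewDer q i b + skewDer q i a * diagAct q i b := by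
  have h1 : skewDer q i (a * b) = skewDerMatrix q i (a * b) 0 1 := rfl
  rw [h1, map_mul, Matrix.mul_apply, Fin.sum_univ_two, (skewDerMatrix_apply q i a).1]
  rfl

@[simp] lemma diagAct_ι (i j : Fin θ) :
    diagAct q i (FreeAlgebra.ι k j) = q i j • FreeAlgebra.ι k j := by
  simp [diagAct, skewDerMatrix]

lemma diagAct_mul (i : Fin θ) (a b : FreeAlgebra k (Fin θ)) :
    diagAct q i (a * b) = diagAct q i a * diagAct q i b := by
  simp [diagAct, Matrix.mul_apply, (skewDerMatrix_apply q i _).2]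

lemma diagAct_add (i : Fin θ) (a b : FreeAlgebra k (Fin θ)) :
    diagAct q i (a + b) = diagAct q i a + diagAct q i b := by
  simp [diagAct]

lemma diagAct_algebraMap (i : Fin θ) (c : k) :
    diagAct q i (algebraMap k _ c) = algebraMap k _ c := by
  simp [diagAct, AlgHom.commutes, Matrix.algebraMap_matrix_apply]

lemma diagAct_word (i : Fin θ) (w : List (Fin θ)) : ∃ c : k,
    diagAct q i (w.map (FreeAlgebra.ι k)).prod = c • (w.map (FreeAlgebra.ι k)).prod := by
  induction w with
  | nil => exact ⟨1, by simp [diagAct]⟩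
  | cons j w ih =>
    obtain ⟨c, hc⟩ := ih
    refine ⟨q i j * c, ?_⟩
    rw [List.map_cons, List.prod_cons, diagAct_mul, hc, diagAct_ι, smul_mul_smul_comm]

/-- The truncated subtraction is harmless, because the empty word has derivative zero. -/
lemma skewDer_word (i : Fin θ) (w : List (Fin θ)) :
    skewDer q i (w.map (FreeAlgebra.ι k)).prod ∈ wordsEq k θ (w.length - 1) := by
  induction w with
  | nil => simp
  | cons j w ih =>
    rw [List.map_cons, List.prod_cons, skewDer_mul, skewDer_ι]
    obtain ⟨c, hc⟩ := diagAct_word q i w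
    refine add_mem ?_ ?_
    · cases w with
      | nil => simp
      | cons l w =>
        have : wordsEq k θ ((l :: w).length - 1) ≤
            (wordsEq k θ ((j :: l :: w).length - 1)).comap
              (LinearMap.mulLeft k (FreeAlgebra.ι k j)) := by
          refine Submodule.span_le.mpr ?_
          rintro _ ⟨w', hw', rfl⟩
          exact Submodule.subset_span ⟨j :: w', by simpa using hw', by simp⟩
        exact this ih
    · rw [hc]
      split_ifs
      · rw [one_mul]
        exact Submodule.smul_mem _ _ (Submodule.subset_span ⟨w, by simp, rfl⟩)
      · simp

lemma skewDer_mem_wordsEq (i : Fin θ) {n : ℕ} {v : FreeAlgebra k (Fin θ)}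
    (hv : v ∈ wordsEq k θ (n + 1)) : skewDer q i v ∈ wordsEq k θ n := by
  have : wordsEq k θ (n + 1) ≤ (wordsEq k θ n).comap (skewDer q i) := by
    refine Submodule.span_le.mpr ?_
    rintro _ ⟨w, hw, rfl⟩
    have := skewDer_word q i w
    rwa [hw] at this
  exact this hv

lemma skewDer_mem_wordsLT (i : Fin θ) {n : ℕ} {v : FreeAlgebra k (Fin θ)}
    (hv : v ∈ wordsLT k θ (n + 1)) : skewDer q i v ∈ wordsLT k θ n := by
  have : wordsLT k θ (n + 1) ≤ (wordsLT k θ n).comap (skewDer q i) := by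
    refine Submodule.span_le.mpr ?_
    rintro _ ⟨w, hw, rfl⟩
    rcases Nat.eq_zero_or_pos w.length with h | h
    · rw [List.length_eq_zero_iff] at h
      simp [h]
    · exact wordsEq_le (by omega) (skewDer_word q i w)
  exact this hv

lemma mem_wordsEq_zero {v : FreeAlgebra k (Fin θ)} (hv : v ∈ wordsEq k θ 0) :
    ∃ c : k, v = algebraMap k _ c := by
  have : wordsEq k θ 0 ≤ LinearMap.range (Algebra.linearMap k (FreeAlgebra k (Fin θ))) := by
    refine Submodule.span_le.mpr ?_
    rintro _ ⟨w, hw, rfl⟩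
    rw [List.length_eq_zero_iff] at hw
    exact ⟨1, by simp [hw]⟩
  obtain ⟨c, hc⟩ := this hv
  exact ⟨c, hc.symm⟩

lemma algebraMapInv_wordsEq {n : ℕ} {v : FreeAlgebra k (Fin θ)} (hv : v ∈ wordsEq k θ (n + 1)) :
    FreeAlgebra.algebraMapInv v = 0 := by
  have : wordsEq k θ (n + 1) ≤
      LinearMap.ker (FreeAlgebra.algebraMapInv (R := k) (X := Fin θ)).toLinearMap := by
    refine Submodule.span_le.mpr ?_
    rintro _ ⟨w, hw, rfl⟩
    cases w with
    | nil => simp at hw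
    | cons i w => simp [FreeAlgebra.algebraMapInv]
  exact this hv

/-- As `wordsLT` at 0 is zero, the truncated subtraction makes this include the vanishing of
derivatives of order at least `n`. -/
lemma prod_skewDer_mem_wordsLT (w : List (Fin θ)) {n : ℕ} {v : FreeAlgebra k (Fin θ)}
    (hv : v ∈ wordsLT k θ n) : (w.map (skewDer q)).prod v ∈ wordsLT k θ (n - w.length) := by
  induction w with
  | nil => simpa using hv
  | cons i w ih =>
    rw [List.map_cons, List.prod_cons, Module.End.mul_apply, List.length_cons]
    rcases h : n - w.length with _ | m
    · rw [h, wordsLT_zero, Submodule.mem_bot] at ih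
      simp [ih]
    · rw [h] at ih
      rw [show n - (w.length + 1) = m by omega]
      exact skewDer_mem_wordsLT q i ih

/-- Iterated skew derivatives of homogeneous elements whose constant term is not zero have full
length. -/
lemma algebraMapInv_prod_skewDer (w : List (Fin θ)) {n : ℕ} {v : FreeAlgebra k (Fin θ)}
    (hv : v ∈ wordsEq k θ n) (hw : w.length ≠ n) :
    FreeAlgebra.algebraMapInv ((w.map (skewDer q)).prod v) = 0 := by
  -- Too few derivatives leave a positive degree, too many give zero.
  rcases lt_or_gt_of_ne hw with h | h
  · have : ∀ w : List (Fin θ), w.length ≤ n →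
        (w.map (skewDer q)).prod v ∈ wordsEq k θ (n - w.length) := by
      intro w
      induction w with
      | nil => intro _; simpa using hv
      | cons i w ih =>
        intro hw
        rw [List.length_cons] at hw
        rw [List.map_cons, List.prod_cons, Module.End.mul_apply, List.length_cons]
        refine skewDer_mem_wordsEq q i ?_
        rw [show n - (w.length + 1) + 1 = n - w.length by omega]
        exact ih (by omega)
    have h1 := this w h.le
    rw [show n - w.length = n - w.length - 1 + 1 by omega] at h1
    exact algebraMapInv_wordsEq h1
  · have h1 := prod_skewDer_mem_wordsLT q w (wordsEq_le (Nat.lt_succ_self n) hv)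
    rw [show n + 1 - w.length = 0 by omega, wordsLT_zero, Submodule.mem_bot] at h1
    simp [h1]

lemma mem_nicholsIdeal {v : FreeAlgebra k (Fin θ)} : v ∈ nicholsIdeal q ↔
    ∀ w : List (Fin θ), FreeAlgebra.algebraMapInv ((w.map (skewDer q)).prod v) = 0 := by
  simp [nicholsIdeal]

end FreeDegree

/-! ### Skew derivations of T(V) # H and the degree filtration -/

section Derivations

variable {k : Type*} [Field k] {H : Type*} [Ring H] [HopfAlgebra k H] {θ : ℕ}

lemma counit_leftTwist (χ : H →ₐ[k] k) (h : H) :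
    Coalgebra.counit (R := k) (leftTwist χ h) = χ h := by
  have h1 : ∀ z : H ⊗[k] H, Coalgebra.counit (R := k) (TensorProduct.lid k H
      (TensorProduct.map χ.toLinearMap LinearMap.id z)) =
      χ (TensorProduct.rid k H (LinearMap.lTensor H Coalgebra.counit z)) := by
    intro z
    induction z with
    | zero => simp
    | add a b ha hb => simp only [map_add, ha, hb]
    | tmul a b => simp [mul_comm]
  refine (h1 _).trans ?_
  rw [Coalgebra.lTensor_counit_comul]
  simp

lemma leftTwist_groupLike (χ : H →ₐ[k] k) {g : H} (hg : IsGroupLikeElem k g) :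
    leftTwist χ g = χ g • g := by
  simp [leftTwist, hg.comul_eq_tmul_self]

namespace Bos

variable (X : Fin θ → YDPair k H)

lemma isGroupLikeElem_ofH {g : H} (hg : IsGroupLikeElem k g) :
    IsGroupLikeElem k (ofH X g) where
  counit_eq_one := by rw [counit_ofH, hg.counit_eq_one]
  comul_eq_tmul_self := by
    rw [comul_ofH, hg.comul_eq_tmul_self]
    simp [ofHH]

@[simp] lemma ofV_ι (i : Fin θ) : ofV X (FreeAlgebra.ι k i) = x X i := by
  simp [ofV]

/-- The projection `T(V) # H → H`. -/
def toH : Bos X →ₐ[k] H := lift (AlgHom.id k H) (fun _ => 0) (by simp)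

@[simp] lemma toH_ofH (h : H) : toH X (ofH X h) = h := lift_ofH _ _ _ h

@[simp] lemma toH_x (i : Fin θ) : toH X (x X i) = 0 := lift_x _ _ _ i

lemma toH_ofV (v : FreeAlgebra k (Fin θ)) :
    toH X (ofV X v) = algebraMap k H (FreeAlgebra.algebraMapInv v) := by
  have : (toH X).comp (ofV X) = (Algebra.ofId k H).comp FreeAlgebra.algebraMapInv := by
    apply FreeAlgebra.hom_ext
    funext i
    simp [FreeAlgebra.algebraMapInv, Algebra.ofId_apply]
  exact AlgHom.congr_fun this v

lemma comul_toH (t : Bos X) : Coalgebra.comul (R := k) (toH X t) =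
    Algebra.TensorProduct.map (toH X) (toH X) (Coalgebra.comul (R := k) t) := by
  have : (Bialgebra.comulAlgHom k H).comp (toH X) =
      (Algebra.TensorProduct.map (toH X) (toH X)).comp (Bialgebra.comulAlgHom k (Bos X)) := by
    apply algHom_ext
    · intro h
      simp only [AlgHom.comp_apply, Bialgebra.comulAlgHom_apply, toH_ofH, comul_ofH]
      generalize Coalgebra.comul (R := k) h = w
      induction w with
      | zero => simp
      | add a b ha hb => simp only [map_add, ← ha, ← hb]
      | tmul c d => simp [ofHH]
    · intro i
      simp [comul_x]
  exact AlgHom.congr_fun this t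

lemma counit_toH (t : Bos X) : Coalgebra.counit (R := k) (toH X t) =
    Coalgebra.counit (R := k) t := by
  have : (Bialgebra.counitAlgHom k H).comp (toH X) = Bialgebra.counitAlgHom k (Bos X) := by
    apply algHom_ext
    · intro h
      simp [counit_ofH]
    · intro i
      simp [counit_x]
  exact AlgHom.congr_fun this t

/-- The character `χ_i` of `H`, extended to `T(V) # H`. -/
def char (i : Fin θ) : Bos X →ₐ[k] k := lift (X i).χ (fun _ => 0) (by simp)

@[simp] lemma char_ofH (i : Fin θ) (h : H) : char X i (ofH X h) = (X i).χ h := lift_ofH _ _ _ h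

@[simp] lemma char_x (i j : Fin θ) : char X i (x X j) = 0 := lift_x _ _ _ j

/-- The algebra map with entries `χ_i`, `ξ_i`, `0`, `ε`, where `ξ_i` is the skew derivation with
values in `k` dual to `x_i`. -/
def coordMatrix (i : Fin θ) : Bos X →ₐ[k] Matrix (Fin 2) (Fin 2) k :=
  lift ((Matrix.diagonalAlgHom k).comp (AlgHom.pi (R := k) (A := fun _ : Fin 2 => k)
      ![(X i).χ, Bialgebra.counitAlgHom k H]))
    (fun j => Matrix.single 0 1 (if i = j then 1 else 0)) (by
      intro j h
      have h1 : ∀ y, Matrix.diagonalAlgHom k (AlgHom.pi (R := k) (A := fun _ : Fin 2 => k)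
        ![(X i).χ, Bialgebra.counitAlgHom k H] y) =
          Matrix.diagonal ![(X i).χ y, Coalgebra.counit (R := k) y] := by
        intro y
        refine congrArg Matrix.diagonal (funext fun p => ?_)
        fin_cases p <;> rfl
      rw [AlgHom.comp_apply, AlgHom.comp_apply, h1, h1]
      ext p q
      rw [Matrix.diagonal_mul, Matrix.mul_diagonal]
      by_cases hij : i = j
      · subst hij
        fin_cases p <;> fin_cases q <;> simp [counit_leftTwist]
      · simp [hij])

/-- The functional `ξ_i` with `ξ_i(x_j h) = δ_{ij} ε(h)` that vanishes in degrees other than `1`. -/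
def coord (i : Fin θ) : Bos X →ₗ[k] k :=
  Matrix.entryLinearMap k k 0 1 ∘ₗ (coordMatrix X i).toLinearMap

lemma coordMatrix_ofH (i : Fin θ) (h : H) : coordMatrix X i (ofH X h) =
    Matrix.diagonal ![(X i).χ h, Coalgebra.counit (R := k) h] := by
  refine (lift_ofH _ _ _ h).trans (congrArg Matrix.diagonal (funext fun p => ?_))
  fin_cases p <;> rfl

lemma coordMatrix_x (i j : Fin θ) :
    coordMatrix X i (x X j) = Matrix.single 0 1 (if i = j then 1 else 0) :=
  lift_x _ _ _ j

@[simp] lemma coord_ofH (i : Fin θ) (h : H) : coord X i (ofH X h) = 0 := by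
  simp [coord, coordMatrix_ofH]

@[simp] lemma coord_x (i j : Fin θ) : coord X i (x X j) = if i = j then 1 else 0 := by
  simp [coord, coordMatrix_x]

lemma coordMatrix_apply (i : Fin θ) (t : Bos X) : coordMatrix X i t 0 0 = char X i t ∧
    coordMatrix X i t 1 0 = 0 ∧ coordMatrix X i t 1 1 = Coalgebra.counit (R := k) t := by
  induction t using induction with
  | hH h => simp [coordMatrix_ofH, counit_ofH]
  | hx j => simp [coordMatrix_x, counit_x]
  | hadd a b ha hb => simp [ha, hb]
  | hmul a b ha hb => simp [Matrix.mul_apply, ha, hb]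

lemma coord_mul (i : Fin θ) (a b : Bos X) : coord X i (a * b) =
    char X i a * coord X i b + coord X i a * Coalgebra.counit (R := k) b := by
  have h1 : coord X i (a * b) = coordMatrix X i (a * b) 0 1 := rfl
  rw [h1, map_mul, Matrix.mul_apply, Fin.sum_univ_two, (coordMatrix_apply X i a).1,
    (coordMatrix_apply X i b).2.2]
  rfl

/-- The skew derivation `t ↦ t₁ ξ_i(t₂)` of `T(V) # H`. -/
def der (i : Fin θ) : Module.End k (Bos X) := rcontr (coord X i)

/-- The map `t ↦ t₁ χ_i(t₂)`. -/
def charTwist (i : Fin θ) : Module.End k (Bos X) := rcontr (char X i).toLinearMap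

@[simp] lemma der_ofH (i : Fin θ) (h : H) : der X i (ofH X h) = 0 := by
  simp only [der, rcontr, LinearMap.comp_apply, comul_ofH]
  generalize Coalgebra.comul (R := k) h = w
  induction w with
  | zero => simp
  | add a b ha hb => simp only [map_add, ha, hb, add_zero]
  | tmul c d => simp [ofHH]

@[simp] lemma der_x (i j : Fin θ) :
    der X i (x X j) = if i = j then ofH X (X i).g else 0 := by
  have h1 : coord X i (1 : Bos X) = 0 := by
    rw [← map_one (ofH X), coord_ofH]
  simp only [der, rcontr, LinearMap.comp_apply, comul_x]
  by_cases hij : i = j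
  · subst hij
    simp [h1]
  · simp [h1, hij]

@[simp] lemma charTwist_x (i j : Fin θ) : charTwist X i (x X j) = x X j := by
  simp [charTwist, rcontr, comul_x]

lemma charTwist_mul (i : Fin θ) (a b : Bos X) :
    charTwist X i (a * b) = charTwist X i a * charTwist X i b :=
  map_mul ((Algebra.TensorProduct.rid k k (Bos X)).toAlgHom.comp
    ((Algebra.TensorProduct.map (.id k (Bos X)) (char X i)).comp
      (Bialgebra.comulAlgHom k (Bos X)))) a b

/-- The second tensor factors of Δ(v) lie in T(V), where `char` sees only the constant term. So on
T(V) the twist disappears from the Leibniz rule `der_mul`. -/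
lemma charTwist_ofV (i : Fin θ) (v : FreeAlgebra k (Fin θ)) :
    charTwist X i (ofV X v) = ofV X v := by
  induction v using FreeAlgebra.induction with
  | grade0 c =>
    rw [AlgHom.commutes, Algebra.algebraMap_eq_smul_one, map_smul]
    simp [charTwist, rcontr, Algebra.TensorProduct.one_def]
  | grade1 j => simp
  | mul a b ha hb => rw [map_mul, charTwist_mul, ha, hb]
  | add a b ha hb => rw [map_add, map_add, ha, hb]

lemma der_mul (i : Fin θ) (a b : Bos X) :
    der X i (a * b) = charTwist X i a * der X i b + der X i a * b := by
  have h1 : ∀ z w : Bos X ⊗[k] Bos X,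
      TensorProduct.rid k (Bos X) (LinearMap.lTensor (Bos X) (coord X i) (z * w)) =
      TensorProduct.rid k (Bos X) (LinearMap.lTensor (Bos X) (char X i).toLinearMap z) *
        TensorProduct.rid k (Bos X) (LinearMap.lTensor (Bos X) (coord X i) w) +
      TensorProduct.rid k (Bos X) (LinearMap.lTensor (Bos X) (coord X i) z) *
        TensorProduct.rid k (Bos X) (LinearMap.lTensor (Bos X) Coalgebra.counit w) := by
    intro z w
    induction z with
    | zero => simp
    | add a b ha hb => simp only [map_add, add_mul, ha, hb]; abel
    | tmul a b =>
      induction w with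
      | zero => simp
      | add a b ha hb => simp only [map_add, mul_add, ha, hb]; abel
      | tmul c d =>
        simp [coord_mul, add_smul, smul_smul, mul_comm]
  have h2 := h1 (Coalgebra.comul (R := k) a) (Coalgebra.comul (R := k) b)
  rw [← Bialgebra.comul_mul, Coalgebra.lTensor_counit_comul] at h2
  simpa [der, charTwist, rcontr] using h2

lemma ofH_g_mul_ofV (i : Fin θ) (v : FreeAlgebra k (Fin θ)) :
    ofH X (X i).g * ofV X v = ofV X (diagAct (braidingMatrix X) i v) * ofH X (X i).g := by
  induction v using FreeAlgebra.induction with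
  | grade0 c => rw [diagAct_algebraMap, AlgHom.commutes, Algebra.commutes]
  | grade1 j =>
    rw [diagAct_ι, map_smul, ofV_ι, ofH_mul_x, leftTwist_groupLike _ (X i).isGroupLike, map_smul,
      mul_smul_comm, smul_mul_assoc]
    rfl
  | mul a b ha hb =>
    rw [map_mul, ← mul_assoc, ha, mul_assoc, hb, ← mul_assoc, ← map_mul, ← diagAct_mul]
  | add a b ha hb => rw [map_add, mul_add, ha, hb, diagAct_add, map_add, add_mul]

/-- Contracting g_i ⊗ x_i leaves the factor g_i. Moving it to the right past later letters produces
the diagonal action in the Leibniz rule of `skewDer`. Being invertible, it does not affect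
vanishing. -/
lemma der_ofV (i : Fin θ) (v : FreeAlgebra k (Fin θ)) :
    der X i (ofV X v) = ofV X (skewDer (braidingMatrix X) i v) * ofH X (X i).g := by
  induction v using FreeAlgebra.induction with
  | grade0 c =>
    rw [AlgHom.commutes, ← (ofH X).commutes, der_ofH, skewDer_algebraMap, map_zero, zero_mul]
  | grade1 j =>
    rw [ofV_ι, der_x, skewDer_ι]
    split_ifs <;> simp
  | mul a b ha hb =>
    rw [map_mul, der_mul, charTwist_ofV, ha, hb, skewDer_mul, mul_assoc, ofH_g_mul_ofV, map_add,
      map_mul, map_mul, add_mul, mul_assoc, mul_assoc]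
  | add a b ha hb => simp only [map_add, ha, hb, add_mul]

lemma der_mul_ofH (i : Fin θ) (a : Bos X) (h : H) :
    der X i (a * ofH X h) = der X i a * ofH X h := by
  rw [der_mul, der_ofH, mul_zero, zero_add]

lemma prod_der_mul_ofH (w : List (Fin θ)) (a : Bos X) (h : H) :
    (w.map (der X)).prod (a * ofH X h) = (w.map (der X)).prod a * ofH X h := by
  induction w with
  | nil => simp
  | cons i w ih => simp [ih, der_mul_ofH]

lemma prod_der_ofV (w : List (Fin θ)) (v : FreeAlgebra k (Fin θ)) :
    (w.map (der X)).prod (ofV X v) =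
      ofV X ((w.map (skewDer (braidingMatrix X))).prod v) *
        ofH X (w.map fun i => (X i).g).prod := by
  induction w with
  | nil => simp
  | cons i w ih =>
    simp only [List.map_cons, List.prod_cons, Module.End.mul_apply, ih, der_mul_ofH, der_ofV,
      map_mul, mul_assoc]

lemma comul_prod_der (w : List (Fin θ)) (t : Bos X) :
    Coalgebra.comul (R := k) ((w.map (der X)).prod t) =
      LinearMap.lTensor (Bos X) (w.map (der X)).prod (Coalgebra.comul (R := k) t) := by
  induction w with
  | nil => simp [Module.End.one_eq_id]
  | cons i w ih =>
    rw [List.map_cons, List.prod_cons, Module.End.mul_apply, der, comul_rcontr, ih,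
      Module.End.mul_eq_comp, LinearMap.lTensor_comp]
    rfl

/-- Maps D with Δ(D t) = t₁ ⊗ D t₂ are contractions with a functional: apply id ⊗ ε. In this form
they can be compared with coactions on quotients. -/
lemma prod_der_eq (w : List (Fin θ)) (t : Bos X) : (w.map (der X)).prod t =
    rcontr (Coalgebra.counit ∘ₗ (w.map (der X)).prod) t := by
  have h1 := congrArg (fun z => TensorProduct.rid k (Bos X)
    (LinearMap.lTensor (Bos X) Coalgebra.counit z)) (comul_prod_der X w t)
  simp only [Coalgebra.lTensor_counit_comul] at h1
  rw [← LinearMap.comp_apply (LinearMap.lTensor _ _), ← LinearMap.lTensor_comp] at h1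
  simpa [rcontr] using h1

/-- The elements of `T(V) # H` of degree less than `n`. -/
def fil (n : ℕ) : Submodule k (Bos X) :=
  Submodule.span k {t | ∃ v ∈ wordsLT k θ n, ∃ h : H, t = ofV X v * ofH X h}

lemma fil_zero : fil X 0 = ⊥ := by
  rw [fil, Submodule.span_eq_bot]
  rintro _ ⟨v, hv, h, rfl⟩
  rw [wordsLT_zero, Submodule.mem_bot] at hv
  simp [hv]

lemma fil_mono {m n : ℕ} (h : m ≤ n) : fil X m ≤ fil X n :=
  Submodule.span_mono fun _ ⟨v, hv, a, ha⟩ => ⟨v, wordsLT_mono h hv, a, ha⟩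

lemma ofV_mul_ofH_mem_fil {n : ℕ} {v : FreeAlgebra k (Fin θ)} (hv : v ∈ wordsLT k θ n) (h : H) :
    ofV X v * ofH X h ∈ fil X n := Submodule.subset_span ⟨v, hv, h, rfl⟩

lemma ofV_mem_fil {n : ℕ} {v : FreeAlgebra k (Fin θ)} (hv : v ∈ wordsLT k θ n) :
    ofV X v ∈ fil X n := by
  simpa using ofV_mul_ofH_mem_fil X hv 1

lemma one_mem_wordsLT (n : ℕ) : (1 : FreeAlgebra k (Fin θ)) ∈ wordsLT k θ (n + 1) :=
  Submodule.subset_span ⟨[], by simp, by simp⟩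

lemma ofH_mem_fil (h : H) (n : ℕ) : ofH X h ∈ fil X (n + 1) := by
  simpa using ofV_mul_ofH_mem_fil X (one_mem_wordsLT n) h

/-- `fil` is indexed by strict bounds: its step one is H, and its step two is spanned by H and the
x_i H. -/
lemma mem_fil_one {t : Bos X} (ht : t ∈ fil X 1) : ∃ h, t = ofH X h := by
  have : fil X 1 ≤ LinearMap.range (ofH X).toLinearMap := by
    refine Submodule.span_le.mpr ?_
    rintro _ ⟨v, hv, h, rfl⟩
    have hv' := wordsLT_succ 0 hv
    rw [wordsLT_zero, sup_bot_eq] at hv'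
    obtain ⟨c, rfl⟩ := mem_wordsEq_zero hv'
    exact ⟨c • h, by simp [Algebra.smul_def]⟩
  obtain ⟨h, hh⟩ := this ht
  exact ⟨h, hh.symm⟩

lemma mul_ofH_mem_fil {n : ℕ} {t : Bos X} (ht : t ∈ fil X n) (h : H) :
    t * ofH X h ∈ fil X n := by
  have : fil X n ≤ (fil X n).comap (LinearMap.mulRight k (ofH X h)) := by
    refine Submodule.span_le.mpr ?_
    rintro _ ⟨v, hv, a, rfl⟩
    exact Submodule.subset_span ⟨v, hv, a * h, by simp [mul_assoc]⟩
  exact this ht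

lemma x_mul_mem_fil (i : Fin θ) {n : ℕ} {t : Bos X} (ht : t ∈ fil X n) :
    x X i * t ∈ fil X (n + 1) := by
  have : fil X n ≤ (fil X (n + 1)).comap (LinearMap.mulLeft k (x X i)) := by
    refine Submodule.span_le.mpr ?_
    rintro _ ⟨v, hv, a, rfl⟩
    exact Submodule.subset_span ⟨_, ι_mul_mem_wordsLT i hv, a, by simp [mul_assoc]⟩
  exact this ht

lemma mul_x_mem_fil (i : Fin θ) {n : ℕ} {t : Bos X} (ht : t ∈ fil X n) :
    t * x X i ∈ fil X (n + 1) := by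
  have : fil X n ≤ (fil X (n + 1)).comap (LinearMap.mulRight k (x X i)) := by
    refine Submodule.span_le.mpr ?_
    rintro _ ⟨v, hv, a, rfl⟩
    exact Submodule.subset_span ⟨_, mul_ι_mem_wordsLT i hv, leftTwist (X i).χ a, by
      simp [mul_assoc, ofH_mul_x]⟩
  exact this ht

lemma exists_mem_fil (t : Bos X) : ∃ n, t ∈ fil X n := by
  -- Stability under right multiplication by `s` is proved instead, so that the product case of the
  -- induction is composition.
  have hx : ∀ (s t : Bos X), (∃ n, t ∈ fil X n) → ∃ n, t * s ∈ fil X n := by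
    intro s
    induction s using induction with
    | hH h => rintro t ⟨n, hn⟩; exact ⟨n, mul_ofH_mem_fil X hn h⟩
    | hx i => rintro t ⟨n, hn⟩; exact ⟨n + 1, mul_x_mem_fil X i hn⟩
    | hadd a b ha hb =>
      intro t ht
      obtain ⟨m, hm⟩ := ha t ht
      obtain ⟨n, hn⟩ := hb t ht
      exact ⟨max m n, by
        rw [mul_add]
        exact add_mem (fil_mono X (le_max_left _ _) hm) (fil_mono X (le_max_right _ _) hn)⟩
    | hmul a b ha hb =>
      intro t ht
      rw [← mul_assoc]
      exact hb _ (ha t ht)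
  have := hx t 1 ⟨1, by simpa using ofH_mem_fil X 1 0⟩
  rwa [one_mul] at this

lemma prod_der_mem_fil (w : List (Fin θ)) {n : ℕ} {t : Bos X} (ht : t ∈ fil X n) :
    (w.map (der X)).prod t ∈ fil X (n - w.length) := by
  have : fil X n ≤ (fil X (n - w.length)).comap (w.map (der X)).prod := by
    refine Submodule.span_le.mpr ?_
    rintro _ ⟨v, hv, a, rfl⟩
    rw [SetLike.mem_coe, Submodule.mem_comap, prod_der_mul_ofH, prod_der_ofV, mul_assoc, ← map_mul]
    exact ofV_mul_ofH_mem_fil X (prod_skewDer_mem_wordsLT _ w hv) _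
  exact this ht

lemma prod_der_eq_zero (w : List (Fin θ)) {n : ℕ} (hn : n ≤ w.length) {t : Bos X}
    (ht : t ∈ fil X n) : (w.map (der X)).prod t = 0 := by
  have := prod_der_mem_fil X w ht
  rwa [show n - w.length = 0 by omega, fil_zero, Submodule.mem_bot] at this

/-- Elements of `T(V) # H` in terms of a basis of `H`. -/
lemma exists_expansion {ι : Type*} (b : Module.Basis ι k H) {n : ℕ} {t : Bos X}
    (ht : t ∈ fil X n) : ∃ v : ι →₀ FreeAlgebra k (Fin θ), (∀ a, v a ∈ wordsLT k θ n) ∧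
      t = v.sum fun a y => ofV X y * ofH X (b a) := by
  classical
  induction ht using Submodule.span_induction with
  | mem t ht =>
    obtain ⟨v, hv, h, rfl⟩ := ht
    refine ⟨(b.repr h).mapRange (fun c => c • v) (zero_smul _ _), fun a => ?_, ?_⟩
    · rw [Finsupp.mapRange_apply]
      exact Submodule.smul_mem _ _ hv
    · rw [Finsupp.sum_mapRange_index (by simp)]
      conv_lhs => rw [← b.linearCombination_repr h]
      simp [Finsupp.linearCombination_apply, Finsupp.sum, Finset.mul_sum]
  | zero => exact ⟨0, by simp, by simp⟩
  | add s t _ _ hs ht =>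
    obtain ⟨v, hv, rfl⟩ := hs
    obtain ⟨w, hw, rfl⟩ := ht
    refine ⟨v + w, fun a => add_mem (hv a) (hw a), ?_⟩
    rw [Finsupp.sum_add_index' (by simp) (by simp [add_mul])]
  | smul c t _ ht =>
    obtain ⟨v, hv, rfl⟩ := ht
    refine ⟨c • v, fun a => Submodule.smul_mem _ _ (hv a), ?_⟩
    rw [Finsupp.sum_smul_index' (by simp), Finsupp.smul_sum]
    simp

lemma toH_prod_der_expansion {ι : Type*} (b : Module.Basis ι k H)
    (v : ι →₀ FreeAlgebra k (Fin θ)) (w : List (Fin θ)) :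
    toH X ((w.map (der X)).prod (v.sum fun a y => ofV X y * ofH X (b a))) =
      (w.map fun i => (X i).g).prod * v.sum fun a y => FreeAlgebra.algebraMapInv
        ((w.map (skewDer (braidingMatrix X))).prod y) • b a := by
  rw [map_finsuppSum, map_finsuppSum, Finsupp.mul_sum]
  refine Finsupp.sum_congr fun a _ => ?_
  rw [prod_der_mul_ofH, prod_der_ofV, map_mul, map_mul, toH_ofH, toH_ofH, toH_ofV,
    Algebra.algebraMap_eq_smul_one, smul_mul_assoc, smul_mul_assoc, one_mul, mul_smul_comm]

/-- Projecting the iterated derivative to H gives a product of group-likes times a combination of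
basis vectors, whose coefficients are the constant terms in question. The group-likes are invertible
and the basis vectors independent. -/
lemma algebraMapInv_eq_zero_of_expansion {ι : Type*} (b : Module.Basis ι k H)
    (v : ι →₀ FreeAlgebra k (Fin θ)) (w : List (Fin θ))
    (h : toH X ((w.map (der X)).prod (v.sum fun a y => ofV X y * ofH X (b a))) = 0) (a : ι) :
    FreeAlgebra.algebraMapInv ((w.map (skewDer (braidingMatrix X))).prod (v a)) = 0 := by
  classical
  have hg : IsUnit (w.map fun i => (X i).g).prod := by
    clear h
    induction w with
    | nil => simp
    | cons i w ih =>
      rw [List.map_cons, List.prod_cons]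
      exact (X i).isGroupLike.isUnit.mul ih
  rw [toH_prod_der_expansion, hg.mul_right_eq_zero] at h
  have h1 := congrArg (fun y => b.repr y a) h
  rw [map_finsuppSum] at h1
  simp only [map_smul, Module.Basis.repr_self, map_zero, Finsupp.coe_zero, Pi.zero_apply,
    Finsupp.sum, Finsupp.coe_finsetSum, Finset.sum_apply, Finsupp.smul_apply,
    Finsupp.single_apply, smul_eq_mul, mul_ite, mul_one, mul_zero] at h1
  rw [Finset.sum_ite_eq'] at h1
  split_ifs at h1 with h2
  · exact h1
  · rw [Finsupp.notMem_support_iff.mp h2]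
    simp

end Bos

end Derivations

/-! ### Top symbols and the filtration of the comultiplication -/

section Filtration

variable {k : Type*} [Field k] {H : Type*} [Ring H] [HopfAlgebra k H] {θ : ℕ}

/-- The subspace `P ⊗ Q` of a tensor product. -/
abbrev tens {M N : Type*} [AddCommGroup M] [Module k M] [AddCommGroup N] [Module k N]
    (P : Submodule k M) (Q : Submodule k N) : Submodule k (M ⊗[k] N) :=
  Submodule.map₂ (TensorProduct.mk k M N) P Q

lemma tmul_mem_tens {M N : Type*} [AddCommGroup M] [Module k M] [AddCommGroup N] [Module k N]
    {P : Submodule k M} {Q : Submodule k N} {a : M} {b : N} (ha : a ∈ P) (hb : b ∈ Q) :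
    a ⊗ₜ[k] b ∈ tens P Q := Submodule.apply_mem_map₂ _ ha hb

lemma map_mem_of_mem_tens {M N V : Type*} [AddCommGroup M] [Module k M] [AddCommGroup N]
    [Module k N] [AddCommGroup V] [Module k V] {P : Submodule k M} {Q : Submodule k N}
    {U : Submodule k V} {f : M ⊗[k] N →ₗ[k] V} (h : ∀ a ∈ P, ∀ b ∈ Q, f (a ⊗ₜ b) ∈ U)
    {z : M ⊗[k] N} (hz : z ∈ tens P Q) : f z ∈ U := by
  have : tens P Q ≤ U.comap f := Submodule.map₂_le.mpr h
  exact this hz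

/-- The ideal spanned by `s` is additively generated by the products a x b, so `U` need not be
packaged as an ideal. This is used for sets cut out by derivations or by degree conditions. -/
lemma span_le_addSubgroup {R : Type*} [Ring R] {s : Set R} {U : AddSubgroup R}
    (h : ∀ a b, ∀ x ∈ s, a * x * b ∈ U) {t : R} (ht : t ∈ TwoSidedIdeal.span s) : t ∈ U := by
  rw [TwoSidedIdeal.mem_span_iff_mem_addSubgroup_closure] at ht
  refine (AddSubgroup.closure_le U).mpr ?_ ht
  rintro _ ⟨_, ⟨a, _, x, hx, rfl⟩, b, _, rfl⟩
  exact h a b x hx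

lemma prod_ofFn_update {M : Type*} [Monoid M] {n : ℕ} (a : Fin n → M)
    (hc : ∀ i j, Commute (a i) (a j)) (c : Fin n → ℕ) (j : Fin n) :
    (List.ofFn fun i => a i ^ (c i + if j = i then 1 else 0)).prod =
      a j * (List.ofFn fun i => a i ^ c i).prod := by
  induction n with
  | zero => exact j.elim0
  | succ n ih =>
    rw [List.ofFn_succ, List.ofFn_succ, List.prod_cons, List.prod_cons]
    refine Fin.cases ?_ (fun j => ?_) j
    · have : ∀ i : Fin n, (0 : Fin (n + 1)) ≠ i.succ := fun i => (Fin.succ_ne_zero i).symm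
      simp [this, pow_succ', mul_assoc]
    · have h1 := ih (fun i => a i.succ) (fun i j => hc _ _) (fun i => c i.succ) j
      simp only [Fin.succ_inj, Fin.succ_ne_zero, if_false, add_zero] at h1 ⊢
      rw [h1, ← mul_assoc, ← mul_assoc, ((hc 0 j.succ).pow_left _).eq]

/-- Relates the ordered products of powers in the definitions of g_r and χ_r to the product along
any word of the same multidegree. -/
lemma prod_ofFn_count {M : Type*} [Monoid M] {n : ℕ} (a : Fin n → M)
    (hc : ∀ i j, Commute (a i) (a j)) (w : List (Fin n)) :
    (List.ofFn fun i => a i ^ w.count i).prod = (w.map a).prod := by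
  induction w with
  | nil => simp
  | cons j w ih =>
    rw [List.map_cons, List.prod_cons, ← ih, ← prod_ofFn_update a hc]
    congr 2
    ext i
    rw [List.count_cons]
    simp

/-- The Yetter-Drinfeld condition of y at h = g_x: both twists multiply g_x by the nonzero scalar
χ_y(g_x), which cancels. -/
lemma YDPair.g_commute (x y : YDPair k H) : Commute x.g y.g := by
  have h1 := y.compat x.g
  have h2 : rightTwist y.χ x.g = y.χ x.g • x.g := by
    simp [rightTwist, x.isGroupLike.comul_eq_tmul_self]
  rw [leftTwist_groupLike _ x.isGroupLike, h2, smul_mul_assoc, mul_smul_comm] at h1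
  have h3 : IsUnit (y.χ x.g) := x.isGroupLike.isUnit.map y.χ
  exact smul_right_injective H h3.ne_zero h1

lemma groupLike_eq (X : Fin θ → YDPair k H) {d : Fin θ → ℕ} {w : List (Fin θ)}
    (hw : ∀ i, w.count i = d i) : groupLike X d = (w.map fun i => (X i).g).prod := by
  rw [groupLike, ← prod_ofFn_count _ fun i j => (X i).g_commute (X j)]
  simp [hw]

lemma isGroupLikeElem_prod (X : Fin θ → YDPair k H) (w : List (Fin θ)) :
    IsGroupLikeElem k (w.map fun i => (X i).g).prod := by
  induction w with
  | nil => simpa using IsGroupLikeElem.one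
  | cons i w ih =>
    rw [List.map_cons, List.prod_cons]
    exact (X i).isGroupLike.mul ih

lemma isGroupLikeElem_groupLike (X : Fin θ → YDPair k H) (d : Fin θ → ℕ) :
    IsGroupLikeElem k (groupLike X d) := by
  obtain ⟨w, hw⟩ : ∃ w : List (Fin θ), ∀ i, w.count i = d i := by
    classical
    refine ⟨(Finsupp.toMultiset (Finsupp.equivFunOnFinite.symm d)).toList, fun i => ?_⟩
    rw [← Multiset.coe_count, Multiset.coe_toList, Finsupp.count_toMultiset]
    rfl
  rw [groupLike_eq X hw]
  exact isGroupLikeElem_prod X w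

lemma length_of_count {d : Fin θ → ℕ} {w : List (Fin θ)} (hw : ∀ i, w.count i = d i) :
    w.length = ∑ i, d i := by
  have h1 := Multiset.toFinset_sum_count_eq (w : Multiset (Fin θ))
  rw [Multiset.coe_card] at h1
  rw [← h1]
  refine (Finset.sum_subset (Finset.subset_univ _) fun i _ hi => ?_).trans
    (Finset.sum_congr rfl fun i _ => ?_)
  · rw [Multiset.coe_count]
    exact List.count_eq_zero.mpr (by simpa using hi)
  · rw [Multiset.coe_count, hw]

lemma homogeneousPart_le (d : Fin θ → ℕ) : homogeneousPart k d ≤ wordsEq k θ (∑ i, d i) :=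
  Submodule.span_mono fun _ ⟨w, hw, hv⟩ => ⟨w, length_of_count hw, hv⟩

namespace Bos

variable (X : Fin θ → YDPair k H)

lemma ofV_word_cons (i : Fin θ) (w : List (Fin θ)) :
    ofV X ((i :: w).map (FreeAlgebra.ι k)).prod =
      x X i * ofV X (w.map (FreeAlgebra.ι k)).prod := by
  simp

lemma exists_ofH_mul_word (w : List (Fin θ)) (h : H) : ∃ h', ofH X h *
    ofV X (w.map (FreeAlgebra.ι k)).prod = ofV X (w.map (FreeAlgebra.ι k)).prod * ofH X h' := by
  induction w generalizing h with
  | nil => exact ⟨h, by simp⟩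
  | cons i w ih =>
    obtain ⟨h', hh⟩ := ih (leftTwist (X i).χ h)
    refine ⟨h', ?_⟩
    rw [ofV_word_cons, ← mul_assoc, ofH_mul_x, mul_assoc, hh, mul_assoc]

lemma ofH_mul_mem_fil (h : H) {n : ℕ} {t : Bos X} (ht : t ∈ fil X n) :
    ofH X h * t ∈ fil X n := by
  have : fil X n ≤ (fil X n).comap (LinearMap.mulLeft k (ofH X h)) := by
    refine Submodule.span_le.mpr ?_
    rintro _ ⟨v, hv, a, rfl⟩
    rw [SetLike.mem_coe, Submodule.mem_comap, LinearMap.mulLeft_apply, ← mul_assoc]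
    refine mul_ofH_mem_fil X ?_ a
    have h1 : wordsLT k θ n ≤
        (fil X n).comap (LinearMap.mulLeft k (ofH X h) ∘ₗ (ofV X).toLinearMap) := by
      refine Submodule.span_le.mpr ?_
      rintro _ ⟨w, hw, rfl⟩
      obtain ⟨h', hh⟩ := exists_ofH_mul_word X w h
      rw [SetLike.mem_coe, Submodule.mem_comap, LinearMap.comp_apply, LinearMap.mulLeft_apply,
        AlgHom.toLinearMap_apply, hh]
      exact ofV_mul_ofH_mem_fil X (Submodule.subset_span ⟨w, hw, rfl⟩) h'
    exact h1 hv
  exact this ht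

/-- The component of highest degree in the second factor of the comultiplication. -/
lemma comul_ofV_sub_right {d : Fin θ → ℕ} {v : FreeAlgebra k (Fin θ)}
    (hv : v ∈ homogeneousPart k d) :
    Coalgebra.comul (R := k) (ofV X v) - ofH X (groupLike X d) ⊗ₜ[k] ofV X v ∈
      tens ⊤ ((wordsLT k θ (∑ i, d i)).map (ofV X).toLinearMap) := by
  have key : ∀ w : List (Fin θ), Coalgebra.comul (R := k) (ofV X (w.map (FreeAlgebra.ι k)).prod) -
      ofH X (w.map fun i => (X i).g).prod ⊗ₜ[k] ofV X (w.map (FreeAlgebra.ι k)).prod ∈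
      tens ⊤ ((wordsLT k θ w.length).map (ofV X).toLinearMap) := by
    intro w
    induction w with
    | nil => simp [Algebra.TensorProduct.one_def]
    | cons i w ih =>
      set y := ofV X (w.map (FreeAlgebra.ι k)).prod with hy
      set g := (w.map fun i => (X i).g).prod
      set U := (wordsLT k θ (i :: w).length).map (ofV X).toLinearMap
      have e1 : ofH X ((i :: w).map fun i => (X i).g).prod = ofH X (X i).g * ofH X g := by simp [g]
      rw [ofV_word_cons, Bialgebra.comul_mul, comul_x, e1]
      -- Of the two products with the top term g ⊗ y, the one with g_i ⊗ x_i is the new top term.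
      -- The other keeps the second factor y, whose length is too small.
      have e2 : (x X i ⊗ₜ[k] 1 + ofH X (X i).g ⊗ₜ[k] x X i) * Coalgebra.comul (R := k) y -
          (ofH X (X i).g * ofH X g) ⊗ₜ[k] (x X i * y) =
          (x X i * ofH X g) ⊗ₜ[k] y + LinearMap.mulLeft k (x X i ⊗ₜ[k] 1 + ofH X (X i).g ⊗ₜ[k] x X i)
            (Coalgebra.comul (R := k) y - ofH X g ⊗ₜ[k] y) := by
        simp only [LinearMap.mulLeft_apply, mul_sub, add_mul,
          Algebra.TensorProduct.tmul_mul_tmul, one_mul]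
        abel
      rw [e2]
      refine add_mem (tmul_mem_tens trivial
        ⟨_, Submodule.subset_span ⟨w, by simp, rfl⟩, rfl⟩) ?_
      refine map_mem_of_mem_tens (fun a _ b hb => ?_) ih
      obtain ⟨v, hv, rfl⟩ := hb
      rw [LinearMap.mulLeft_apply, add_mul, Algebra.TensorProduct.tmul_mul_tmul,
        Algebra.TensorProduct.tmul_mul_tmul, one_mul]
      refine add_mem (tmul_mem_tens trivial ⟨v, wordsLT_mono (by simp) hv, rfl⟩)
        (tmul_mem_tens trivial ⟨_, ι_mul_mem_wordsLT i hv, by simp⟩)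
  have : homogeneousPart k d ≤ (tens ⊤ ((wordsLT k θ (∑ i, d i)).map (ofV X).toLinearMap)).comap
      (Coalgebra.comul ∘ₗ (ofV X).toLinearMap -
        TensorProduct.mk k (Bos X) (Bos X) (ofH X (groupLike X d)) ∘ₗ (ofV X).toLinearMap) := by
    refine Submodule.span_le.mpr ?_
    rintro _ ⟨w, hw, rfl⟩
    have := key w
    rw [length_of_count hw, ← groupLike_eq X hw] at this
    exact this
  exact this hv

/-- The component of highest degree in the first factor of the comultiplication. -/
lemma comul_ofV_sub_left {n : ℕ} {v : FreeAlgebra k (Fin θ)} (hv : v ∈ wordsEq k θ n) :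
    Coalgebra.comul (R := k) (ofV X v) - ofV X v ⊗ₜ[k] 1 ∈ tens (fil X n) ⊤ := by
  have key : ∀ w : List (Fin θ), Coalgebra.comul (R := k) (ofV X (w.map (FreeAlgebra.ι k)).prod) -
      ofV X (w.map (FreeAlgebra.ι k)).prod ⊗ₜ[k] 1 ∈ tens (fil X w.length) ⊤ := by
    intro w
    induction w with
    | nil => simp [Algebra.TensorProduct.one_def]
    | cons i w ih =>
      set y := ofV X (w.map (FreeAlgebra.ι k)).prod with hy
      have hyf : y ∈ fil X (w.length + 1) :=
        ofV_mem_fil X (Submodule.subset_span ⟨w, by simp, rfl⟩)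
      rw [ofV_word_cons, Bialgebra.comul_mul, comul_x]
      have e2 : (x X i ⊗ₜ[k] 1 + ofH X (X i).g ⊗ₜ[k] x X i) * Coalgebra.comul (R := k) y -
          (x X i * y) ⊗ₜ[k] 1 =
          (ofH X (X i).g * y) ⊗ₜ[k] x X i +
            LinearMap.mulLeft k (x X i ⊗ₜ[k] 1 + ofH X (X i).g ⊗ₜ[k] x X i)
            (Coalgebra.comul (R := k) y - y ⊗ₜ[k] 1) := by
        simp only [LinearMap.mulLeft_apply, mul_sub, add_mul,
          Algebra.TensorProduct.tmul_mul_tmul, mul_one]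
        abel
      rw [e2, List.length_cons]
      refine add_mem (tmul_mem_tens (ofH_mul_mem_fil X _ hyf) trivial) ?_
      refine map_mem_of_mem_tens (fun a ha b _ => ?_) ih
      rw [LinearMap.mulLeft_apply, add_mul, Algebra.TensorProduct.tmul_mul_tmul,
        Algebra.TensorProduct.tmul_mul_tmul]
      refine add_mem (tmul_mem_tens (x_mul_mem_fil X i ha) trivial)
        (tmul_mem_tens (fil_mono X (Nat.le_succ _) (ofH_mul_mem_fil X _ ha)) trivial)
  have : wordsEq k θ n ≤ (tens (fil X n) ⊤).comap (Coalgebra.comul ∘ₗ (ofV X).toLinearMap -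
        (TensorProduct.mk k (Bos X) (Bos X)).flip 1 ∘ₗ (ofV X).toLinearMap) := by
    refine Submodule.span_le.mpr ?_
    rintro _ ⟨w, rfl, rfl⟩
    exact key w
  exact this hv

/-- The filtration of the tensor square of `T(V) # H`. -/
def fil₂ (n : ℕ) : Submodule k (Bos X ⊗[k] Bos X) :=
  ⨆ p : Fin (n + 1), tens (fil X (p + 1)) (fil X (n - p + 1))

lemma tmul_mem_fil₂ {n i j : ℕ} (h : i + j = n) {a b : Bos X} (ha : a ∈ fil X (i + 1))
    (hb : b ∈ fil X (j + 1)) : a ⊗ₜ[k] b ∈ fil₂ X n := by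
  refine Submodule.mem_iSup_of_mem ⟨i, by omega⟩ (tmul_mem_tens ha ?_)
  rwa [show n - i = j by omega]

lemma map_mem_of_mem_fil₂ {n : ℕ} {V : Type*} [AddCommGroup V] [Module k V] {U : Submodule k V}
    {f : Bos X ⊗[k] Bos X →ₗ[k] V} (h : ∀ i j, i + j = n → ∀ a ∈ fil X (i + 1),
      ∀ b ∈ fil X (j + 1), f (a ⊗ₜ b) ∈ U)
    {z : Bos X ⊗[k] Bos X} (hz : z ∈ fil₂ X n) : f z ∈ U := by
  have : fil₂ X n ≤ U.comap f := iSup_le fun p =>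
    Submodule.map₂_le.mpr (h p (n - p) (by have := p.2; omega))
  exact this hz

/-- Each letter contributes its degree to one of the two tensor factors. Because of the strict
bounds in `fil`, both sides speak of degree at most `n`. -/
lemma comul_mem_fil₂ {n : ℕ} {t : Bos X} (ht : t ∈ fil X (n + 1)) :
    Coalgebra.comul (R := k) t ∈ fil₂ X n := by
  have key : ∀ w : List (Fin θ), ∀ n, w.length ≤ n →
      Coalgebra.comul (R := k) (ofV X (w.map (FreeAlgebra.ι k)).prod) ∈ fil₂ X n := by
    intro w
    induction w with
    | nil =>
      intro n _
      have h1 : ∀ m, (1 : Bos X) ∈ fil X (m + 1) := fun m => by simpa using ofH_mem_fil X 1 m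
      simp only [List.map_nil, List.prod_nil, map_one, Bialgebra.comul_one,
        Algebra.TensorProduct.one_def]
      exact tmul_mem_fil₂ X (add_zero n) (h1 n) (h1 0)
    | cons i w ih =>
      intro n hn
      obtain ⟨n, rfl⟩ : ∃ m, n = m + 1 := ⟨n - 1, by simp at hn; omega⟩
      rw [ofV_word_cons, Bialgebra.comul_mul, comul_x, ← LinearMap.mulLeft_apply (R := k)]
      refine map_mem_of_mem_fil₂ X (fun p q hpq a ha b hb => ?_)
        (ih n (by simpa using hn))
      rw [LinearMap.mulLeft_apply, add_mul, Algebra.TensorProduct.tmul_mul_tmul,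
        Algebra.TensorProduct.tmul_mul_tmul, one_mul]
      exact add_mem (tmul_mem_fil₂ X (i := p + 1) (j := q) (by omega) (x_mul_mem_fil X i ha) hb)
        (tmul_mem_fil₂ X (i := p) (j := q + 1) (by omega) (ofH_mul_mem_fil X _ ha)
          (x_mul_mem_fil X i hb))
  have h2 : fil X (n + 1) ≤ (fil₂ X n).comap Coalgebra.comul := by
    refine Submodule.span_le.mpr ?_
    rintro _ ⟨v, hv, h, rfl⟩
    rw [SetLike.mem_coe, Submodule.mem_comap, Bialgebra.comul_mul, comul_ofH]
    have h3 : wordsLT k θ (n + 1) ≤ (fil₂ X n).comap (Coalgebra.comul ∘ₗ (ofV X).toLinearMap) := by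
      refine Submodule.span_le.mpr ?_
      rintro _ ⟨w, hw, rfl⟩
      exact key w n (by omega)
    have h4 : Coalgebra.comul (R := k) (ofV X v) ∈ fil₂ X n := h3 hv
    generalize Coalgebra.comul (R := k) h = z
    induction z with
    | zero => simp
    | add a b ha hb => rw [map_add, mul_add]; exact add_mem ha hb
    | tmul a b =>
      rw [← LinearMap.mulRight_apply (R := k)]
      refine map_mem_of_mem_fil₂ X (fun p q hpq y hy z hz => ?_) h4
      rw [LinearMap.mulRight_apply, ofHH, Algebra.TensorProduct.map_tmul,
        Algebra.TensorProduct.tmul_mul_tmul]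
      exact tmul_mem_fil₂ X hpq (mul_ofH_mem_fil X hy a) (mul_ofH_mem_fil X hz b)
  exact h2 ht

/-- With respect to a basis of H, the coefficients of the leading part are homogeneous of degree
`d`, so only derivatives of order `d` can have a nonzero constant term on them, and these vanish by
hypothesis. Hence the leading part lies in 𝒥(V) # H. -/
lemma exists_symbol_of_prod_der_eq_zero {d : ℕ} {t : Bos X} (ht : t ∈ fil X (d + 1))
    (hw : ∀ w : List (Fin θ), w.length = d → (w.map (der X)).prod t = 0) :
    ∃ (s : Finset H) (v : H → FreeAlgebra k (Fin θ)),
      (∀ a ∈ s, v a ∈ wordsEq k θ d ∧ v a ∈ nicholsIdeal (braidingMatrix X)) ∧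
      t - ∑ a ∈ s, ofV X (v a) * ofH X a ∈ fil X d := by
  classical
  let b := Module.Basis.ofVectorSpace k H
  obtain ⟨v, hv, rfl⟩ := exists_expansion X b ht
  have h1 : ∀ a, ∃ y ∈ wordsEq k θ d, v a - y ∈ wordsLT k θ d := by
    intro a
    obtain ⟨y, hy, z, hz, h⟩ := Submodule.mem_sup.mp (wordsLT_succ d (hv a))
    exact ⟨y, hy, by rw [← h]; simpa using hz⟩
  choose y hy hyv using h1
  have hyn : ∀ a, y a ∈ nicholsIdeal (braidingMatrix X) := by
    intro a
    rw [mem_nicholsIdeal]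
    intro w
    by_cases hwd : w.length = d
    · have h2 := prod_skewDer_mem_wordsLT (braidingMatrix X) w (hyv a)
      rw [hwd, Nat.sub_self, wordsLT_zero, Submodule.mem_bot, map_sub, sub_eq_zero] at h2
      rw [← h2]
      refine algebraMapInv_eq_zero_of_expansion X b v w ?_ a
      rw [hw w hwd, map_zero]
    · exact algebraMapInv_prod_skewDer _ w (hy a) hwd
  have hinj : Function.Injective b := b.injective
  refine ⟨v.support.image b, Function.extend b y 0, ?_, ?_⟩
  · intro h hh
    obtain ⟨a, _, rfl⟩ := Finset.mem_image.mp hh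
    rw [hinj.extend_apply]
    exact ⟨hy _, hyn _⟩
  · rw [Finset.sum_image (fun a _ c _ h => hinj h), Finsupp.sum, ← Finset.sum_sub_distrib]
    refine Submodule.sum_mem _ fun a _ => ?_
    rw [hinj.extend_apply, ← sub_mul, ← map_sub]
    exact ofV_mul_ofH_mem_fil X (hyv a) _

end Bos

end Filtration

/-! ### Leading symbols of the ideals and the Nichols ideal -/

section Graded

variable {k : Type*} [Field k] {H : Type*} [Ring H] [HopfAlgebra k H] {θ : ℕ}

/-- The homomorphism that records degrees. -/
def degHom (k : Type*) [Field k] (θ : ℕ) : FreeAlgebra k (Fin θ) →ₐ[k] (FreeAlgebra k (Fin θ))[X] :=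
  FreeAlgebra.lift k fun i => Polynomial.C (FreeAlgebra.ι k i) * Polynomial.X

/-- The component of degree `d`. -/
def degPart (d : ℕ) : FreeAlgebra k (Fin θ) →ₗ[k] FreeAlgebra k (Fin θ) where
  toFun v := (degHom k θ v).coeff d
  map_add' a b := by simp
  map_smul' c a := by simp

lemma degPart_apply (d : ℕ) (v : FreeAlgebra k (Fin θ)) : degPart d v = (degHom k θ v).coeff d :=
  rfl

lemma degPart_ι_mul_succ (d : ℕ) (i : Fin θ) (v : FreeAlgebra k (Fin θ)) :
    degPart (d + 1) (FreeAlgebra.ι k i * v) = FreeAlgebra.ι k i * degPart d v := by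
  simp [degPart_apply, degHom, mul_assoc]

lemma degPart_ι_mul_zero (i : Fin θ) (v : FreeAlgebra k (Fin θ)) :
    degPart 0 (FreeAlgebra.ι k i * v) = 0 := by
  simp [degPart_apply, degHom, mul_assoc]

lemma degPart_mul_ι_succ (d : ℕ) (i : Fin θ) (v : FreeAlgebra k (Fin θ)) :
    degPart (d + 1) (v * FreeAlgebra.ι k i) = degPart d v * FreeAlgebra.ι k i := by
  simp [degPart_apply, degHom, ← mul_assoc]

lemma degPart_mul_ι_zero (i : Fin θ) (v : FreeAlgebra k (Fin θ)) :
    degPart 0 (v * FreeAlgebra.ι k i) = 0 := by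
  simp [degPart_apply, degHom, ← mul_assoc]

lemma degHom_word (w : List (Fin θ)) : degHom k θ (w.map (FreeAlgebra.ι k)).prod =
    Polynomial.C (w.map (FreeAlgebra.ι k)).prod * Polynomial.X ^ w.length := by
  induction w with
  | nil => simp
  | cons i w ih =>
    rw [List.map_cons, List.prod_cons, map_mul, ih, List.length_cons, pow_succ']
    simp only [degHom, FreeAlgebra.lift_ι_apply, map_mul, mul_assoc]
    rw [← mul_assoc Polynomial.X, Polynomial.X_mul_C, mul_assoc]

lemma degPart_of_mem {n : ℕ} {v : FreeAlgebra k (Fin θ)} (hv : v ∈ wordsEq k θ n) (d : ℕ) :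
    degPart d v = if n = d then v else 0 := by
  induction hv using Submodule.span_induction with
  | mem v hv =>
    obtain ⟨w, rfl, rfl⟩ := hv
    rw [degPart_apply, degHom_word, Polynomial.coeff_C_mul, Polynomial.coeff_X_pow]
    split_ifs <;> simp_all
  | zero => simp
  | add a b _ _ ha hb => rw [map_add, ha, hb]; split_ifs <;> simp
  | smul c a _ ha => rw [map_smul, ha]; split_ifs <;> simp

lemma eq_zero_of_mem_nicholsIdeal_of_zero (q : Fin θ → Fin θ → k) {v : FreeAlgebra k (Fin θ)}
    (hv : v ∈ wordsEq k θ 0) (hn : v ∈ nicholsIdeal q) : v = 0 := by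
  obtain ⟨c, rfl⟩ := mem_wordsEq_zero hv
  have := (mem_nicholsIdeal _).mp hn []
  simp at this
  simp [this]

lemma mem_wordsEq_one {v : FreeAlgebra k (Fin θ)} (hv : v ∈ wordsEq k θ 1) :
    ∃ c : Fin θ → k, v = ∑ i, c i • FreeAlgebra.ι k i := by
  induction hv using Submodule.span_induction with
  | mem v hv =>
    obtain ⟨w, hw, rfl⟩ := hv
    obtain ⟨i, rfl⟩ := List.length_eq_one_iff.mp hw
    exact ⟨Pi.single i 1, by simp [Pi.single_apply]⟩
  | zero => exact ⟨0, by simp⟩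
  | add a b _ _ ha hb =>
    obtain ⟨c, rfl⟩ := ha
    obtain ⟨d, rfl⟩ := hb
    exact ⟨c + d, by simp [add_smul, Finset.sum_add_distrib]⟩
  | smul e a _ ha =>
    obtain ⟨c, rfl⟩ := ha
    exact ⟨e • c, by simp [Finset.smul_sum, smul_smul]⟩

/-- The skew derivations are dual to the letters, so they detect every nonzero element of degree
one. This is what will make V embed in the liftings. -/
lemma eq_zero_of_mem_nicholsIdeal_of_one (q : Fin θ → Fin θ → k) {v : FreeAlgebra k (Fin θ)}
    (hv : v ∈ wordsEq k θ 1) (hn : v ∈ nicholsIdeal q) : v = 0 := by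
  obtain ⟨c, rfl⟩ := mem_wordsEq_one hv
  refine Finset.sum_eq_zero fun i _ => ?_
  have := (mem_nicholsIdeal _).mp hn [i]
  simp only [List.map_cons, List.map_nil, List.prod_cons, List.prod_nil, mul_one, map_sum, map_smul,
    skewDer_ι] at this
  simp [apply_ite] at this
  simp [this]

namespace Relations

variable {X : Fin θ → YDPair k H} {ι : Type*} (𝒢 : Relations X ι)

/-- The ideal of `T(V) # H` generated by the relations of level less than `n`. -/
abbrev ideal (n : ℕ) : TwoSidedIdeal (Bos X) := preNicholsIdeal X 𝒢.rel 𝒢.level n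

lemma ideal_mono {m n : ℕ} (h : m ≤ n) : 𝒢.ideal m ≤ 𝒢.ideal n :=
  TwoSidedIdeal.span_mono fun _ ⟨r, hr, hz⟩ => ⟨r, by omega, hz⟩

lemma ideal_le_len (n : ℕ) : 𝒢.ideal n ≤ 𝒢.ideal 𝒢.len :=
  TwoSidedIdeal.span_mono fun _ ⟨r, _, hz⟩ => ⟨r, 𝒢.level_lt r, hz⟩

lemma ofV_mem_ideal {v : FreeAlgebra k (Fin θ)} (hv : v ∈ nicholsIdeal (braidingMatrix X)) :
    Bos.ofV X v ∈ 𝒢.ideal 𝒢.len := by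
  rw [← quot_eq_zero]
  have h1 : TwoSidedIdeal.span (Set.range 𝒢.rel) ≤
      TwoSidedIdeal.ker ((quot (𝒢.ideal 𝒢.len)).comp (Bos.ofV X)) := by
    refine TwoSidedIdeal.span_le.mpr ?_
    rintro _ ⟨r, rfl⟩
    refine (TwoSidedIdeal.mem_ker _).mpr (quot_eq_zero.mpr ?_)
    exact TwoSidedIdeal.subset_span ⟨r, 𝒢.level_lt r, rfl⟩
  exact (TwoSidedIdeal.mem_ker ((quot (𝒢.ideal 𝒢.len)).comp (Bos.ofV X))).mp (h1 ((𝒢.generate v).mpr hv))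

/-- The ideal of `T(V) # H` defining `𝔅(V) # H`, in terms of skew derivations. -/
lemma mem_ideal_len_iff {t : Bos X} : t ∈ 𝒢.ideal 𝒢.len ↔
    ∀ w : List (Fin θ), Bos.toH X ((w.map (Bos.der X)).prod t) = 0 := by
  let b := Module.Basis.ofVectorSpace k H
  constructor
  · intro ht
    let U : AddSubgroup (Bos X) :=
      { carrier := {t | ∀ w : List (Fin θ), Bos.toH X ((w.map (Bos.der X)).prod t) = 0}
        zero_mem' := fun w => by simp
        add_mem' := fun ha hb w => by rw [map_add, map_add, ha w, hb w, add_zero]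
        neg_mem' := fun ha w => by rw [map_neg, map_neg, ha w, neg_zero] }
    refine span_le_addSubgroup (U := U) ?_ ht
    rintro a c _ ⟨r, -, rfl⟩ w
    -- Right multiples: after expanding `c` over a basis of H, the claim becomes that r times an
    -- element of T(V) lies in 𝒥(V), which is the ideal generated by the relations.
    have h1 : ∀ w : List (Fin θ),
        Bos.toH X ((w.map (Bos.der X)).prod (Bos.ofV X (𝒢.rel r) * c)) = 0 := by
      intro w
      obtain ⟨n, hn⟩ := Bos.exists_mem_fil X c
      obtain ⟨v, -, rfl⟩ := Bos.exists_expansion X b hn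
      rw [Finsupp.sum, Finset.mul_sum, map_sum, map_sum]
      refine Finset.sum_eq_zero fun e _ => ?_
      rw [← mul_assoc, ← map_mul, Bos.prod_der_mul_ofH, Bos.prod_der_ofV, map_mul, map_mul,
        Bos.toH_ofV]
      have h2 : 𝒢.rel r * v e ∈ nicholsIdeal (braidingMatrix X) :=
        (𝒢.generate _).mp (TwoSidedIdeal.mul_mem_right _ _ _
          (TwoSidedIdeal.subset_span ⟨r, rfl⟩))
      rw [(mem_nicholsIdeal _).mp h2 w, map_zero, zero_mul, zero_mul]
    rw [mul_assoc]
    revert h1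
    generalize Bos.ofV X (𝒢.rel r) * c = t
    intro h1
    -- Left multiples: by the Leibniz rule a derivation hits `a` or `t`, and both outcomes are left
    -- multiples of an element satisfying the same hypothesis. The last letter of `w` is the
    -- derivation applied first, hence the reverse induction.
    induction w using List.reverseRecOn generalizing a t with
    | nil =>
      have := h1 []
      simp only [List.map_nil, List.prod_nil, Module.End.one_apply] at this ⊢
      rw [map_mul, this, mul_zero]
    | append_singleton w i ih =>
      rw [List.map_append, List.prod_append, Module.End.mul_apply, List.map_singleton,
        List.prod_singleton, Bos.der_mul, map_add, map_add, ih _ _ h1, add_zero]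
      refine ih _ _ fun w' => ?_
      have := h1 (w' ++ [i])
      simpa using this
  · intro ht
    obtain ⟨n, hn⟩ := Bos.exists_mem_fil X t
    obtain ⟨v, -, rfl⟩ := Bos.exists_expansion X b hn
    refine TwoSidedIdeal.finsetSum_mem _ _ _ fun a _ => TwoSidedIdeal.mul_mem_right _ _ _ ?_
    refine 𝒢.ofV_mem_ideal ((mem_nicholsIdeal _).mpr fun w => ?_)
    exact Bos.algebraMapInv_eq_zero_of_expansion X b v w (ht w) a

section Coaction

variable {𝒢} {I : TwoSidedIdeal (Bos X)}

/-- The iterated derivation is contraction with a functional that vanishes on the ideal of 𝔅(V) # H.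
Such a contraction factors through the right coaction, so it descends to 𝒯/I. -/
lemma prod_der_mem (hrho : ∀ t ∈ I, quotComul I (𝒢.ideal 𝒢.len) t = 0) (w : List (Fin θ)) {t : Bos X} (ht : t ∈ I) :
    (w.map (Bos.der X)).prod t ∈ I := by
  rw [Bos.prod_der_eq, ← quot_eq_zero]
  refine rcontr_mem (quot_surjective (𝒢.ideal 𝒢.len)) (hrho t ht) fun s hs => ?_
  rw [quot_eq_zero, mem_ideal_len_iff] at hs
  rw [LinearMap.comp_apply, ← Bos.counit_toH, hs w, map_zero]

/-- Following the coaction of h by the projection 𝔅(V) # H → H gives h₁ ⊗ h₂ = 0 in 𝒯/I ⊗ H. Then h₁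
S(h₂) ⊗ h₃ = 1 ⊗ h vanishes as well. -/
lemma eq_zero_of_ofH_mem (hrho : ∀ t ∈ I, quotComul I (𝒢.ideal 𝒢.len) t = 0) (hI : I ≠ ⊤) {h : H}
    (hh : Bos.ofH X h ∈ I) : h = 0 := by
  have hI' := nontrivial_quot hI
  obtain ⟨e, he⟩ := exists_factor (p := (quot (𝒢.ideal 𝒢.len)).toLinearMap) (quot_surjective _)
    (Bos.toH X).toLinearMap fun t ht => 𝒢.mem_ideal_len_iff.mp (quot_eq_zero.mp ht) []
  let p : H →ₐ[k] (Bos X ⧸ I.asIdeal) := (quot I).comp (Bos.ofH X)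
  obtain ⟨f, hf⟩ := exists_functional_one (k := k) (Bos X ⧸ I.asIdeal)
  have h1 : coact p (AlgHom.id k H) h = 0 := by
    have h2 : ∀ z : H ⊗[k] H, TensorProduct.map LinearMap.id e (TensorProduct.map
        (quot I).toLinearMap (quot (𝒢.ideal 𝒢.len)).toLinearMap (Bos.ofHH X z)) =
        TensorProduct.map p.toLinearMap (AlgHom.id k H).toLinearMap z := by
      intro z
      induction z with
      | zero => simp
      | add a b ha hb => simp only [map_add, ha, hb]
      | tmul a b =>
        have he' : ∀ t, e (quot (𝒢.ideal 𝒢.len) t) = Bos.toH X t := he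
        simp [Bos.ofHH, p, he']
    have h3 := hrho _ hh
    rw [quotComul_eq, coact_eq, Bos.comul_ofH] at h3
    rw [coact_eq, ← h2, h3, map_zero]
  have h2 := insertLeft_transl p (AlgHom.id k H) h
  rw [← map_factor (p := p.toLinearMap) (q := (AlgHom.id k H).toLinearMap) (f' := LinearMap.id)
    (h' := (transl p (AlgHom.id k H)).toLinearMap) (fun t => rfl) (fun t => rfl),
    ← coact_eq, h1, map_zero, map_zero] at h2
  have h3 := congrArg (fun z => TensorProduct.lid k H (LinearMap.rTensor H f z)) h2
  simpa [hf] using h3.symm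

end Coaction

section Symbols

variable {𝒢} {I K J : TwoSidedIdeal (Bos X)}

/-- Elements of `J` have no top symbol. -/
lemma prod_der_eq_zero_of_mem (hb : IsBigalois I K J) (hI : I ≠ ⊤) (hK : K ≤ 𝒢.ideal 𝒢.len)
    {d : ℕ} {t : Bos X} (ht : t ∈ J) (htd : t ∈ Bos.fil X (d + 1)) {w : List (Fin θ)}
    (hw : w.length = d) : (w.map (Bos.der X)).prod t = 0 := by
  have hrho : ∀ t ∈ I, quotComul I (𝒢.ideal 𝒢.len) t = 0 := fun t ht =>
    quotComul_eq_zero_of_le le_rfl hK (hb.rho t ht)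
  set D := (w.map (Bos.der X)).prod with hD
  obtain ⟨D', hD'⟩ := exists_factor (p := (quot I).toLinearMap) (quot_surjective I)
    ((quot I).toLinearMap ∘ₗ D) fun t ht =>
      quot_eq_zero.mpr (prod_der_mem hrho w (quot_eq_zero.mp ht))
  obtain ⟨p, hp⟩ := LinearMap.exists_leftInverse_of_injective
    ((quot I).toLinearMap ∘ₗ (Bos.ofH X).toLinearMap) (LinearMap.ker_eq_bot'.mpr fun h hh =>
      eq_zero_of_ofH_mem hrho hI (quot_eq_zero.mp hh))
  have hp' : ∀ h, p (quot I (Bos.ofH X h)) = h := LinearMap.congr_fun hp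
  -- `D` has order `d` and `t` has degree at most `d`. In (D ⊗ id)Δ(t) only the terms of bidegree
  -- (d, 0) survive, and they land in H ⊗ H.
  obtain ⟨z, hz⟩ : ∃ z : H ⊗[k] H, Bos.ofHH X z =
      LinearMap.rTensor (Bos X) D (Coalgebra.comul (R := k) t) := by
    have : LinearMap.rTensor (Bos X) D (Coalgebra.comul (R := k) t) ∈
        LinearMap.range (Bos.ofHH X).toLinearMap := by
      refine Bos.map_mem_of_mem_fil₂ X (fun i j hij a ha b hb => ?_) (Bos.comul_mem_fil₂ X htd)
      rw [LinearMap.rTensor_tmul]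
      by_cases hid : i = d
      · obtain rfl : j = 0 := by omega
        have h1 := Bos.prod_der_mem_fil X w ha
        rw [show i + 1 - w.length = 1 by omega] at h1
        obtain ⟨h, hh⟩ := Bos.mem_fil_one X h1
        obtain ⟨h', rfl⟩ := Bos.mem_fil_one X hb
        refine ⟨h ⊗ₜ h', ?_⟩
        rw [hD, hh]
        rfl
      · rw [hD, Bos.prod_der_eq_zero X w (by omega) ha, TensorProduct.zero_tmul]
        exact zero_mem _
    exact this
  -- `D` descends to 𝒯/I and H embeds there, so applying `D` to the first factor of t₁ ⊗ S(t₂) = 0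
  -- gives (id ⊗ S)(z) = 0. As ε ∘ S = ε, the counit then yields D(t) = 0.
  have h1 : (LinearMap.lTensor H (HopfAlgebra.antipode k)) z = 0 := by
    have h2 := hb.cot t ht
    rw [cotransl_eq] at h2
    have h3 := congrArg (TensorProduct.map D' LinearMap.id) h2
    rw [map_zero, map_factor (p := (quot I).toLinearMap) (q := (MulOpposite.opLinearEquiv
      k).toLinearMap ∘ₗ (quot I).toLinearMap ∘ₗ HopfAlgebra.antipode k)
      (f := (quot I).toLinearMap ∘ₗ D) (h := (MulOpposite.opLinearEquiv
      k).toLinearMap ∘ₗ (quot I).toLinearMap ∘ₗ HopfAlgebra.antipode k) hD' (fun t => rfl)] at h3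
    have h4 : TensorProduct.map ((quot I).toLinearMap ∘ₗ D) ((MulOpposite.opLinearEquiv
        k).toLinearMap ∘ₗ (quot I).toLinearMap ∘ₗ HopfAlgebra.antipode k)
          (Coalgebra.comul (R := k) t) = TensorProduct.map (quot I).toLinearMap
        ((MulOpposite.opLinearEquiv k).toLinearMap ∘ₗ (quot I).toLinearMap ∘ₗ
          HopfAlgebra.antipode k) (LinearMap.rTensor (Bos X) D (Coalgebra.comul (R := k) t)) := by
      exact (map_factor (fun t => rfl) (fun t => rfl) _).symm
    rw [h4, ← hz] at h3
    have h5 : ∀ z : H ⊗[k] H, TensorProduct.map p (p ∘ₗ (MulOpposite.opLinearEquiv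
        k).symm.toLinearMap) (TensorProduct.map (quot I).toLinearMap
        ((MulOpposite.opLinearEquiv k).toLinearMap ∘ₗ (quot I).toLinearMap ∘ₗ
          HopfAlgebra.antipode k) (Bos.ofHH X z)) =
        LinearMap.lTensor H (HopfAlgebra.antipode k) z := by
      intro z
      induction z with
      | zero => simp
      | add a b ha hb => simp only [map_add, ha, hb]
      | tmul a b =>
        have : HopfAlgebra.antipode k (Bos.ofH X b) = Bos.ofH X (HopfAlgebra.antipode k b) :=
          Bos.antipodeMap_ofH X b
        simp [Bos.ofHH, hp', this]
    rw [← h5, h3, map_zero]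
  have h2 : (LinearMap.lTensor H (Coalgebra.counit (R := k))) z = 0 := by
    have h3 := congrArg (LinearMap.lTensor H (Coalgebra.counit (R := k))) h1
    rw [← LinearMap.comp_apply (LinearMap.lTensor _ _), ← LinearMap.lTensor_comp, map_zero] at h3
    have h4 : Coalgebra.counit ∘ₗ HopfAlgebra.antipode k = (Coalgebra.counit (R := k) (A := H)) :=
      HopfAlgebra.counit_comp_antipode
    rwa [h4] at h3
  have h3 : LinearMap.rTensor k D (LinearMap.lTensor (Bos X) Coalgebra.counit
      (Coalgebra.comul (R := k) t)) = 0 := by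
    have h4 : ∀ y : Bos X ⊗[k] Bos X, LinearMap.rTensor k D (LinearMap.lTensor (Bos X)
        Coalgebra.counit y) = LinearMap.lTensor (Bos X) Coalgebra.counit
        (LinearMap.rTensor (Bos X) D y) := by
      intro y
      rw [← LinearMap.comp_apply, ← LinearMap.comp_apply, LinearMap.rTensor_comp_lTensor,
        LinearMap.lTensor_comp_rTensor]
    have h5 : ∀ z : H ⊗[k] H, LinearMap.lTensor (Bos X) Coalgebra.counit (Bos.ofHH X z) =
        LinearMap.rTensor k (Bos.ofH X).toLinearMap (LinearMap.lTensor H Coalgebra.counit z) := by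
      intro z
      induction z with
      | zero => simp
      | add a b ha hb => simp only [map_add, ha, hb]
      | tmul a b => simp [Bos.ofHH, Bos.counit_ofH]
    rw [h4, ← hz, h5, h2, map_zero]
  rw [Coalgebra.lTensor_counit_comul] at h3
  simpa using congrArg (TensorProduct.rid k _) h3

/-- The ideal `J` does not meet the component of degree at most one. -/
lemma eq_zero_of_mem_fil_two (hb : IsBigalois I K J) (hI : I ≠ ⊤) (hK : K ≤ 𝒢.ideal 𝒢.len)
    {t : Bos X} (ht : t ∈ J) (htd : t ∈ Bos.fil X 2) : t = 0 := by
  obtain ⟨s, v, hv, hs⟩ := Bos.exists_symbol_of_prod_der_eq_zero X htd fun w hw =>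
    prod_der_eq_zero_of_mem hb hI hK ht htd hw
  rw [Finset.sum_eq_zero, sub_zero] at hs
  -- Now `t` has degree zero, and the empty word, the case of no derivations, says that it vanishes.
  · exact prod_der_eq_zero_of_mem hb hI hK ht hs (w := []) rfl
  · intro a ha
    rw [eq_zero_of_mem_nicholsIdeal_of_one _ (hv a ha).1 (hv a ha).2, map_zero, zero_mul]

/-- Elements without top symbol have smaller degree modulo `J`. -/
lemma exists_sub_mem_fil (hrel : ∀ r, ∃ u ∈ J, Bos.ofV X (𝒢.rel r) - u ∈
      Bos.fil X (∑ i, 𝒢.deg r i)) {d : ℕ} {t : Bos X} (htd : t ∈ Bos.fil X (d + 1))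
    (hw : ∀ w : List (Fin θ), w.length = d → (w.map (Bos.der X)).prod t = 0) :
    ∃ u ∈ J, t - u ∈ Bos.fil X d := by
  -- The elements of T(V) that agree with an element of `J` up to terms of degree less than `d`.
  let good : ℕ → Submodule k (FreeAlgebra k (Fin θ)) := fun d =>
    { carrier := {v | ∃ u ∈ J, Bos.ofV X v - u ∈ Bos.fil X d}
      zero_mem' := ⟨0, TwoSidedIdeal.zero_mem _, by simp⟩
      add_mem' := by
        rintro a b ⟨u, hu, hau⟩ ⟨v, hv, hbv⟩
        refine ⟨u + v, TwoSidedIdeal.add_mem _ hu hv, ?_⟩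
        rw [map_add, add_sub_add_comm]
        exact add_mem hau hbv
      smul_mem' := by
        rintro c a ⟨u, hu, hau⟩
        refine ⟨c • u, TwoSidedIdeal.smul_mem' c hu, ?_⟩
        rw [map_smul, ← smul_sub]
        exact Submodule.smul_mem _ _ hau }
  have gl : ∀ d i v, v ∈ good d → FreeAlgebra.ι k i * v ∈ good (d + 1) := by
    rintro d i v ⟨u, hu, hv⟩
    refine ⟨Bos.x X i * u, TwoSidedIdeal.mul_mem_left _ _ _ hu, ?_⟩
    rw [map_mul, Bos.ofV_ι, ← mul_sub]
    exact Bos.x_mul_mem_fil X i hv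
  have gr : ∀ d i v, v ∈ good d → v * FreeAlgebra.ι k i ∈ good (d + 1) := by
    rintro d i v ⟨u, hu, hv⟩
    refine ⟨u * Bos.x X i, TwoSidedIdeal.mul_mem_right _ _ _ hu, ?_⟩
    rw [map_mul, Bos.ofV_ι, ← sub_mul]
    exact Bos.mul_x_mem_fil X i hv
  -- The elements all of whose homogeneous components are good form an ideal. It contains the
  -- relations by `hrel`, hence all of 𝒥(V).
  let U : Submodule k (FreeAlgebra k (Fin θ)) := ⨅ d, (good d).comap (degPart d)
  have mU : ∀ v, v ∈ U ↔ ∀ d, degPart d v ∈ good d := fun v => by simp [U]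
  have ul : ∀ a v, v ∈ U → a * v ∈ U := by
    intro a
    induction a using FreeAlgebra.induction with
    | grade0 c =>
      intro v hv
      rw [← Algebra.smul_def]
      exact Submodule.smul_mem _ _ hv
    | grade1 i =>
      intro v hv
      rw [mU] at hv ⊢
      rintro (_ | d)
      · rw [degPart_ι_mul_zero]; exact zero_mem _
      · rw [degPart_ι_mul_succ]; exact gl _ _ _ (hv d)
    | mul a b ha hb => intro v hv; rw [mul_assoc]; exact ha _ (hb _ hv)
    | add a b ha hb => intro v hv; rw [add_mul]; exact add_mem (ha _ hv) (hb _ hv)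
  have ur : ∀ a v, v ∈ U → v * a ∈ U := by
    intro a
    induction a using FreeAlgebra.induction with
    | grade0 c =>
      intro v hv
      rw [← Algebra.commutes, ← Algebra.smul_def]
      exact Submodule.smul_mem _ _ hv
    | grade1 i =>
      intro v hv
      rw [mU] at hv ⊢
      rintro (_ | d)
      · rw [degPart_mul_ι_zero]; exact zero_mem _
      · rw [degPart_mul_ι_succ]; exact gr _ _ _ (hv d)
    | mul a b ha hb => intro v hv; rw [← mul_assoc]; exact hb _ (ha _ hv)
    | add a b ha hb => intro v hv; rw [mul_add]; exact add_mem (ha _ hv) (hb _ hv)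
  have hU : ∀ v ∈ nicholsIdeal (braidingMatrix X), v ∈ U := by
    intro v hv
    refine span_le_addSubgroup (U := U.toAddSubgroup) ?_ ((𝒢.generate v).mpr hv)
    rintro a b _ ⟨r, rfl⟩
    refine ur _ _ (ul _ _ ((mU _).mpr fun d => ?_))
    rw [degPart_of_mem (homogeneousPart_le _ (𝒢.rel_mem r))]
    split_ifs with h
    · subst h
      exact hrel r
    · exact zero_mem _
  obtain ⟨s, v, hv, hs⟩ := Bos.exists_symbol_of_prod_der_eq_zero X htd hw
  have h1 : ∀ a ∈ s, ∃ u ∈ J, Bos.ofV X (v a) - u ∈ Bos.fil X d := by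
    intro a ha
    have := (mU _).mp (hU _ (hv a ha).2) d
    rwa [degPart_of_mem (hv a ha).1, if_pos rfl] at this
  choose! u hu hvu using h1
  refine ⟨∑ a ∈ s, u a * Bos.ofH X a, TwoSidedIdeal.finsetSum_mem _ _ _ fun a ha =>
    TwoSidedIdeal.mul_mem_right _ _ _ (hu a ha), ?_⟩
  have h2 : t - ∑ a ∈ s, u a * Bos.ofH X a = (t - ∑ a ∈ s, Bos.ofV X (v a) * Bos.ofH X a) +
      ∑ a ∈ s, (Bos.ofV X (v a) - u a) * Bos.ofH X a := by
    simp only [sub_mul, Finset.sum_sub_distrib]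
    abel
  rw [h2]
  exact add_mem hs (Submodule.sum_mem _ fun a ha => Bos.mul_ofH_mem_fil X (hvu a ha) a)

end Symbols

end Relations

end Graded

/-! ### Products of YD-pairs and weights of words -/

section Weights

variable {k : Type*} [Field k] {H : Type*} [Ring H] [HopfAlgebra k H] {θ : ℕ}

/-- The algebra endomorphism `h ↦ χ(h₁) h₂`. -/
def leftTwistHom (χ : H →ₐ[k] k) : H →ₐ[k] H :=
  (Algebra.TensorProduct.lid k H).toAlgHom.comp
    ((Algebra.TensorProduct.map χ (.id k H)).comp (Bialgebra.comulAlgHom k H))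

/-- By coassociativity twists compose by convolution: the character on the right is h ↦ ψ(h₁) χ(h₂).
-/
lemma leftTwist_leftTwist (χ ψ : H →ₐ[k] k) (h : H) :
    leftTwist χ (leftTwist ψ h) = leftTwist (χ.comp (leftTwistHom ψ)) h := by
  refine Eq.trans (b := TensorProduct.lid k H (TensorProduct.map χ.toLinearMap LinearMap.id
    (TensorProduct.map (leftTwist ψ) LinearMap.id (Coalgebra.comul (R := k) h)))) ?_ ?_
  · rw [leftTwist_comul]
    rfl
  · rw [map_factor (f := (χ.comp (leftTwistHom ψ)).toLinearMap) (h := LinearMap.id)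
      (fun t => rfl) (fun t => rfl)]
    rfl

lemma rightTwist_rightTwist (χ ψ : H →ₐ[k] k) (h : H) :
    rightTwist ψ (rightTwist χ h) = rightTwist (χ.comp (leftTwistHom ψ)) h := by
  have h1 : ∀ z : H ⊗[k] H, TensorProduct.rid k H (TensorProduct.map LinearMap.id χ.toLinearMap
      (TensorProduct.map (rightTwist ψ) LinearMap.id z)) =
      rightTwist ψ (TensorProduct.rid k H (TensorProduct.map LinearMap.id χ.toLinearMap z)) := by
    intro z
    induction z with
    | zero => simp
    | add a b ha hb => simp only [map_add, ha, hb]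
    | tmul a b => simp
  have h2 : rightTwist (χ.comp (leftTwistHom ψ)) h = TensorProduct.rid k H (TensorProduct.map
      LinearMap.id χ.toLinearMap (TensorProduct.map LinearMap.id (leftTwist ψ)
        (Coalgebra.comul (R := k) h))) := by
    rw [map_factor (f := LinearMap.id) (h := (χ.comp (leftTwistHom ψ)).toLinearMap)
      (fun t => rfl) (fun t => rfl)]
    rfl
  rw [h2, rightTwist_comul, h1]
  rfl

lemma leftTwist_rightTwist (χ ψ : H →ₐ[k] k) (h : H) :
    leftTwist ψ (rightTwist χ h) = rightTwist χ (leftTwist ψ h) := by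
  have h1 : ∀ z : H ⊗[k] H, TensorProduct.rid k H (TensorProduct.map LinearMap.id χ.toLinearMap
      (TensorProduct.map (leftTwist ψ) LinearMap.id z)) =
      leftTwist ψ (TensorProduct.rid k H (TensorProduct.map LinearMap.id χ.toLinearMap z)) := by
    intro z
    induction z with
    | zero => simp
    | add a b ha hb => simp only [map_add, ha, hb]
    | tmul a b => simp
  conv_rhs => rw [rightTwist, LinearMap.comp_apply, LinearMap.comp_apply, ← leftTwist_comul]
  exact (h1 _).symm

lemma apply_rightTwist (χ ψ : H →ₐ[k] k) (h : H) : χ (rightTwist ψ h) = ψ (leftTwist χ h) := by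
  simp only [rightTwist, leftTwist, LinearMap.comp_apply]
  generalize Coalgebra.comul (R := k) h = z
  induction z with
  | zero => simp
  | add a b ha hb => simp only [map_add, ha, hb]
  | tmul a b => simp [mul_comm]

lemma leftTwist_counit (h : H) : leftTwist (Bialgebra.counitAlgHom k H) h = h := by
  have := Coalgebra.rTensor_counit_comul (R := k) h
  rw [leftTwist, LinearMap.comp_apply, LinearMap.comp_apply]
  exact (congrArg (TensorProduct.lid k H) this).trans (by simp)

lemma rightTwist_counit (h : H) : rightTwist (Bialgebra.counitAlgHom k H) h = h := by
  have := Coalgebra.lTensor_counit_comul (R := k) h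
  rw [rightTwist, LinearMap.comp_apply, LinearMap.comp_apply]
  exact (congrArg (TensorProduct.rid k H) this).trans (by simp)

/-- Recovers a functional from the contraction it defines. `exists_isLift` uses this to turn an
identity between contractions into one between functionals. -/
lemma lcontr_mul_antipode (ξ : H →ₗ[k] k) (h : H) :
    LinearMap.mul' k H (TensorProduct.map (lcontr ξ) (HopfAlgebra.antipode k)
      (Coalgebra.comul (R := k) h)) = ξ h • 1 := by
  have h1 : ∀ z : H ⊗[k] H, LinearMap.mul' k H (TensorProduct.map (lcontr ξ)
      (HopfAlgebra.antipode k) z) = TensorProduct.lid k H (TensorProduct.map ξ (LinearMap.mul' k H ∘ₗ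
        LinearMap.lTensor H (HopfAlgebra.antipode k)) (TensorProduct.assoc k H H H
          (LinearMap.rTensor H Coalgebra.comul z))) := by
    intro z
    induction z with
    | zero => simp
    | add a b ha hb => simp only [map_add, ha, hb]
    | tmul a b =>
      simp only [TensorProduct.map_tmul, LinearMap.rTensor_tmul, lcontr, LinearMap.comp_apply]
      generalize Coalgebra.comul (R := k) a = w
      induction w with
      | zero => simp
      | add a b ha hb => simp only [map_add, TensorProduct.add_tmul, ha, hb]
      | tmul c d => simp
  have h2 : ∀ z : H ⊗[k] H, TensorProduct.lid k H (TensorProduct.map ξ (LinearMap.mul' k H ∘ₗ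
        LinearMap.lTensor H (HopfAlgebra.antipode k)) (LinearMap.lTensor H Coalgebra.comul z)) =
      TensorProduct.lid k H (TensorProduct.map ξ (Algebra.linearMap k H)
        (LinearMap.lTensor H Coalgebra.counit z)) := by
    intro z
    induction z with
    | zero => simp
    | add a b ha hb => simp only [map_add, ha, hb]
    | tmul a b => simp [HopfAlgebra.mul_antipode_lTensor_comul_apply]
  rw [h1, Coalgebra.coassoc_apply, h2, Coalgebra.lTensor_counit_comul]
  simp

variable (k H) in
/-- The trivial pair. -/
def YDPair.one : YDPair k H where
  g := 1
  χ := Bialgebra.counitAlgHom k H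
  isGroupLike := .one
  compat h := by rw [rightTwist_counit, leftTwist_counit, one_mul, mul_one]

/-- The product of pairs. -/
def YDPair.mul (x y : YDPair k H) : YDPair k H where
  g := x.g * y.g
  χ := x.χ.comp (leftTwistHom y.χ)
  isGroupLike := x.isGroupLike.mul y.isGroupLike
  compat h := by
    rw [← rightTwist_rightTwist, ← leftTwist_leftTwist, (x.g_commute y).eq, ← mul_assoc, y.compat,
      mul_assoc, leftTwist_rightTwist, x.compat, mul_assoc]

/-- Applying χ_x to the compatibility condition of y and cancelling the unit χ_x(g_y) shows that the
two characters commute under convolution. -/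
lemma YDPair.leftTwist_commute (x y : YDPair k H) :
    Commute (leftTwist x.χ : Module.End k H) (leftTwist y.χ) := by
  have h1 : x.χ.comp (leftTwistHom y.χ) = y.χ.comp (leftTwistHom x.χ) := by
    ext h
    have h2 := congrArg x.χ (y.compat h)
    have h3 : IsUnit (x.χ y.g) := y.isGroupLike.isUnit.map x.χ
    rw [map_mul, map_mul, mul_comm (x.χ y.g), h3.mul_left_inj, apply_rightTwist] at h2
    exact h2.symm
  ext h
  rw [Module.End.mul_apply, Module.End.mul_apply, leftTwist_leftTwist, h1, leftTwist_leftTwist]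

variable (X : Fin θ → YDPair k H)

/-- The product of the pairs of the letters of a word. -/
def wordPair : List (Fin θ) → YDPair k H
  | [] => YDPair.one k H
  | i :: w => (X i).mul (wordPair w)

lemma wordPair_g (w : List (Fin θ)) : (wordPair X w).g = (w.map fun i => (X i).g).prod := by
  induction w with
  | nil => rfl
  | cons i w ih => rw [List.map_cons, List.prod_cons, ← ih]; rfl

lemma leftTwist_wordPair (w : List (Fin θ)) : (leftTwist (wordPair X w).χ : Module.End k H) =
    (w.map fun i => (leftTwist (X i).χ : Module.End k H)).prod := by
  induction w with
  | nil => ext h; exact leftTwist_counit h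
  | cons i w ih =>
    rw [List.map_cons, List.prod_cons, ← ih]
    ext h
    exact (leftTwist_leftTwist _ _ h).symm

lemma twist_eq {d : Fin θ → ℕ} {w : List (Fin θ)} (hw : ∀ i, w.count i = d i) :
    twist X d = leftTwist (wordPair X w).χ := by
  rw [leftTwist_wordPair, ← prod_ofFn_count _ fun i j => (X i).leftTwist_commute (X j), twist]
  simp [hw]

lemma exists_word (d : Fin θ → ℕ) : ∃ w : List (Fin θ), ∀ i, w.count i = d i := by
  classical
  refine ⟨(Finsupp.toMultiset (Finsupp.equivFunOnFinite.symm d)).toList, fun i => ?_⟩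
  rw [← Multiset.coe_count, Multiset.coe_toList, Finsupp.count_toMultiset]
  rfl

lemma exists_pair (d : Fin θ → ℕ) :
    ∃ y : YDPair k H, y.g = groupLike X d ∧ leftTwist y.χ = twist X d := by
  obtain ⟨w, hw⟩ := exists_word d
  exact ⟨wordPair X w, by rw [wordPair_g, groupLike_eq X hw], (twist_eq X hw).symm⟩

lemma Bos.ofH_mul_word (h : H) (w : List (Fin θ)) :
    ofH X h * ofV X (w.map (FreeAlgebra.ι k)).prod =
      ofV X (w.map (FreeAlgebra.ι k)).prod * ofH X (leftTwist (wordPair X w).χ h) := by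
  induction w generalizing h with
  | nil => simp [wordPair, YDPair.one, leftTwist_counit]
  | cons i w ih =>
    have h1 : leftTwist (wordPair X (i :: w)).χ h =
        leftTwist (wordPair X w).χ (leftTwist (X i).χ h) :=
      (leftTwist_leftTwist (X i).χ (wordPair X w).χ h).symm.trans
        (LinearMap.congr_fun ((X i).leftTwist_commute (wordPair X w)).eq h)
    rw [ofV_word_cons, ← mul_assoc, ofH_mul_x, mul_assoc, ih, h1, mul_assoc]

lemma Bos.ofH_mul_ofV (h : H) {d : Fin θ → ℕ} {v : FreeAlgebra k (Fin θ)}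
    (hv : v ∈ homogeneousPart k d) : ofH X h * ofV X v = ofV X v * ofH X (twist X d h) := by
  induction hv using Submodule.span_induction with
  | mem v hv =>
    obtain ⟨w, hw, rfl⟩ := hv
    rw [ofH_mul_word, twist_eq X hw]
  | zero => simp
  | add a b _ _ ha hb => rw [map_add, mul_add, ha, hb, add_mul]
  | smul c a _ ha => rw [map_smul, mul_smul_comm, ha, smul_mul_assoc]

lemma exists_sum_words (v : FreeAlgebra k (Fin θ)) : ∃ c : List (Fin θ) →₀ k,
    v = c.sum fun w a => a • (w.map (FreeAlgebra.ι k)).prod := by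
  obtain ⟨n, hn⟩ := exists_mem_wordsLT v
  have h1 : v ∈ Submodule.span k
      (Set.range fun w : List (Fin θ) => (w.map (FreeAlgebra.ι k)).prod) := by
    refine Submodule.span_mono ?_ hn
    rintro _ ⟨w, -, rfl⟩
    exact ⟨w, rfl⟩
  obtain ⟨c, hc⟩ := Finsupp.mem_span_range_iff_exists_finsupp.mp h1
  exact ⟨c, hc.symm⟩

/-- Functionals that separate characters. -/
lemma exists_functional_character (χ : H →ₐ[k] k) : ∃ Φ : (H → k) →ₗ[k] k,
    ∀ ψ : H →ₐ[k] k, Φ ψ = open Classical in if ψ = χ then 1 else 0 := by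
  classical
  -- Dedekind's independence of characters. The coordinate at `χ` is then extended to all functions
  -- on H.
  have h1 : LinearIndependent k (fun ψ : H →ₐ[k] k => (ψ : H → k)) := by
    have h2 := linearIndependent_monoidHom H k
    exact h2.comp (fun ψ : H →ₐ[k] k => (ψ : H →* k)) fun a b hab => by
      ext h
      exact DFunLike.congr_fun hab h
  obtain ⟨Φ, hΦ⟩ := LinearMap.exists_extend
    ((Finsupp.lapply χ : ((H →ₐ[k] k) →₀ k) →ₗ[k] k) ∘ₗ h1.repr)
  refine ⟨Φ, fun ψ => ?_⟩
  have h2 := LinearMap.congr_fun hΦ ⟨(ψ : H → k), Submodule.subset_span ⟨ψ, rfl⟩⟩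
  rw [LinearMap.comp_apply, Submodule.subtype_apply] at h2
  rw [h2, LinearMap.comp_apply, h1.repr_eq_single ψ _ rfl]
  simp [Finsupp.single_apply]

end Weights

/-! ### Existence of lifts of the relations with the right weight -/

section Lifts

variable {k : Type*} [Field k] {H : Type*} [Ring H] [HopfAlgebra k H] {θ : ℕ}
  {X : Fin θ → YDPair k H}

/-- The deviation of `t` from being an eigenvector for `H` with weight `χ`. -/
def deviation (χ : H →ₐ[k] k) (t : Bos X) : H →ₗ[k] Bos X :=
  LinearMap.mulRight k t ∘ₗ (Bos.ofH X).toLinearMap -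
    LinearMap.mulLeft k t ∘ₗ (Bos.ofH X).toLinearMap ∘ₗ leftTwist χ

lemma deviation_apply (χ : H →ₐ[k] k) (t : Bos X) (h : H) :
    deviation χ t h = Bos.ofH X h * t - t * Bos.ofH X (leftTwist χ h) := rfl

/-- The contributions of g ⊗ r to the two terms of the deviation cancel, by the weight of r and the
Yetter-Drinfeld condition of `y`. So the deviation is a colinear map from H. -/
lemma quotComul_deviation {I K : TwoSidedIdeal (Bos X)} {t r : Bos X} (y : YDPair k H)
    (ht : quotComul I K t = quot I t ⊗ₜ 1 + quot I (Bos.ofH X y.g) ⊗ₜ quot K r)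
    (hr : ∀ h, Bos.ofH X h * r = r * Bos.ofH X (leftTwist y.χ h)) (h : H) :
    quotComul I K (deviation y.χ t h) = TensorProduct.map ((quot I).toLinearMap ∘ₗ deviation y.χ t)
      ((quot K).toLinearMap ∘ₗ (Bos.ofH X).toLinearMap) (Coalgebra.comul (R := k) h) := by
  let P : H ⊗[k] H →ₐ[k] (Bos X ⧸ I.asIdeal) ⊗[k] (Bos X ⧸ K.asIdeal) :=
    Algebra.TensorProduct.map ((quot I).comp (Bos.ofH X)) ((quot K).comp (Bos.ofH X))
  have hP : ∀ h, quotComul I K (Bos.ofH X h) = P (Coalgebra.comul (R := k) h) := by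
    intro h
    rw [quotComul_eq, coact_eq, Bos.comul_ofH]
    generalize Coalgebra.comul (R := k) h = z
    induction z with
    | zero => simp
    | add a b ha hb => simp only [map_add, ha, hb]
    | tmul a b => simp [Bos.ofHH, P]
  have hPt : ∀ a b, P (a ⊗ₜ b) = quot I (Bos.ofH X a) ⊗ₜ quot K (Bos.ofH X b) := fun a b => by
    simp [P]
  have h2 : ∀ z : H ⊗[k] H, P z * (quot I (Bos.ofH X y.g) ⊗ₜ[k] quot K r) =
      (1 ⊗ₜ[k] quot K r) * P (TensorProduct.map (LinearMap.mulRight k y.g) LinearMap.id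
        (TensorProduct.map LinearMap.id (leftTwist y.χ) z)) := by
    intro z
    induction z with
    | zero => simp
    | add a b ha hb => simp only [map_add, add_mul, mul_add, ha, hb]
    | tmul a b => simp [hPt, ← map_mul, hr]
  have h3 : ∀ z : H ⊗[k] H, TensorProduct.map (LinearMap.mulRight k y.g) LinearMap.id
      (TensorProduct.map (rightTwist y.χ) LinearMap.id z) =
      (y.g ⊗ₜ[k] 1) * TensorProduct.map (leftTwist y.χ) LinearMap.id z := by
    intro z
    induction z with
    | zero => simp
    | add a b ha hb => simp only [map_add, mul_add, ha, hb]
    | tmul a b => simp [y.compat]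
  rw [deviation_apply, map_sub, map_mul, map_mul, hP, hP, ht, mul_add, h2, rightTwist_comul, h3,
    ← leftTwist_comul, add_mul, map_mul P, ← mul_assoc]
  have h4 : ((1 : Bos X ⧸ I.asIdeal) ⊗ₜ[k] quot K r) * P (y.g ⊗ₜ[k] 1) =
      quot I (Bos.ofH X y.g) ⊗ₜ quot K r := by
    simp [hPt]
  rw [h4, add_sub_add_right_eq_sub]
  generalize Coalgebra.comul (R := k) h = z
  induction z with
  | zero => simp
  | add a b ha hb =>
    simp only [map_add, add_mul, mul_add, ← ha, ← hb]
    abel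
  | tmul a b => simp [hPt, deviation_apply, TensorProduct.sub_tmul]

/-- Colinearity gives z(h₁) S(h₂) ⊗ h₃ = 1 ⊗ z(h). Applying a functional f with f(1) = 1 to the
first factor shows z(h) = c(h₁) h₂ for c = f ∘ (z * S). -/
lemma exists_functional_of_quotComul {I K : TwoSidedIdeal (Bos X)} (hI : I ≠ ⊤)
    (htr : ∀ t ∈ K, transl (quot I) (quot I) t = 0) {z : H →ₗ[k] Bos X}
    (hz : ∀ h, quotComul I K (z h) = TensorProduct.map ((quot I).toLinearMap ∘ₗ z)
      ((quot K).toLinearMap ∘ₗ (Bos.ofH X).toLinearMap) (Coalgebra.comul (R := k) h)) :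
    ∃ c : H →ₗ[k] k, ∀ h, quot I (z h) = quot I (Bos.ofH X (lcontr c h)) := by
  have hI' := nontrivial_quot hI
  obtain ⟨m, hm⟩ := exists_factor (p := (quot K).toLinearMap) (quot_surjective K)
    (transl (quot I) (quot I)).toLinearMap fun t ht => htr t (quot_eq_zero.mp ht)
  obtain ⟨f, hf⟩ := exists_functional_one (k := k) (Bos X ⧸ I.asIdeal)
  let a : H →ₐ[k] Bos X ⧸ I.asIdeal := (quot I).comp (Bos.ofH X)
  let c : H →ₗ[k] Bos X ⧸ I.asIdeal := LinearMap.mul' k _ ∘ₗ TensorProduct.map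
    ((quot I).toLinearMap ∘ₗ z) (a.toLinearMap ∘ₗ HopfAlgebra.antipode k) ∘ₗ Coalgebra.comul
  refine ⟨f ∘ₗ c, fun h => ?_⟩
  have h1 := insertLeft_transl (quot I) (quot I) (z h)
  rw [← map_factor (p := (quot I).toLinearMap) (q := (quot K).toLinearMap) (f' := LinearMap.id)
    (fun t => rfl) hm, ← coact_eq, ← quotComul_eq, hz] at h1
  have h2 : ∀ w : H ⊗[k] H, TensorProduct.map LinearMap.id m (TensorProduct.map
      ((quot I).toLinearMap ∘ₗ z) ((quot K).toLinearMap ∘ₗ (Bos.ofH X).toLinearMap) w) =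
      TensorProduct.map ((quot I).toLinearMap ∘ₗ z) (TensorProduct.map
        ((MulOpposite.opLinearEquiv k).toLinearMap ∘ₗ a.toLinearMap ∘ₗ HopfAlgebra.antipode k)
        a.toLinearMap) (LinearMap.lTensor H Coalgebra.comul w) := by
    intro w
    induction w with
    | zero => simp
    | add a b ha hb => simp only [map_add, ha, hb]
    | tmul x y =>
      have h3 : m (quot K (Bos.ofH X y)) = transl (quot I) (quot I) (Bos.ofH X y) := hm _
      simp only [TensorProduct.map_tmul, LinearMap.lTensor_tmul, LinearMap.comp_apply,
        LinearMap.id_apply, AlgHom.toLinearMap_apply, h3, transl_eq, Bos.comul_ofH]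
      congr 1
      generalize Coalgebra.comul (R := k) y = w
      induction w with
      | zero => simp
      | add a b ha hb => simp only [map_add, ha, hb]
      | tmul x y =>
        have : HopfAlgebra.antipode k (Bos.ofH X x) = Bos.ofH X (HopfAlgebra.antipode k x) :=
          Bos.antipodeMap_ofH X x
        simp [Bos.ofHH, a, this]
  have h3 : ∀ w : (H ⊗[k] H) ⊗[k] H, insertLeft k _ _ (TensorProduct.map ((quot I).toLinearMap ∘ₗ z)
      (TensorProduct.map ((MulOpposite.opLinearEquiv k).toLinearMap ∘ₗ a.toLinearMap ∘ₗ
        HopfAlgebra.antipode k) a.toLinearMap) (TensorProduct.assoc k H H H w)) =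
      TensorProduct.map (LinearMap.mul' k _ ∘ₗ TensorProduct.map ((quot I).toLinearMap ∘ₗ z)
        (a.toLinearMap ∘ₗ HopfAlgebra.antipode k)) a.toLinearMap w := by
    intro w
    induction w with
    | zero => simp
    | add a b ha hb => simp only [map_add, ha, hb]
    | tmul x y =>
      induction x with
      | zero => simp
      | add a b ha hb => simp only [map_add, TensorProduct.add_tmul, ha, hb]
      | tmul u v => simp
  rw [h2, ← Coalgebra.coassoc_apply, h3, LinearMap.rTensor,
    map_factor (f := c) (h := a.toLinearMap) (fun t => rfl) (fun t => rfl)] at h1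
  have h4 := congrArg (fun z => TensorProduct.lid k _ (LinearMap.rTensor _ f z)) h1
  simp only [LinearMap.rTensor_tmul, TensorProduct.lid_tmul, hf, one_smul] at h4
  rw [← h4, lcontr, LinearMap.comp_apply, LinearMap.comp_apply]
  generalize Coalgebra.comul (R := k) h = w
  induction w with
  | zero => simp
  | add a b ha hb => simp only [map_add, ha, hb]
  | tmul x y => simp [a]

lemma sum_convolution {ι : Type*} (s : Finset ι) (A : Type*) [Ring A] [Algebra k A]
    (E : ι → H →ₗ[k] A) (F G : H →ₗ[k] A) (h : ∀ x, ∑ i ∈ s, E i x = F x) (z : H ⊗[k] H) :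
    ∑ i ∈ s, LinearMap.mul' k A (TensorProduct.map (E i) G z) =
      LinearMap.mul' k A (TensorProduct.map F G z) := by
  induction z with
  | zero => simp
  | add a b ha hb => simp only [map_add, Finset.sum_add_distrib, ha, hb]
  | tmul a b => simp [← Finset.sum_mul, h]

namespace Relations

variable {ι : Type*} (𝒢 : Relations X ι)

lemma exists_isLift {I : TwoSidedIdeal (Bos X)} (hI : I ≠ ⊤) (r : ι)
    (htr : ∀ t ∈ 𝒢.ideal (𝒢.level r), transl (quot I) (quot I) t = 0) :
    ∃ v ∈ wordsLT k θ (∑ i, 𝒢.deg r i), ∃ c : k, 𝒢.IsLift I r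
      (Bos.ofV X (𝒢.rel r) + Bos.ofV X v + algebraMap k (Bos X) c) := by
  classical
  have hI' := nontrivial_quot hI
  set K := 𝒢.ideal (𝒢.level r) with hK
  obtain ⟨y, hyg, hyχ⟩ := exists_pair X (𝒢.deg r)
  obtain ⟨f, hf⟩ := exists_functional_one (k := k) (Bos X ⧸ I.asIdeal)
  set g := Bos.ofH X (groupLike X (𝒢.deg r)) with hg
  have hgl : IsGroupLikeElem k g := Bos.isGroupLikeElem_ofH X (isGroupLikeElem_groupLike X _)
  set ξ := f ∘ₗ (quot I).toLinearMap ∘ₗ LinearMap.mulLeft k g ∘ₗ HopfAlgebra.antipode k with hξ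
  have h1 := coact_lcontr (a := quot I) (b := quot K) (quot_surjective K)
    (fun t ht => htr t (quot_eq_zero.mp ht)) hf hgl (𝒢.primitive r)
  rw [← hξ] at h1
  -- The term of Δ(r) of top degree in the second factor is g ⊗ r, and ξ(g) = 1, so the contraction
  -- has leading part r.
  obtain ⟨v, hv, hv'⟩ : ∃ v ∈ wordsLT k θ (∑ i, 𝒢.deg r i),
      lcontr ξ (Bos.ofV X (𝒢.rel r)) = Bos.ofV X (𝒢.rel r) + Bos.ofV X v := by
    have h2 : TensorProduct.lid k (Bos X) (LinearMap.rTensor (Bos X) ξ _) ∈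
        (wordsLT k θ (∑ i, 𝒢.deg r i)).map (Bos.ofV X).toLinearMap :=
      map_mem_of_mem_tens (f := (TensorProduct.lid k (Bos X)).toLinearMap ∘ₗ
        LinearMap.rTensor (Bos X) ξ) (fun a _ b hb => by
          rw [LinearMap.comp_apply, LinearMap.rTensor_tmul, LinearEquiv.coe_coe,
            TensorProduct.lid_tmul]
          exact Submodule.smul_mem _ (ξ a) hb) (Bos.comul_ofV_sub_right X (𝒢.rel_mem r))
    obtain ⟨v, hv, hv'⟩ := h2
    refine ⟨v, hv, ?_⟩
    have h3 : ξ g = 1 := by simp [hξ, hgl.mul_antipode_cancel, hf]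
    rw [map_sub, map_sub, LinearMap.rTensor_tmul, TensorProduct.lid_tmul, h3, one_smul,
      eq_sub_iff_add_eq] at hv'
    rw [add_comm]
    exact hv'.symm
  rw [hv'] at h1
  set t := Bos.ofV X (𝒢.rel r) + Bos.ofV X v with ht
  -- The lift `t` need not have weight χ_r, but its deviation has the form h ↦ c(h₁) h₂. The rest of
  -- the proof shows that adding a scalar to `t` repairs this.
  obtain ⟨c, hc⟩ := exists_functional_of_quotComul hI htr (quotComul_deviation y (r :=
    Bos.ofV X (𝒢.rel r)) (by rw [hyg]; exact h1) fun h => by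
      rw [hyχ]; exact Bos.ofH_mul_ofV X h (𝒢.rel_mem r))
  obtain ⟨e, he⟩ := exists_sum_words (𝒢.rel r + v)
  have ht' : t = Bos.ofV X (𝒢.rel r + v) := by rw [ht, map_add]
  obtain ⟨Φ, hΦ⟩ := exists_functional_character y.χ
  let m : List (Fin θ) → FreeAlgebra k (Fin θ) := fun w => (w.map (FreeAlgebra.ι k)).prod
  let a : List (Fin θ) → Bos X ⧸ I.asIdeal := fun w => e w • quot I (Bos.ofV X (m w))
  let ψ : List (Fin θ) → H →ₐ[k] k := fun w => (wordPair X w).χ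
  have hta : quot I t = ∑ w ∈ e.support, a w := by
    rw [ht', he]
    simp [Finsupp.sum, a, m]
  let α : H →ₐ[k] Bos X ⧸ I.asIdeal := (quot I).comp (Bos.ofH X)
  have h2 : ∀ h, ∑ w ∈ e.support, (LinearMap.mulLeft k (a w) ∘ₗ α.toLinearMap ∘ₗ
      lcontr ((ψ w).toLinearMap - y.χ.toLinearMap)) h =
        (LinearMap.mulLeft k 1 ∘ₗ α.toLinearMap ∘ₗ lcontr c) h := by
    intro h
    have h3 := hc h
    rw [deviation_apply, map_sub, map_mul (quot I) t, hta, ht', he, Finsupp.sum, map_sum,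
      Finset.mul_sum, map_sum, Finset.sum_mul, ← Finset.sum_sub_distrib] at h3
    refine Eq.trans ?_ (h3.trans ?_)
    · refine Finset.sum_congr rfl fun w _ => ?_
      have h4 : ∀ ξ η : H →ₗ[k] k, lcontr (ξ - η) h = lcontr ξ h - lcontr η h := by
        intro ξ η
        simp [lcontr, LinearMap.rTensor_sub]
      have h5 : lcontr (ψ w).toLinearMap h = leftTwist (wordPair X w).χ h := rfl
      have h6 : lcontr y.χ.toLinearMap h = leftTwist y.χ h := rfl
      rw [LinearMap.comp_apply, LinearMap.comp_apply, h4, h5, h6, map_smul, mul_smul_comm,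
        Bos.ofH_mul_word]
      simp [a, α, m, mul_sub]
    · simp [α]
  -- Words are weight vectors, which gives a second description of the deviation. Convolving with
  -- the antipode removes the tail h₂ from both.
  have h3 : ∀ h, ∑ w ∈ e.support, (ψ w h - y.χ h) • a w = c h • 1 := by
    intro h
    have h4 := sum_convolution e.support _ _ _ (α.toLinearMap ∘ₗ HopfAlgebra.antipode k) h2
      (Coalgebra.comul (R := k) h)
    have h5 : ∀ b (ζ : H →ₗ[k] k), LinearMap.mul' k _ (TensorProduct.map (LinearMap.mulLeft k b ∘ₗ
        α.toLinearMap ∘ₗ lcontr ζ) (α.toLinearMap ∘ₗ HopfAlgebra.antipode k)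
          (Coalgebra.comul (R := k) h)) = ζ h • b := by
      intro b ζ
      have h6 : ∀ z : H ⊗[k] H, LinearMap.mul' k _ (TensorProduct.map (LinearMap.mulLeft k b ∘ₗ
        α.toLinearMap ∘ₗ lcontr ζ) (α.toLinearMap ∘ₗ HopfAlgebra.antipode k) z) =
        b * α (LinearMap.mul' k H (TensorProduct.map (lcontr ζ) (HopfAlgebra.antipode k) z)) := by
        intro z
        induction z with
        | zero => simp
        | add a b ha hb => simp only [map_add, mul_add, ha, hb]
        | tmul a b => simp [mul_assoc]
      rw [h6, lcontr_mul_antipode, map_smul, map_one, mul_smul_comm, mul_one]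
    simp only [h5] at h4
    exact h4
  -- The component of weight χ_r. Applying to `h3` the functional `Φ`, which is 1 at χ_r and 0 at
  -- every other character, gives v' = t + Φ(c) in 𝒯/I.
  let v' : FreeAlgebra k (Fin θ) := ∑ w ∈ e.support, if ψ w = y.χ then e w • m w else 0
  have h4 : quot I (Bos.ofV X v') = quot I (t + algebraMap k (Bos X) (Φ c)) := by
    rw [← sub_eq_zero]
    -- `Φ` acts on scalar functions on H, so `h3` is first paired with an arbitrary functional `p`
    -- on the quotient.
    refine (Module.forall_dual_apply_eq_zero_iff k _).mp fun p => ?_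
    have h5 : ∑ w ∈ e.support, p (a w) • ((ψ w : H → k) - (y.χ : H → k)) = p 1 • (c : H → k) := by
      funext h
      have h6 := congrArg p (h3 h)
      simp only [map_sum, map_smul, smul_eq_mul] at h6
      simp only [Finset.sum_apply, Pi.smul_apply, Pi.sub_apply, smul_eq_mul]
      rw [mul_comm, ← h6]
      exact Finset.sum_congr rfl fun w _ => mul_comm _ _
    have h6 := congrArg Φ h5
    simp only [map_sum, map_smul, map_sub, hΦ, if_true, smul_eq_mul] at h6
    have h7 : quot I (Bos.ofV X v') = ∑ w ∈ e.support, if ψ w = y.χ then a w else 0 := by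
      simp only [v', map_sum]
      refine Finset.sum_congr rfl fun w _ => ?_
      split_ifs
      · simp [a]
      · simp
    have h8 : ∀ w, p (if ψ w = y.χ then a w else 0) - p (a w) =
        p (a w) * ((if ψ w = y.χ then 1 else 0) - 1) := by
      intro w
      split_ifs <;> simp
    rw [h7, map_add, hta, AlgHom.commutes, Algebra.algebraMap_eq_smul_one, map_sub, map_add,
      map_smul, map_sum, map_sum, smul_eq_mul, mul_comm (Φ c), ← h6, ← sub_sub,
      ← Finset.sum_sub_distrib, Finset.sum_congr rfl fun w _ => h8 w, sub_self]
  refine ⟨v, hv, Φ c, ?_, fun h => ?_⟩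
  · change quotComul I K t = _ at h1
    change quotComul I K (t + _) = quot I (t + _) ⊗ₜ 1 + _
    rw [map_add (quotComul I K) t, AlgHom.commutes, map_add (quot I) t, AlgHom.commutes, h1, TensorProduct.add_tmul, Algebra.TensorProduct.algebraMap_apply, add_right_comm]
    rfl
  · rw [map_mul, map_mul, ← h4, ← map_mul, ← map_mul, ← hyχ]
    congr 1
    simp only [v', map_sum, Finset.mul_sum, Finset.sum_mul]
    refine Finset.sum_congr rfl fun w _ => ?_
    split_ifs with h5
    · rw [map_smul, mul_smul_comm, Bos.ofH_mul_word, smul_mul_assoc]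
      rw [← h5]
    · simp

end Relations

end Lifts

/-! ### The biGalois property of 𝒜(Λ) and leading terms of ℒ(Λ) -/

section Induction

variable {k : Type*} [Field k] {H : Type*} [Ring H] [HopfAlgebra k H] {θ : ℕ}
  {X : Fin θ → YDPair k H}

lemma Bos.rcontr_mem_fil {n : ℕ} {t : Bos X} (ht : t ∈ Bos.fil X (n + 1)) (ξ : Bos X →ₗ[k] k) :
    rcontr ξ t ∈ Bos.fil X (n + 1) := by
  refine Bos.map_mem_of_mem_fil₂ X (f := (TensorProduct.rid k (Bos X)).toLinearMap ∘ₗ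
    LinearMap.lTensor (Bos X) ξ) (fun i j hij a ha b _ => ?_) (Bos.comul_mem_fil₂ X ht)
  rw [LinearMap.comp_apply, LinearMap.lTensor_tmul, LinearEquiv.coe_coe, TensorProduct.rid_tmul]
  exact Submodule.smul_mem _ _ (Bos.fil_mono X (by omega) ha)

/-- An ideal that defines a Hopf algebra. -/
lemma IsBigalois.isHopfIdeal {I K J : TwoSidedIdeal (Bos X)} (h : IsBigalois I K J) :
    J.asIdeal.IsHopfIdeal k where
  counit_eq_zero t ht := h.counit t (TwoSidedIdeal.mem_asIdeal.mp ht)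
  map_mkQ_comul_eq_zero t ht := h.comul t (TwoSidedIdeal.mem_asIdeal.mp ht)
  antipode_mem t ht := TwoSidedIdeal.mem_asIdeal.mpr (h.antipode t (TwoSidedIdeal.mem_asIdeal.mp ht))

namespace Relations

variable {ι : Type*} {𝒢 : Relations X ι}

/-- The difference of two lifts is coinvariant. -/
lemma IsLift.exists_scalar {I : TwoSidedIdeal (Bos X)} (hI : I ≠ ⊤) {r : ι}
    (htr : ∀ t ∈ 𝒢.ideal (𝒢.level r), transl (quot I) (quot I) t = 0) {s t : Bos X}
    (hs : 𝒢.IsLift I r s) (ht : 𝒢.IsLift I r t) :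
    ∃ c : k, s - t - algebraMap k (Bos X) c ∈ I := by
  refine exists_scalar_of_quotComul hI htr ?_
  rw [map_sub, hs.1, ht.1, map_sub, TensorProduct.sub_tmul]
  abel

variable (γ : 𝒢.Sections)

lemma Sections.lift_spec {I : TwoSidedIdeal (Bos X)} (hI : I ≠ ⊤) (r : ι)
    (htr : ∀ t ∈ 𝒢.ideal (𝒢.level r), transl (quot I) (quot I) t = 0) :
    𝒢.IsLift I r (γ.lift I r) := by
  obtain ⟨v, _, c, h⟩ := 𝒢.exists_isLift hI r htr
  exact γ.isLift I r ⟨_, h⟩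

/-- Whatever choice `γ` makes, it differs by a scalar modulo `I` from the lift of `exists_isLift`,
whose leading term is known. -/
lemma Sections.exists_lift_sub_mem {I : TwoSidedIdeal (Bos X)} (hI : I ≠ ⊤) (r : ι)
    (htr : ∀ t ∈ 𝒢.ideal (𝒢.level r), transl (quot I) (quot I) t = 0) :
    ∃ v ∈ wordsLT k θ (∑ i, 𝒢.deg r i), ∃ c : k, γ.lift I r -
      (Bos.ofV X (𝒢.rel r) + Bos.ofV X v + algebraMap k (Bos X) c) ∈ I := by
  obtain ⟨v, hv, c, h⟩ := 𝒢.exists_isLift hI r htr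
  obtain ⟨c', hc⟩ := (γ.lift_spec hI r htr).exists_scalar hI htr h
  refine ⟨v, hv, c + c', ?_⟩
  rwa [map_add, ← add_assoc, ← sub_sub]

/-- The element `r̃`, with its top symbol. -/
lemma Sections.exists_tilde {I J : TwoSidedIdeal (Bos X)} {r : ι}
    (h : IsBigalois I (𝒢.ideal (𝒢.level r)) J) (hI : I ≠ ⊤) :
    ∃ u, quotComul J I (γ.lift I r) = quot J u ⊗ₜ 1 +
        quot J (Bos.ofH X (𝒢.g r)) ⊗ₜ quot I (γ.lift I r) ∧
      (∑ i, 𝒢.deg r i ≠ 0 → Bos.ofV X (𝒢.rel r) - u ∈ Bos.fil X (∑ i, 𝒢.deg r i)) := by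
  have hI' := nontrivial_quot hI
  obtain ⟨f, hf⟩ := exists_functional_one (k := k) (Bos X ⧸ I.asIdeal)
  obtain ⟨v, hv, c, ht⟩ := γ.exists_lift_sub_mem hI r h.tra
  set t := Bos.ofV X (𝒢.rel r) + Bos.ofV X v + algebraMap k (Bos X) c with htd
  have hL := (γ.lift_spec hI r h.tra).1
  -- Both coactions vanish on `I`, so the chosen lift may be replaced by a representative of
  -- controlled degree.
  have h1 : quotComul J I (γ.lift I r) = quotComul J I t := by
    rw [← sub_eq_zero, ← map_sub]
    exact h.del _ ht
  have h2 : quotComul I (𝒢.ideal (𝒢.level r)) (γ.lift I r) =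
      quotComul I (𝒢.ideal (𝒢.level r)) t := by
    rw [← sub_eq_zero, ← map_sub]
    exact h.rho _ ht
  have h3 : quot I (γ.lift I r) = quot I t := quot_eq_quot.mpr ht
  have hgl : IsGroupLikeElem k (Bos.ofH X (𝒢.g r)) :=
    Bos.isGroupLikeElem_ofH X (isGroupLikeElem_groupLike X _)
  rw [h2, h3] at hL
  have h4 := coact_rcontr (l := quot J) (quot_surjective I) (quot_surjective _)
    (fun t ht => h.tra t (quot_eq_zero.mp ht)) (fun t ht => h.del t (quot_eq_zero.mp ht)) hf hgl hL
  refine ⟨_, by rw [h1, h3]; exact h4, fun hm => ?_⟩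
  obtain ⟨m, hm⟩ := Nat.exists_eq_succ_of_ne_zero hm
  rw [hm] at hv ⊢
  -- The term of Δ(r) of top degree in the first factor is r ⊗ 1, and f(1) = 1, so contraction
  -- preserves the leading term. The degree of r must be nonzero for the remaining terms from H to
  -- be of lower degree.
  have h5 : rcontr (f ∘ₗ (quot I).toLinearMap) (Bos.ofV X (𝒢.rel r)) - Bos.ofV X (𝒢.rel r) ∈
      Bos.fil X (m + 1) := by
    have h6 := map_mem_of_mem_tens (U := Bos.fil X (m + 1))
      (f := (TensorProduct.rid k (Bos X)).toLinearMap ∘ₗ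
        LinearMap.lTensor (Bos X) (f ∘ₗ (quot I).toLinearMap)) (fun a ha b _ => by
          rw [LinearMap.comp_apply, LinearMap.lTensor_tmul, LinearEquiv.coe_coe,
            TensorProduct.rid_tmul]
          exact Submodule.smul_mem _ _ ha)
      (Bos.comul_ofV_sub_left X (hm ▸ homogeneousPart_le _ (𝒢.rel_mem r)))
    rw [map_sub] at h6
    have h7 : TensorProduct.rid k (Bos X) (LinearMap.lTensor (Bos X) (f ∘ₗ (quot I).toLinearMap)
        (Bos.ofV X (𝒢.rel r) ⊗ₜ 1)) = Bos.ofV X (𝒢.rel r) := by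
      simp [hf]
    simp only [LinearMap.comp_apply, LinearEquiv.coe_coe, h7] at h6
    exact h6
  have h6 : ∀ h, Bos.ofH X h ∈ Bos.fil X (m + 1) := fun h => Bos.ofH_mem_fil X h m
  have h7 : algebraMap k (Bos X) c ∈ Bos.fil X (m + 1) := by
    rw [← (Bos.ofH X).commutes]
    exact h6 _
  rw [htd, map_add (rcontr _), map_add (rcontr _)]
  have h8 : ∀ a b c d e : Bos X, a - (b + c + d - e) = -(b - a) - c - d + e := by
    intros
    abel
  rw [h8]
  exact add_mem (sub_mem (sub_mem (neg_mem h5) (Bos.rcontr_mem_fil (Bos.ofV_mem_fil X hv) _))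
    (Bos.rcontr_mem_fil h7 _)) (Submodule.smul_mem _ _ (h6 _))

lemma ideal_succ (n : ℕ) : 𝒢.ideal (n + 1) = 𝒢.ideal n ⊔
    TwoSidedIdeal.span {z | ∃ r, 𝒢.level r = n ∧ z = Bos.ofV X (𝒢.rel r)} := by
  refine le_antisymm (TwoSidedIdeal.span_le.mpr ?_) (sup_le (𝒢.ideal_mono (Nat.le_succ n))
    (TwoSidedIdeal.span_mono ?_))
  · rintro _ ⟨r, hr, rfl⟩
    rcases Nat.lt_succ_iff_lt_or_eq.mp hr with h | h
    · exact TwoSidedIdeal.mem_sup_left (TwoSidedIdeal.subset_span ⟨r, h, rfl⟩)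
    · exact TwoSidedIdeal.mem_sup_right (TwoSidedIdeal.subset_span ⟨r, h, rfl⟩)
  · rintro _ ⟨r, hr, rfl⟩
    exact ⟨r, by omega, rfl⟩

variable (Λ : ι → k)

/-- Induction over the strata by `IsBigalois.sup`. Only the stages before `n` have to be nonzero,
since each stage supplies the lifts for the next. -/
lemma isBigalois (n : ℕ) (hΛ : ∀ m < n, cleftIdeal γ Λ m ≠ ⊤) :
    IsBigalois (cleftIdeal γ Λ n) (𝒢.ideal n) (liftingIdeal γ Λ n) := by
  induction n with
  | zero =>
    have h1 : 𝒢.ideal 0 = ⊥ := by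
      refine le_bot_iff.mp (TwoSidedIdeal.span_le.mpr ?_)
      rintro _ ⟨r, hr, -⟩
      omega
    rw [h1]
    exact isBigalois_bot
  | succ n ih =>
    have hn := ih fun m hm => hΛ m (by omega)
    have hI := hΛ n n.lt_succ_self
    rw [ideal_succ, cleftIdeal, liftingIdeal]
    have hgl : ∀ r, IsGroupLikeElem k (Bos.ofH X (𝒢.g r)) := fun r =>
      Bos.isGroupLikeElem_ofH X (isGroupLikeElem_groupLike X _)
    refine hn.sup hI ?_ ?_ ?_
    · rintro _ ⟨r, rfl, rfl⟩
      obtain ⟨u, hu, -⟩ := γ.exists_tilde hn hI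
      exact ⟨_, _, _, u, Λ r, hgl r, rfl, ⟨r, rfl, rfl⟩, ⟨r, u, rfl, hu, rfl⟩,
        (γ.lift_spec hI r hn.tra).1, hu⟩
    · rintro _ ⟨r, rfl, rfl⟩
      exact ⟨_, _, Λ r, hgl r, ⟨r, rfl, rfl⟩, (γ.lift_spec hI r hn.tra).1⟩
    · rintro _ ⟨r, u, rfl, hu, rfl⟩
      exact ⟨_, _, u, Λ r, hgl r, ⟨r, rfl, rfl⟩, rfl, hu⟩

lemma liftingIdeal_mono {m n : ℕ} (h : m ≤ n) : liftingIdeal γ Λ m ≤ liftingIdeal γ Λ n :=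
  monotone_nat_of_le_succ (fun _ => le_sup_left) h

lemma cleftIdeal_mono {m n : ℕ} (h : m ≤ n) : cleftIdeal γ Λ m ≤ cleftIdeal γ Λ n :=
  monotone_nat_of_le_succ (fun _ => le_sup_left) h

/-- The relations of the lifting are deformations of those of the Nichols algebra. -/
lemma exists_mem_liftingIdeal (hΛ : ∀ m < 𝒢.len, cleftIdeal γ Λ m ≠ ⊤) (r : ι) :
    ∃ u ∈ liftingIdeal γ Λ 𝒢.len, Bos.ofV X (𝒢.rel r) - u ∈ Bos.fil X (∑ i, 𝒢.deg r i) := by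
  -- A relation of degree zero is a constant in 𝒥(V), hence zero.
  by_cases hm : ∑ i, 𝒢.deg r i = 0
  · have h1 := homogeneousPart_le _ (𝒢.rel_mem r)
    rw [hm] at h1
    have h2 := (𝒢.generate _).mp (TwoSidedIdeal.subset_span ⟨r, rfl⟩)
    refine ⟨0, TwoSidedIdeal.zero_mem _, ?_⟩
    rw [eq_zero_of_mem_nicholsIdeal_of_zero _ h1 h2]
    simp
  · have hr := 𝒢.level_lt r
    obtain ⟨u, hu, hu'⟩ := γ.exists_tilde
      (isBigalois γ Λ (𝒢.level r) fun m hm => hΛ m (by omega)) (hΛ _ hr)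
    refine ⟨u - Λ r • (1 - Bos.ofH X (𝒢.g r)), liftingIdeal_mono γ Λ hr ?_, ?_⟩
    · exact TwoSidedIdeal.mem_sup_right (TwoSidedIdeal.subset_span ⟨r, u, rfl, hu, rfl⟩)
    · obtain ⟨m, hm'⟩ := Nat.exists_eq_succ_of_ne_zero hm
      rw [sub_sub_eq_add_sub, add_sub_right_comm]
      refine add_mem (hu' hm) (Submodule.smul_mem _ _ ?_)
      rw [hm', ← map_one (Bos.ofH X), ← map_sub]
      exact Bos.ofH_mem_fil X _ m

end Relations

end Induction

/-! ### Cosemisimple Hopf algebras: skew-primitives are trivial -/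

section Cosemisimple

variable {k : Type*} [Field k] {H : Type*} [Ring H] [HopfAlgebra k H]

lemma tensor_eq_of_forall {M N : Type*} [AddCommGroup M] [Module k M] [AddCommGroup N] [Module k N]
    {y z : M ⊗[k] N} (h : ∀ p : N →ₗ[k] k, TensorProduct.rid k M (LinearMap.lTensor M p y) =
      TensorProduct.rid k M (LinearMap.lTensor M p z)) : y = z := by
  classical
  let b := Module.Basis.ofVectorSpace k N
  apply (TensorProduct.equivFinsuppOfBasisRight b).injective
  ext i
  rw [TensorProduct.equivFinsuppOfBasisRight_apply, TensorProduct.equivFinsuppOfBasisRight_apply, h]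

lemma tensor_eq_of_forall' {M N : Type*} [AddCommGroup M] [Module k M] [AddCommGroup N] [Module k N]
    {y z : M ⊗[k] N} (h : ∀ p : M →ₗ[k] k, TensorProduct.lid k N (LinearMap.rTensor N p y) =
      TensorProduct.lid k N (LinearMap.rTensor N p z)) : y = z := by
  classical
  let b := Module.Basis.ofVectorSpace k M
  apply (TensorProduct.equivFinsuppOfBasisLeft b).injective
  ext i
  rw [TensorProduct.equivFinsuppOfBasisLeft_apply, TensorProduct.equivFinsuppOfBasisLeft_apply, h]

/-- Subcoalgebras are the subspaces stable under contractions. -/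
lemma isSubcoalgebra_iff {C : Submodule k H} : IsSubcoalgebra C ↔
    ∀ p : H →ₗ[k] k, ∀ c ∈ C, rcontr p c ∈ C ∧ lcontr p c ∈ C := by
  constructor
  · intro h p c hc
    obtain ⟨z, hz⟩ := h c hc
    constructor
    · change TensorProduct.rid k H (LinearMap.lTensor H p (Coalgebra.comul (R := k) c)) ∈ C
      rw [← hz]
      generalize z = z
      clear hz
      induction z with
      | zero => simp
      | add a b ha hb => simp only [map_add]; exact add_mem ha hb
      | tmul a b => simpa using C.smul_mem _ a.2
    · change TensorProduct.lid k H (LinearMap.rTensor H p (Coalgebra.comul (R := k) c)) ∈ C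
      rw [← hz]
      generalize z = z
      clear hz
      induction z with
      | zero => simp
      | add a b ha hb => simp only [map_add]; exact add_mem ha hb
      | tmul a b => simpa using C.smul_mem _ b.2
  · intro h c hc
    -- Contractions of Δ(c) on either side stay in `C`, so a linear projection onto `C` fixes both
    -- tensor factors of Δ(c).
    obtain ⟨π, hπ⟩ := LinearMap.exists_leftInverse_of_injective C.subtype C.ker_subtype
    have hπ' : ∀ x ∈ C, (π x : H) = x := fun x hx =>
      congrArg Subtype.val (LinearMap.congr_fun hπ ⟨x, hx⟩)
    set z := Coalgebra.comul (R := k) c with hz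
    set e := C.subtype ∘ₗ π with he
    have h1 : LinearMap.rTensor H e z = z := by
      refine tensor_eq_of_forall fun p => ?_
      have h2 : ∀ z : H ⊗[k] H, TensorProduct.rid k H (LinearMap.lTensor H p
          (LinearMap.rTensor H e z)) = e (TensorProduct.rid k H (LinearMap.lTensor H p z)) := by
        intro z
        induction z with
        | zero => simp
        | add a b ha hb => simp only [map_add, ha, hb]
        | tmul a b => simp
      rw [h2]
      exact hπ' _ (h p c hc).1
    have h2 : LinearMap.lTensor H e z = z := by
      refine tensor_eq_of_forall' fun p => ?_
      have h2 : ∀ z : H ⊗[k] H, TensorProduct.lid k H (LinearMap.rTensor H p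
          (LinearMap.lTensor H e z)) = e (TensorProduct.lid k H (LinearMap.rTensor H p z)) := by
        intro z
        induction z with
        | zero => simp
        | add a b ha hb => simp only [map_add, ha, hb]
        | tmul a b => simp
      rw [h2]
      exact hπ' _ (h p c hc).2
    refine ⟨TensorProduct.map π π z, ?_⟩
    rw [map_factor (f := e) (h := e) (fun t => rfl) (fun t => rfl)]
    have h3 := LinearMap.congr_fun (LinearMap.rTensor_comp_lTensor (f := e) (g := e)) z
    rw [LinearMap.comp_apply, h2, h1] at h3
    exact h3.symm

/-- Stability under contractions passes to intersections at once, whereas the definition would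
require comparing tensor squares of subspaces. -/
lemma IsSubcoalgebra.inf {C D : Submodule k H} (hC : IsSubcoalgebra C) (hD : IsSubcoalgebra D) :
    IsSubcoalgebra (C ⊓ D) := by
  rw [isSubcoalgebra_iff] at *
  exact fun p c hc => ⟨⟨(hC p c hc.1).1, (hD p c hc.2).1⟩, (hC p c hc.1).2, (hD p c hc.2).2⟩

lemma rcontr_of_isGroupLikeElem (p : H →ₗ[k] k) {g : H} (hg : IsGroupLikeElem k g) :
    rcontr p g = p g • g := by
  simp [rcontr, hg.comul_eq_tmul_self]

lemma rcontr_eq_zero {C : Submodule k H} (hC : IsSubcoalgebra C) {p : H →ₗ[k] k}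
    (hp : ∀ c ∈ C, p c = 0) {c : H} (hc : c ∈ C) : rcontr p c = 0 := by
  obtain ⟨z, hz⟩ := hC c hc
  change TensorProduct.rid k H (LinearMap.lTensor H p (Coalgebra.comul (R := k) c)) = 0
  rw [← hz]
  generalize z = z
  clear hz
  induction z with
  | zero => simp
  | add a b ha hb => simp only [map_add, ha, hb, add_zero]
  | tmul a b => simp [hp b b.2]

lemma isSubcoalgebra_span_one : IsSubcoalgebra (Submodule.span k {(1 : H)}) := by
  intro c hc
  obtain ⟨a, rfl⟩ := Submodule.mem_span_singleton.mp hc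
  refine ⟨a • (⟨1, Submodule.mem_span_singleton_self 1⟩ ⊗ₜ ⟨1, Submodule.mem_span_singleton_self 1⟩), ?_⟩
  simp [Algebra.TensorProduct.one_def]

/-- There is a projection onto the scalars that vanishes on the other simple subcoalgebras. -/
lemma exists_functional_of_isCosemisimple (hH : IsCosemisimple k H) :
    ∃ p : H →ₗ[k] k, p 1 = 1 ∧ ∀ h, rcontr p h = p h • 1 := by
  classical
  set S := {C : Submodule k H | IsSimpleSubcoalgebra C ∧ C ≠ Submodule.span k {1}} with hS
  -- A product of contractions fixes 1 and kills finitely many simple subcoalgebras other than k·1;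
  -- that each factor preserves every subcoalgebra is what allows composing them. Hence 1 is not in
  -- the sum of these subcoalgebras.
  have h1 : ∀ s : Finset (Submodule k H), (∀ C ∈ s, C ∈ S) → ∃ R : H →ₗ[k] H, R 1 = 1 ∧
      (∀ C : Submodule k H, IsSubcoalgebra C → ∀ c ∈ C, R c ∈ C) ∧ ∀ C ∈ s, ∀ c ∈ C, R c = 0 := by
    intro s
    induction s using Finset.induction_on with
    | empty => exact fun _ => ⟨LinearMap.id, rfl, fun _ _ _ h => h, by simp⟩
    | insert C s hCs ih =>
      intro hs
      obtain ⟨R, hR1, hR2, hR3⟩ := ih fun D hD => hs D (Finset.mem_insert_of_mem hD)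
      obtain ⟨hC, hC1⟩ := hs C (Finset.mem_insert_self _ _)
      have h2 : (1 : H) ∉ C := by
        intro h2
        have h3 : Submodule.span k {(1 : H)} ≤ C := by
          rwa [Submodule.span_singleton_le_iff_mem]
        rcases hC.2.2 _ h3 isSubcoalgebra_span_one with h4 | h4
        · rw [Submodule.span_singleton_eq_bot] at h4
          refine hC.2.1 (Submodule.eq_bot_iff _ |>.mpr fun x _ => ?_)
          rw [← mul_one x, h4, mul_zero]
        · exact hC1 h4.symm
      obtain ⟨f, hf1, hf2⟩ := Submodule.exists_le_ker_of_notMem h2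
      set p := (f 1)⁻¹ • f with hp
      have hp1 : p 1 = 1 := by simp [hp, hf1]
      have hpC : ∀ c ∈ C, p c = 0 := fun c hc => by
        have : f c = 0 := hf2 hc
        simp [hp, this]
      refine ⟨R ∘ₗ rcontr p, ?_, fun D hD c hc => ?_, fun D hD c hc => ?_⟩
      · rw [LinearMap.comp_apply, rcontr_of_isGroupLikeElem p .one, hp1, one_smul, hR1]
      · exact hR2 D hD _ (isSubcoalgebra_iff.mp hD p c hc).1
      · rcases Finset.mem_insert.mp hD with rfl | hD'
        · rw [LinearMap.comp_apply, rcontr_eq_zero hC.1 hpC hc, map_zero]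
        · exact hR3 D hD' _ (isSubcoalgebra_iff.mp (hs D hD).1.1 p c hc).1
  by_cases htriv : (1 : H) = 0
  · have : ∀ x : H, x = 0 := fun x => by rw [← mul_one x, htriv, mul_zero]
    have h2 := Bialgebra.counit_one (R := k) (A := H)
    rw [htriv, map_zero] at h2
    exact absurd h2 zero_ne_one
  have h2 : (1 : H) ∉ sSup S := by
    intro h2
    obtain ⟨s, hs, hm⟩ := Submodule.mem_sSup_iff_exists_finset.mp h2
    obtain ⟨R, hR1, -, hR3⟩ := h1 s hs
    have h3 : (⨆ C ∈ s, C) ≤ LinearMap.ker R := iSup₂_le fun C hC c hc => hR3 C hC c hc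
    have h4 : R 1 = 0 := h3 hm
    exact htriv (hR1.symm.trans h4)
  obtain ⟨f, hf1, hf2⟩ := Submodule.exists_le_ker_of_notMem h2
  refine ⟨(f 1)⁻¹ • f, by simp [hf1], fun h => ?_⟩
  set p := (f 1)⁻¹ • f with hp
  have hp1 : p 1 = 1 := by simp [hp, hf1]
  -- By linearity it suffices to check simple subcoalgebras: on k·1 this is the normalisation, on
  -- the others both sides vanish.
  have h3 : (⊤ : Submodule k H) ≤ LinearMap.ker (rcontr p - LinearMap.toSpanSingleton k H 1 ∘ₗ p) := by
    rw [← (show sSup {C : Submodule k H | IsSimpleSubcoalgebra C} = ⊤ from hH)]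
    refine sSup_le fun C hC c hc => ?_
    rw [LinearMap.mem_ker, LinearMap.sub_apply, LinearMap.comp_apply,
      LinearMap.toSpanSingleton_apply]
    by_cases hC1 : C = Submodule.span k {1}
    · subst hC1
      obtain ⟨a, rfl⟩ := Submodule.mem_span_singleton.mp hc
      rw [map_smul, rcontr_of_isGroupLikeElem p .one, map_smul, hp1]
      simp
    · have h4 : ∀ c ∈ C, p c = 0 := fun c hc => by
        have : f c = 0 := hf2 (le_sSup (show C ∈ S from ⟨hC, hC1⟩) hc)
        simp [hp, this]
      rw [rcontr_eq_zero hC.1 h4 hc, h4 c hc, zero_smul, sub_zero]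
  have h4 := h3 (show h ∈ ⊤ from trivial)
  rw [LinearMap.mem_ker, LinearMap.sub_apply, sub_eq_zero] at h4
  simpa using h4

/-- The skew-primitive elements of a cosemisimple Hopf algebra are trivial. -/
lemma exists_eq_smul_of_isCosemisimple (hH : IsCosemisimple k H) {g h : H}
    (hh : Coalgebra.comul (R := k) h = h ⊗ₜ 1 + g ⊗ₜ h) : ∃ c : k, h = c • (1 - g) := by
  obtain ⟨p, hp1, hp⟩ := exists_functional_of_isCosemisimple hH
  refine ⟨p h, ?_⟩
  -- Contracting with `p` gives h + p(h) g = p(h).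
  have h1 := hp h
  simp only [rcontr, LinearMap.comp_apply, hh, map_add, LinearMap.lTensor_tmul,
    LinearEquiv.coe_coe, TensorProduct.rid_tmul, hp1, one_smul] at h1
  rw [smul_sub, ← h1]
  abel

end Cosemisimple

/-! ### Coradical and skew-primitive elements of a lifting -/

section Coradical

variable {k : Type*} [Field k] {H : Type*} [Ring H] [HopfAlgebra k H] {θ : ℕ}
  {X : Fin θ → YDPair k H}

/-- A derivation of order d need not descend to a lifting, but on elements of degree at most d it
does. Agreement on that subspace is all that is used. -/
lemma exists_factor_on {M N V : Type*} [AddCommGroup M] [Module k M] [AddCommGroup N]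
    [Module k N] [AddCommGroup V] [Module k V] (p : M →ₗ[k] N) (U : Submodule k M) (f : M →ₗ[k] V)
    (hf : ∀ t ∈ U, p t = 0 → f t = 0) : ∃ g : N →ₗ[k] V, ∀ t ∈ U, g (p t) = f t := by
  obtain ⟨g, hg⟩ := exists_factor (p := (p ∘ₗ U.subtype).rangeRestrict)
    (LinearMap.surjective_rangeRestrict _) (f ∘ₗ U.subtype)
    fun t ht => hf t t.2 (congrArg Subtype.val ht)
  obtain ⟨e, he⟩ := LinearMap.exists_extend g
  refine ⟨e, fun t ht => ?_⟩
  have h1 := LinearMap.congr_fun he ((p ∘ₗ U.subtype).rangeRestrict ⟨t, ht⟩)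
  rw [hg] at h1
  exact h1

lemma isSubcoalgebra_top {A : Type*} [Ring A] [HopfAlgebra k A] :
    IsSubcoalgebra (⊤ : Submodule k A) :=
  isSubcoalgebra_iff.mpr fun _ _ _ => ⟨trivial, trivial⟩

lemma IsSubcoalgebra.map {A B : Type*} [Ring A] [HopfAlgebra k A] [Ring B] [HopfAlgebra k B]
    {C : Submodule k A} (hC : IsSubcoalgebra C) (f : A →ₗ[k] B) (hf : ∀ a,
      Coalgebra.comul (R := k) (f a) = TensorProduct.map f f (Coalgebra.comul (R := k) a)) :
    IsSubcoalgebra (C.map f) := by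
  rintro _ ⟨c, hc, rfl⟩
  obtain ⟨z, hz⟩ := hC c hc
  let e : C →ₗ[k] C.map f := f.restrict fun x hx => Submodule.mem_map_of_mem hx
  refine ⟨TensorProduct.map e e z, ?_⟩
  rw [hf, ← hz]
  exact (map_factor (p := e) (q := e) (f := f ∘ₗ C.subtype) (h := f ∘ₗ C.subtype) (fun _ => rfl)
    (fun _ => rfl) z).trans (map_factor (p := C.subtype) (q := C.subtype) (f := f ∘ₗ C.subtype)
    (h := f ∘ₗ C.subtype) (fun _ => rfl) (fun _ => rfl) z).symm

lemma IsSubcoalgebra.comap {A B : Type*} [Ring A] [HopfAlgebra k A] [Ring B] [HopfAlgebra k B]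
    {D : Submodule k B} (hD : IsSubcoalgebra D) (f : A →ₗ[k] B) (hi : Function.Injective f)
    (hf : ∀ a, Coalgebra.comul (R := k) (f a) =
      TensorProduct.map f f (Coalgebra.comul (R := k) a)) : IsSubcoalgebra (D.comap f) := by
  obtain ⟨r, hr⟩ := LinearMap.exists_leftInverse_of_injective f (LinearMap.ker_eq_bot.mpr hi)
  rw [isSubcoalgebra_iff] at hD ⊢
  have h1 : ∀ (p : A →ₗ[k] k) a, f (rcontr p a) = rcontr (p ∘ₗ r) (f a) ∧
      f (lcontr p a) = lcontr (p ∘ₗ r) (f a) := by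
    intro p a
    have hr' : ∀ x, r (f x) = x := LinearMap.congr_fun hr
    simp only [rcontr, lcontr, LinearMap.comp_apply, hf]
    generalize Coalgebra.comul (R := k) a = z
    induction z with
    | zero => simp
    | add a b ha hb => simp only [map_add, ha.1, hb.1, ha.2, hb.2, and_self]
    | tmul a b => simp [hr']
  intro p c hc
  rw [Submodule.mem_comap, Submodule.mem_comap, (h1 p c).1, (h1 p c).2]
  exact hD _ _ hc

/-- The image of a simple subcoalgebra under an injective coalgebra map. -/
lemma IsSimpleSubcoalgebra.map {A B : Type*} [Ring A] [HopfAlgebra k A] [Ring B] [HopfAlgebra k B]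
    {C : Submodule k A} (hC : IsSimpleSubcoalgebra C) (f : A →ₗ[k] B)
    (hi : Function.Injective f) (hf : ∀ a, Coalgebra.comul (R := k) (f a) =
      TensorProduct.map f f (Coalgebra.comul (R := k) a)) : IsSimpleSubcoalgebra (C.map f) := by
  refine ⟨hC.1.map f hf, fun h => hC.2.1 ?_, fun D hD hDs => ?_⟩
  · exact Submodule.map_injective_of_injective hi (h.trans (Submodule.map_bot f).symm)
  · have h1 : (D.comap f).map f = D := by
      rw [Submodule.map_comap_eq, inf_eq_right]
      exact hD.trans (LinearMap.map_le_range)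
    have h2 : D.comap f ≤ C := by
      rw [← Submodule.comap_map_eq_of_injective hi C]
      exact Submodule.comap_mono hD
    rcases hC.2.2 _ h2 (hDs.comap f hi hf) with h | h
    · left; rw [← h1, h, Submodule.map_bot]
    · right; rw [← h1, h]

/-- Ideals of `T(V) # H` with quotient filtered by degree, with associated graded `𝔅(V) # H`. -/
structure IsLiftingIdeal (J : TwoSidedIdeal (Bos X)) : Prop where
  prod_der_eq_zero : ∀ {d : ℕ} {t : Bos X}, t ∈ J → t ∈ Bos.fil X (d + 1) →
    ∀ {w : List (Fin θ)}, w.length = d → (w.map (Bos.der X)).prod t = 0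
  exists_sub_mem : ∀ {d : ℕ} {t : Bos X}, t ∈ Bos.fil X (d + 1) →
    (∀ w : List (Fin θ), w.length = d → (w.map (Bos.der X)).prod t = 0) →
    ∃ u ∈ J, t - u ∈ Bos.fil X d
  eq_zero : ∀ {t : Bos X}, t ∈ J → t ∈ Bos.fil X 2 → t = 0

lemma Relations.isLiftingIdeal {ι : Type*} {𝒢 : Relations X ι} (γ : 𝒢.Sections) (Λ : ι → k)
    (hΛ : ∀ m ≤ 𝒢.len, cleftIdeal γ Λ m ≠ ⊤) : IsLiftingIdeal (liftingIdeal γ Λ 𝒢.len) := by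
  have hb := isBigalois γ Λ 𝒢.len fun m hm => hΛ m hm.le
  exact ⟨fun ht htd _ hw => prod_der_eq_zero_of_mem hb (hΛ _ le_rfl) le_rfl ht htd hw,
    fun htd hw => exists_sub_mem_fil
      (fun r => exists_mem_liftingIdeal γ Λ (fun m hm => hΛ m hm.le) r) htd hw,
    fun ht htd => eq_zero_of_mem_fil_two hb (hΛ _ le_rfl) le_rfl ht htd⟩

namespace IsLiftingIdeal

variable {J : TwoSidedIdeal (Bos X)}

lemma ofH_injective (hJ : IsLiftingIdeal J) : Function.Injective ((quot J).comp (Bos.ofH X)) := by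
  refine (injective_iff_map_eq_zero _).mpr fun h hh => ?_
  have : Bos.ofH X h = 0 := hJ.eq_zero (quot_eq_zero.mp hh) (Bos.ofH_mem_fil X h 1)
  rw [← Bos.toH_ofH X h, this, map_zero]

variable [J.asIdeal.IsHopfIdeal k]

lemma comul_quot (t : Bos X) : Coalgebra.comul (R := k) (quot J t) =
    TensorProduct.map (quot J).toLinearMap (quot J).toLinearMap (Coalgebra.comul (R := k) t) := rfl

lemma counit_quot (t : Bos X) :
    Coalgebra.counit (R := k) (quot J t) = Coalgebra.counit (R := k) t := rfl

lemma comul_quot_ofH (h : H) : Coalgebra.comul (R := k) (quot J (Bos.ofH X h)) =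
    TensorProduct.map ((quot J).comp (Bos.ofH X)).toLinearMap ((quot J).comp (Bos.ofH X)).toLinearMap
      (Coalgebra.comul (R := k) h) := by
  rw [comul_quot, Bos.comul_ofH]
  exact map_factor (fun t => rfl) (fun t => rfl) _

/-- The coradical of a lifting is contained in `H`. -/
lemma exists_ofH_of_isSimpleSubcoalgebra {C : Submodule k (Bos X ⧸ J.asIdeal)}
    (hC : IsSimpleSubcoalgebra C) {c : Bos X ⧸ J.asIdeal} (hc : c ∈ C) :
    ∃ h, c = quot J (Bos.ofH X h) := by
  classical
  let F : ℕ → Submodule k (Bos X ⧸ J.asIdeal) := fun n => (Bos.fil X n).map (quot J).toLinearMap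
  -- Let m + 1 be the first filtration step that `C` meets. If m = 0, simplicity puts `C` inside H;
  -- the case m > 0 is impossible.
  have hex : ∃ n, C ⊓ F n ≠ ⊥ := by
    obtain ⟨c, hc, hc0⟩ := Submodule.exists_mem_ne_zero_of_ne_bot hC.2.1
    obtain ⟨t, rfl⟩ := quot_surjective J c
    obtain ⟨n, hn⟩ := Bos.exists_mem_fil X t
    refine ⟨n, (Submodule.ne_bot_iff _).mpr ⟨_, ⟨hc, ⟨t, hn, rfl⟩⟩, hc0⟩⟩
  obtain ⟨m, hm⟩ : ∃ m, Nat.find hex = m + 1 := by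
    refine Nat.exists_eq_succ_of_ne_zero fun h0 => Nat.find_spec hex ?_
    rw [h0]
    simp [F, Bos.fil_zero]
  have h1 : C ⊓ F (m + 1) ≠ ⊥ := hm ▸ Nat.find_spec hex
  have h2 : C ⊓ F m = ⊥ := not_not.mp (Nat.find_min hex (m := m) (by omega))
  rcases Nat.eq_zero_or_pos m with rfl | hm0
  · have h3 : F 1 = (⊤ : Submodule k H).map ((quot J).comp (Bos.ofH X)).toLinearMap := by
      ext y
      constructor
      · rintro ⟨t, ht, rfl⟩
        obtain ⟨h, rfl⟩ := Bos.mem_fil_one X ht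
        exact ⟨h, trivial, rfl⟩
      · rintro ⟨h, -, rfl⟩
        exact ⟨_, Bos.ofH_mem_fil X h 0, rfl⟩
    have h4 : IsSubcoalgebra (F 1) := h3 ▸ isSubcoalgebra_top.map _ comul_quot_ofH
    rcases hC.2.2 _ inf_le_left (hC.1.inf h4) with h5 | h5
    · exact absurd h5 h1
    · have h6 : c ∈ F 1 := (h5.symm ▸ hc : c ∈ C ⊓ F 1).2
      rw [h3] at h6
      obtain ⟨h, -, rfl⟩ := h6
      exact ⟨h, rfl⟩
  · exfalso
    obtain ⟨c, ⟨hc, t, ht, hct⟩, hc0⟩ := Submodule.exists_mem_ne_zero_of_ne_bot h1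
    -- As `C` meets `F m` trivially, some linear `e` is the identity on `C` and zero on `F m`. Then
    -- e ⊗ e fixes Δ(c), which lies in C ⊗ C, and kills it, since for m > 0 every term of Δ(c) has a
    -- factor of degree less than m. So c = 0.
    obtain ⟨r, hr⟩ := LinearMap.exists_leftInverse_of_injective ((F m).mkQ ∘ₗ C.subtype)
      (LinearMap.ker_eq_bot'.mpr fun x hx => by
        have h3 : (x : Bos X ⧸ J.asIdeal) ∈ C ⊓ F m :=
          ⟨x.2, (Submodule.Quotient.mk_eq_zero _).mp hx⟩
        rw [h2, Submodule.mem_bot] at h3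
        exact Subtype.ext h3)
    let e := C.subtype ∘ₗ r ∘ₗ (F m).mkQ
    have heC : ∀ x : C, e x = x := fun x => congrArg Subtype.val (LinearMap.congr_fun hr x)
    have heF : ∀ x ∈ F m, e x = 0 := fun x hx => by
      have : (F m).mkQ x = 0 := (Submodule.Quotient.mk_eq_zero _).mpr hx
      simp only [e, LinearMap.comp_apply, this, map_zero]
    have h3 : TensorProduct.map e e (Coalgebra.comul (R := k) c) = Coalgebra.comul (R := k) c := by
      obtain ⟨z, hz⟩ := hC.1 c hc
      rw [← hz]
      exact map_factor heC heC z
    have h4 : TensorProduct.map e e (Coalgebra.comul (R := k) c) = 0 := by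
      rw [← hct]
      change TensorProduct.map e e (Coalgebra.comul (R := k) (quot J t)) = 0
      rw [comul_quot, map_factor (f := e ∘ₗ (quot J).toLinearMap) (h := e ∘ₗ (quot J).toLinearMap)
        (fun t => rfl) (fun t => rfl), ← Submodule.mem_bot (R := k)]
      refine Bos.map_mem_of_mem_fil₂ X (fun i j hij a ha b hb => ?_) (Bos.comul_mem_fil₂ X ht)
      rw [Submodule.mem_bot, TensorProduct.map_tmul]
      by_cases him : i < m
      · have : (e ∘ₗ (quot J).toLinearMap) a = 0 := heF _ ⟨a, Bos.fil_mono X (by omega) ha, rfl⟩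
        rw [this, TensorProduct.zero_tmul]
      · have : (e ∘ₗ (quot J).toLinearMap) b = 0 := heF _ ⟨b, Bos.fil_mono X (by omega) hb, rfl⟩
        rw [this, TensorProduct.tmul_zero]
    have h5 := Coalgebra.rTensor_counit_comul (R := k) c
    rw [← h3, h4, map_zero] at h5
    have h6 := congrArg (TensorProduct.lid k _) h5
    simp at h6
    exact hc0 h6.symm

/-- Skew-primitive elements of a lifting have degree at most one. -/
lemma exists_mem_fil_two (hJ : IsLiftingIdeal J) {g : H} {b : Bos X ⧸ J.asIdeal} (hb : Coalgebra.comul (R := k) b =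
    b ⊗ₜ 1 + quot J (Bos.ofH X g) ⊗ₜ b) : ∃ t ∈ Bos.fil X 2, quot J t = b := by
  have key : ∀ n, (∃ t ∈ Bos.fil X (n + 2), quot J t = b) → ∃ t ∈ Bos.fil X 2, quot J t = b := by
    intro n
    induction n with
    | zero => exact id
    | succ n ih =>
      rintro ⟨t, ht, rfl⟩
      apply ih
      suffices h : ∀ w : List (Fin θ), w.length = n + 2 → (w.map (Bos.der X)).prod t = 0 by
        obtain ⟨u, hu, htu⟩ := hJ.exists_sub_mem ht h
        exact ⟨_, htu, quot_eq_quot.mpr (by simpa using J.neg_mem hu)⟩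
      intro w hw
      obtain ⟨i, v, rfl⟩ : ∃ i v, w = i :: v := by
        cases w with
        | nil => simp at hw
        | cons i v => exact ⟨i, v, rfl⟩
      have hv : v.length = n + 1 := by simpa using hw
      set D := (v.map (Bos.der X)).prod with hD
      -- The derivative is split as ∂_i D. `E₁` computes ∂_i in degree at most one and kills H; `E₂`
      -- computes `D` in degree at most n + 1 and kills 1. So E₁ ⊗ E₂ annihilates b ⊗ 1 + g ⊗ b,
      -- while on Δ(t) it agrees with ∂_i ⊗ D.
      obtain ⟨E₁, hE₁⟩ := exists_factor_on (quot J).toLinearMap (Bos.fil X 2)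
        ((Bos.toH X).toLinearMap ∘ₗ Bos.der X i) fun s hs hsJ => by
          have := hJ.prod_der_eq_zero (quot_eq_zero.mp hsJ) hs (w := [i]) rfl
          simp only [List.map_cons, List.map_nil, List.prod_singleton] at this
          simp [this]
      obtain ⟨E₂, hE₂⟩ := exists_factor_on (quot J).toLinearMap (Bos.fil X (n + 2))
        ((Bos.toH X).toLinearMap ∘ₗ D) fun s hs hsJ => by
          simp [hD, hJ.prod_der_eq_zero (quot_eq_zero.mp hsJ) hs hv]
      have hi0 : ∀ s ∈ Bos.fil X 1, Bos.der X i s = 0 := fun s hs => by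
        obtain ⟨h, rfl⟩ := Bos.mem_fil_one X hs
        exact Bos.der_ofH X i h
      have hD0 : ∀ s ∈ Bos.fil X (n + 1), D s = 0 := fun s hs =>
        Bos.prod_der_eq_zero X v (by omega) hs
      have h1 : TensorProduct.map (E₁ ∘ₗ (quot J).toLinearMap) (E₂ ∘ₗ (quot J).toLinearMap)
          (Coalgebra.comul (R := k) t) = TensorProduct.map ((Bos.toH X).toLinearMap ∘ₗ Bos.der X i)
          ((Bos.toH X).toLinearMap ∘ₗ D) (Coalgebra.comul (R := k) t) := by
        rw [← sub_eq_zero, ← LinearMap.sub_apply, ← Submodule.mem_bot (R := k)]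
        refine Bos.map_mem_of_mem_fil₂ X (fun p q hpq a ha b hb => ?_) (Bos.comul_mem_fil₂ X ht)
        rw [Submodule.mem_bot, LinearMap.sub_apply, TensorProduct.map_tmul, TensorProduct.map_tmul,
          LinearMap.comp_apply E₁, LinearMap.comp_apply E₂]
        -- Only p = 1 contributes: for p = 0 the first factor dies, for p ≥ 2 the second.
        rcases Nat.lt_or_ge p 2 with hp | hp
        · rw [hE₁ a (Bos.fil_mono X (by omega) ha)]
          rcases Nat.eq_zero_or_pos p with rfl | hp0
          · simp [hi0 a ha]
          · rw [hE₂ b (Bos.fil_mono X (by omega) hb), sub_self]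
        · have hb' := Bos.fil_mono X (show q + 1 ≤ n + 1 by omega) hb
          rw [hE₂ b (Bos.fil_mono X (by omega) hb')]
          simp [hD0 b hb']
      have h2 := congrArg (TensorProduct.map E₁ E₂) hb
      rw [comul_quot, map_factor (f := E₁ ∘ₗ (quot J).toLinearMap)
        (h := E₂ ∘ₗ (quot J).toLinearMap) (fun t => rfl) (fun t => rfl), h1, map_add,
        TensorProduct.map_tmul, TensorProduct.map_tmul] at h2
      have h3 : E₂ 1 = 0 := by
        have h4 := hE₂ 1 (by rw [← map_one (Bos.ofH X)]; exact Bos.ofH_mem_fil X 1 _)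
        have h5 := hD0 1 (by rw [← map_one (Bos.ofH X)]; exact Bos.ofH_mem_fil X 1 _)
        simpa [h5] using h4
      have h4 : E₁ (quot J (Bos.ofH X g)) = 0 := by
        have h4 := hE₁ _ (Bos.ofH_mem_fil X g 1)
        simpa using h4
      rw [h3, h4, TensorProduct.tmul_zero, TensorProduct.zero_tmul, add_zero] at h2
      have h5 := congrArg (fun z => TensorProduct.rid k H (LinearMap.lTensor H
        Coalgebra.counit z)) h2
      have h6 : ∀ z : Bos X ⊗[k] Bos X, TensorProduct.rid k H (LinearMap.lTensor H Coalgebra.counit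
          (TensorProduct.map ((Bos.toH X).toLinearMap ∘ₗ Bos.der X i)
            ((Bos.toH X).toLinearMap ∘ₗ D) z)) = Bos.toH X (Bos.der X i (TensorProduct.rid k (Bos X)
          (LinearMap.lTensor (Bos X) (Coalgebra.counit ∘ₗ D) z))) := by
        intro z
        induction z with
        | zero => simp
        | add a b ha hb => simp only [map_add, ha, hb]
        | tmul a b => simp [Bos.counit_toH]
      simp only [h6, map_zero] at h5
      have h7 : Bos.toH X (((i :: v).map (Bos.der X)).prod t) = 0 := by
        rw [List.map_cons, List.prod_cons, Module.End.mul_apply, ← hD, hD, Bos.prod_der_eq]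
        exact h5
      have h8 := Bos.prod_der_mem_fil X (i :: v) ht
      rw [show n + 1 + 2 - (i :: v).length = 1 by rw [hw]; omega] at h8
      obtain ⟨h, hh⟩ := Bos.mem_fil_one X h8
      rw [hh, Bos.toH_ofH] at h7
      rw [hh, h7, map_zero]
  obtain ⟨t, rfl⟩ := quot_surjective J b
  obtain ⟨n, hn⟩ := Bos.exists_mem_fil X t
  exact key n ⟨t, Bos.fil_mono X (by omega) hn, rfl⟩

end IsLiftingIdeal

end Coradical

/-! ### Finite-dimensionality excludes q_ii = 1 -/

section Finite

variable {k : Type*} [Field k] [CharZero k] {θ : ℕ} {q : Fin θ → Fin θ → k}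

/-- The powers of `x_i` are linearly independent in the Nichols algebra if `q_{ii} = 1`. -/
lemma ne_one_of_finite (hfin : Module.Finite k (FreeAlgebra k (Fin θ) ⧸ nicholsIdeal q))
    (i : Fin θ) : q i i ≠ 1 := by
  intro hq
  have h1 : ∀ n, diagAct q i (FreeAlgebra.ι k i ^ n) = FreeAlgebra.ι k i ^ n := by
    intro n
    induction n with
    | zero => simpa using diagAct_algebraMap q i 1
    | succ n ih => rw [pow_succ, diagAct_mul, ih, diagAct_ι, hq, one_smul]
  -- For q_ii = 1 the skew derivation acts on powers of x_i as the ordinary derivative. In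
  -- characteristic zero, the constant term of ∂_i^m / m! is then a family of functionals dual to
  -- these powers.
  have h2 : ∀ n : ℕ, skewDer q i (FreeAlgebra.ι k i ^ (n + 1)) =
      ((n : k) + 1) • FreeAlgebra.ι k i ^ n := by
    intro n
    induction n with
    | zero => simp
    | succ n ih =>
      rw [pow_succ', skewDer_mul, ih, h1, skewDer_ι, if_pos rfl, one_mul, mul_smul_comm, ← pow_succ']
      push_cast
      rw [add_smul ((n : k) + 1), one_smul]
  have h3 : ∀ n m, m ≤ n → ((skewDer q i) ^ m) (FreeAlgebra.ι k i ^ n) =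
      (n.descFactorial m : k) • FreeAlgebra.ι k i ^ (n - m) := by
    intro n m
    induction m with
    | zero => simp
    | succ m ih =>
      intro hm
      rw [pow_succ', Module.End.mul_apply, ih (by omega), map_smul,
        show n - m = n - (m + 1) + 1 by omega, h2, smul_smul, Nat.descFactorial_succ]
      congr 1
      rw [show n - m = n - (m + 1) + 1 by omega]
      push_cast
      ring
  let f : ℕ → Module.Dual k (FreeAlgebra k (Fin θ) ⧸ nicholsIdeal q) := fun m =>
    (nicholsIdeal q).liftQ ((m.factorial : k)⁻¹ •
      (FreeAlgebra.algebraMapInv.toLinearMap ∘ₗ (skewDer q i) ^ m)) fun v hv => by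
        have := (mem_nicholsIdeal q).mp hv (List.replicate m i)
        simp only [List.map_replicate, List.prod_replicate] at this
        simp [this]
  have h4 : ∀ m n, f m ((nicholsIdeal q).mkQ (FreeAlgebra.ι k i ^ n)) = if m = n then 1 else 0 := by
    intro m n
    simp only [f, Submodule.mkQ_apply, Submodule.liftQ_apply, LinearMap.smul_apply,
      LinearMap.comp_apply, AlgHom.toLinearMap_apply]
    rcases Nat.lt_or_ge n m with h | h
    · obtain ⟨d, rfl⟩ : ∃ d, m = d + 1 + n := ⟨m - n - 1, by omega⟩
      rw [pow_add, Module.End.mul_apply, h3 n n le_rfl, if_neg (by omega), pow_succ,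
        Module.End.mul_apply]
      simp
    · rw [h3 n m h]
      rcases h.eq_or_lt with rfl | h
      · simp [Nat.descFactorial_self, Nat.factorial_ne_zero]
      · rw [if_neg (by omega), show n - m = n - m - 1 + 1 by omega]
        simp [FreeAlgebra.algebraMapInv]
  have h5 : LinearIndependent k fun n => (nicholsIdeal q).mkQ (FreeAlgebra.ι k i ^ n) := by
    refine LinearIndependent.of_pairwise_dual_eq_zero_one _ f (fun m n hmn => ?_) fun n => ?_
    · exact (h4 m n).trans (if_neg hmn)
    · exact (h4 n n).trans (if_pos rfl)
  exact not_finite_iff_infinite.mpr inferInstance h5.finite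

end Finite

/-! ### Skew-primitive elements with a character -/

section SkewPrimitive

variable {k : Type*} [Field k] {H : Type*} [Ring H] [HopfAlgebra k H] {θ : ℕ}
  {X : Fin θ → YDPair k H}

lemma Bos.exists_eq_of_mem_fil_two {t : Bos X} (ht : t ∈ Bos.fil X 2) :
    ∃ (h₀ : H) (h : Fin θ → H), t = Bos.ofH X h₀ + ∑ i, Bos.x X i * Bos.ofH X (h i) := by
  induction ht using Submodule.span_induction with
  | mem t ht =>
    obtain ⟨v, hv, a, rfl⟩ := ht
    obtain ⟨v₁, hv₁, v₀, hv₀, rfl⟩ := Submodule.mem_sup.mp (wordsLT_succ 1 hv)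
    obtain ⟨c, rfl⟩ := mem_wordsEq_one hv₁
    have hv₀' := wordsLT_succ 0 hv₀
    rw [wordsLT_zero, sup_bot_eq] at hv₀'
    obtain ⟨d, rfl⟩ := mem_wordsEq_zero hv₀'
    refine ⟨d • a, fun i => c i • a, ?_⟩
    simp only [map_add, map_sum, map_smul, Bos.ofV_ι, AlgHom.commutes, add_mul, Finset.sum_mul,
      smul_mul_assoc, mul_smul_comm, ← Algebra.smul_def]
    rw [add_comm]
  | zero => exact ⟨0, 0, by simp⟩
  | add a b _ _ ha hb =>
    obtain ⟨a₀, a', rfl⟩ := ha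
    obtain ⟨b₀, b', rfl⟩ := hb
    refine ⟨a₀ + b₀, a' + b', ?_⟩
    simp only [map_add, Pi.add_apply, mul_add, Finset.sum_add_distrib]
    abel
  | smul c a _ ha =>
    obtain ⟨a₀, a', rfl⟩ := ha
    refine ⟨c • a₀, c • a', ?_⟩
    simp only [map_smul, Pi.smul_apply, mul_smul_comm, Finset.smul_sum, smul_add]

lemma Bos.lcontr_coord_ofH (i : Fin θ) (h : H) : lcontr (Bos.coord X i) (Bos.ofH X h) = 0 := by
  simp only [lcontr, LinearMap.comp_apply, Bos.comul_ofH]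
  generalize Coalgebra.comul (R := k) h = w
  induction w with
  | zero => simp
  | add a b ha hb => simp only [map_add, ha, hb, add_zero]
  | tmul c d => simp [Bos.ofHH]

/-- Contraction on the left reads off coefficients: from a sum of x_j h_j it extracts h_i. -/
lemma Bos.lcontr_coord_x_mul (i j : Fin θ) (h : H) : lcontr (Bos.coord X i)
    (Bos.x X j * Bos.ofH X h) = if i = j then Bos.ofH X h else 0 := by
  have h1 : ∀ w : H ⊗[k] H, TensorProduct.lid k (Bos X) (LinearMap.rTensor (Bos X) (Bos.coord X i)
      ((Bos.x X j ⊗ₜ 1 + Bos.ofH X (X j).g ⊗ₜ Bos.x X j) * Bos.ofHH X w)) =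
      if i = j then Bos.ofH X (TensorProduct.lid k H (LinearMap.rTensor H Coalgebra.counit w))
        else 0 := by
    intro w
    induction w with
    | zero => simp
    | add a b ha hb => simp only [mul_add, map_add, ha, hb]; split_ifs <;> simp
    | tmul c d =>
      simp only [Bos.ofHH, Algebra.TensorProduct.map_tmul, add_mul,
        Algebra.TensorProduct.tmul_mul_tmul, one_mul, map_add, LinearMap.rTensor_tmul,
        TensorProduct.lid_tmul, Bos.coord_mul, Bos.coord_ofH, Bos.char_x, Bos.coord_x,
        Bos.counit_ofH]
      split_ifs <;> simp
  have h2 := h1 (Coalgebra.comul (R := k) h)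
  rw [Coalgebra.rTensor_counit_comul] at h2
  simp only [lcontr, LinearMap.comp_apply, Bialgebra.comul_mul, Bos.comul_x, Bos.comul_ofH]
  simpa using h2

lemma Bos.ofH_injective : Function.Injective (Bos.ofH X) :=
  Function.LeftInverse.injective (Bos.toH_ofH X)

variable {J : TwoSidedIdeal (Bos X)} [J.asIdeal.IsHopfIdeal k]

namespace IsLiftingIdeal

/-- The projection is injective in degree at most one, and all factors occurring in Δ(t) have such
degree, so the skew-primitive identity lifts to T(V) # H. -/
lemma exists_comul_eq (hJ : IsLiftingIdeal J) {g : H} {b : Bos X ⧸ J.asIdeal}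
    (hb : Coalgebra.comul (R := k) b = b ⊗ₜ 1 + quot J (Bos.ofH X g) ⊗ₜ b) :
    ∃ t ∈ Bos.fil X 2, quot J t = b ∧
      Coalgebra.comul (R := k) t = t ⊗ₜ 1 + Bos.ofH X g ⊗ₜ t := by
  obtain ⟨t, ht, rfl⟩ := hJ.exists_mem_fil_two hb
  obtain ⟨p, hp⟩ := exists_factor_on (quot J).toLinearMap (Bos.fil X 2) LinearMap.id
    fun s hs hsJ => hJ.eq_zero (quot_eq_zero.mp hsJ) hs
  have h1 : TensorProduct.map (p ∘ₗ (quot J).toLinearMap) (p ∘ₗ (quot J).toLinearMap)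
      (Coalgebra.comul (R := k) t) = Coalgebra.comul (R := k) t := by
    rw [← sub_eq_zero]
    change (TensorProduct.map (p ∘ₗ (quot J).toLinearMap) (p ∘ₗ (quot J).toLinearMap) -
      LinearMap.id : _ →ₗ[k] _) (Coalgebra.comul (R := k) t) = 0
    rw [← Submodule.mem_bot (R := k)]
    refine Bos.map_mem_of_mem_fil₂ X (fun i j hij a ha b hb => ?_) (Bos.comul_mem_fil₂ X ht)
    rw [Submodule.mem_bot, LinearMap.sub_apply, TensorProduct.map_tmul, LinearMap.comp_apply,
      LinearMap.comp_apply, hp a (Bos.fil_mono X (by omega) ha),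
      hp b (Bos.fil_mono X (by omega) hb)]
    simp
  refine ⟨t, ht, rfl, ?_⟩
  have h2 := congrArg (TensorProduct.map p p) hb
  rw [comul_quot, map_factor (f := p ∘ₗ (quot J).toLinearMap)
    (h := p ∘ₗ (quot J).toLinearMap) (fun t => rfl) (fun t => rfl), h1] at h2
  have h3 : p 1 = 1 := by
    have := hp 1 (by rw [← map_one (Bos.ofH X)]; exact Bos.ofH_mem_fil X 1 _)
    simpa using this
  have h4 : p (quot J (Bos.ofH X g)) = Bos.ofH X g := hp _ (Bos.ofH_mem_fil X g 1)
  have h5 : p (quot J t) = t := hp _ ht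
  rw [h2, map_add, TensorProduct.map_tmul, TensorProduct.map_tmul, h3, h4, h5]

/-- A skew-primitive element of a lifting that transforms by a character of `H` is a combination of
the generators `a_i`. -/
lemma exists_eq_sum (hJ : IsLiftingIdeal J) (hH : IsCosemisimple k H) (y : YDPair k H)
    (hy : y.χ y.g ≠ 1) {b : Bos X ⧸ J.asIdeal}
    (hb : Coalgebra.comul (R := k) b = b ⊗ₜ 1 + quot J (Bos.ofH X y.g) ⊗ₜ b)
    (hw : ∀ h, quot J (Bos.ofH X h) * b = b * quot J (Bos.ofH X (leftTwist y.χ h))) :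
    ∃ c : Fin θ → k, b = ∑ i, c i • quot J (Bos.x X i) ∧
      ∀ i, c i ≠ 0 → (X i).g = y.g ∧ (X i).χ = y.χ := by
  obtain ⟨t, ht, rfl, hΔ⟩ := hJ.exists_comul_eq hb
  have hw' : ∀ h, Bos.ofH X h * t = t * Bos.ofH X (leftTwist y.χ h) := by
    intro h
    rw [← sub_eq_zero]
    refine hJ.eq_zero ?_ (sub_mem (Bos.ofH_mul_mem_fil X h ht) (Bos.mul_ofH_mem_fil X ht _))
    rw [← quot_eq_zero, map_sub, map_mul, map_mul, hw, sub_self]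
  obtain ⟨h₀, a, hta⟩ := Bos.exists_eq_of_mem_fil_two ht
  have h1 : ∀ i, lcontr (Bos.coord X i) t = Bos.ofH X (a i) := by
    intro i
    rw [hta, map_add, map_sum, Bos.lcontr_coord_ofH, zero_add]
    simp [Bos.lcontr_coord_x_mul]
  -- Contracting t ⊗ 1 + g ⊗ t on the left leaves a multiple of 1, so the coefficients are scalars.
  -- Contraction on the right then gives g_i = g.
  have h2 : ∀ i, a i = Bos.coord X i t • 1 := by
    intro i
    apply Bos.ofH_injective (X := X)
    rw [← h1 i]
    simp [lcontr, hΔ]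
  have h3 : t = Bos.ofH X h₀ + ∑ i, Bos.coord X i t • Bos.x X i := by
    conv_lhs => rw [hta]
    simp only [h2, map_smul, map_one, mul_smul_comm, mul_one]
  have h4 : ∀ i, Bos.coord X i t ≠ 0 → (X i).g = y.g := by
    intro i hi
    have h5 : Bos.der X i t = Bos.coord X i t • Bos.ofH X y.g := by
      have : Bos.coord X i 1 = 0 := by rw [← map_one (Bos.ofH X), Bos.coord_ofH]
      simp [Bos.der, rcontr, hΔ, this]
    have h6 : Bos.der X i t = Bos.coord X i t • Bos.ofH X (X i).g := by
      conv_lhs => rw [h3]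
      simp
    rw [h5] at h6
    exact (Bos.ofH_injective (smul_right_injective _ hi h6)).symm
  -- The functional ξ_i dual to x_i takes h t to χ_i(h) ξ_i(t) and t χ(h₁) h₂ to ξ_i(t) χ(h).
  have h5 : ∀ i, Bos.coord X i t ≠ 0 → (X i).χ = y.χ := by
    intro i hi
    ext h
    have := congrArg (Bos.coord X i) (hw' h)
    rw [Bos.coord_mul, Bos.coord_mul, Bos.coord_ofH, Bos.coord_ofH, zero_mul, mul_zero, add_zero,
      zero_add, Bos.char_ofH, Bos.counit_ofH, counit_leftTwist, mul_comm] at this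
    exact mul_left_cancel₀ hi this
  have h6 : Bos.toH X t = h₀ := by
    rw [h3]
    simp
  obtain ⟨c, hc⟩ := exists_eq_smul_of_isCosemisimple hH (g := y.g) (h := h₀) (by
    rw [← h6, Bos.comul_toH, hΔ]
    simp)
  -- The part of degree zero is c (1 - g), which commutes with g. It also has weight χ, and χ(g) ≠
  -- 1, so it vanishes.
  have h7 : h₀ = 0 := by
    have h8 := congrArg (Bos.toH X) (hw' y.g)
    rw [map_mul, map_mul, Bos.toH_ofH, Bos.toH_ofH, h6, leftTwist_groupLike _ y.isGroupLike, hc,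
      mul_smul_comm, smul_mul_smul_comm, mul_sub, sub_mul, one_mul, mul_one, mul_comm c,
      mul_smul] at h8
    have h9 : (1 - y.χ y.g) • (c • (y.g - y.g * y.g)) = 0 := by
      rw [sub_smul, one_smul, ← h8, sub_self]
    have h10 := (smul_eq_zero.mp h9).resolve_left (sub_ne_zero.mpr hy.symm)
    rw [hc]
    apply (y.isGroupLike.isUnit).mul_left_cancel
    rw [mul_smul_comm, mul_sub, mul_one, h10, mul_zero]
  refine ⟨fun i => Bos.coord X i t, ?_, fun i hi => ⟨h4 i hi, h5 i hi⟩⟩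
  conv_lhs => rw [h3, h7]
  simp

omit [J.asIdeal.IsHopfIdeal k] in
lemma coeff_eq_zero (hJ : IsLiftingIdeal J) {c : Fin θ → k}
    (h : ∑ i, c i • quot J (Bos.x X i) = 0) (i : Fin θ) : c i = 0 := by
  have h1 : ∑ i, c i • Bos.x X i = 0 := by
    refine hJ.eq_zero ?_ (sum_mem fun i _ => Submodule.smul_mem _ _ ?_)
    · rw [← quot_eq_zero, map_sum]
      simpa using h
    · rw [← Bos.ofV_ι]
      exact Bos.ofV_mem_fil X (Submodule.subset_span ⟨[i], by simp, by simp⟩)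
  simpa using congrArg (Bos.coord X i) h1

end IsLiftingIdeal

end SkewPrimitive

/-! ### Functoriality of the bosonization -/

section Functoriality

variable {k : Type*} [Field k]

/-- f ∘ S and S ∘ f are a left and a right convolution inverse of f. -/
lemma BialgHom.map_antipode {A B : Type*} [Ring A] [HopfAlgebra k A] [Ring B] [HopfAlgebra k B]
    (f : A →ₐc[k] B) (a : A) :
    f (HopfAlgebra.antipode k a) = HopfAlgebra.antipode k (f a) := by
  have h1 : WithConv.toConv ((f : A →ₐ[k] B).toLinearMap ∘ₗ HopfAlgebra.antipode k) *
      WithConv.toConv (f : A →ₐ[k] B).toLinearMap = 1 := by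
    apply WithConv.ofConv_injective
    calc _ = (f : A →ₐ[k] B).toLinearMap ∘ₗ
          (WithConv.toConv (HopfAlgebra.antipode k) * WithConv.toConv LinearMap.id :
            WithConv (A →ₗ[k] A)).ofConv := by
          rw [LinearMap.algHom_comp_convMul_distrib]; rfl
      _ = _ := by rw [LinearMap.antipode_mul_id, LinearMap.algHom_comp_convOne]
  have h2 : WithConv.toConv (f : A →ₐ[k] B).toLinearMap *
      WithConv.toConv (HopfAlgebra.antipode k ∘ₗ (f : A →ₐ[k] B).toLinearMap) = 1 := by
    apply WithConv.ofConv_injective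
    calc _ = (WithConv.toConv LinearMap.id * WithConv.toConv (HopfAlgebra.antipode k) :
            WithConv (B →ₗ[k] B)).ofConv ∘ₗ f.toCoalgHom.toLinearMap := by
          rw [LinearMap.convMul_comp_coalgHom_distrib]; rfl
      _ = _ := by rw [LinearMap.id_mul_antipode, LinearMap.convOne_comp_coalgHom]
  exact LinearMap.congr_fun (congrArg WithConv.ofConv (left_inv_eq_right_inv h1 h2)) a

lemma BialgHom.map_comul {A B : Type*} [Ring A] [HopfAlgebra k A] [Ring B] [HopfAlgebra k B]
    (f : A →ₐc[k] B) (a : A) : Coalgebra.comul (R := k) (f a) =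
      TensorProduct.map (f : A →ₐ[k] B).toLinearMap (f : A →ₐ[k] B).toLinearMap
        (Coalgebra.comul (R := k) a) :=
  (CoalgHomClass.map_comp_comul_apply f a).symm

variable {H H' : Type*} [Ring H] [HopfAlgebra k H] [Ring H'] [HopfAlgebra k H'] {θ θ' : ℕ}
  {X : Fin θ → YDPair k H} {X' : Fin θ' → YDPair k H'}

lemma leftTwist_map (f : H' →ₐc[k] H) (χ : H →ₐ[k] k) (h : H') :
    leftTwist χ (f h) = f (leftTwist (χ.comp (f : H' →ₐ[k] H)) h) := by
  simp only [leftTwist, LinearMap.comp_apply, BialgHom.map_comul]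
  generalize Coalgebra.comul (R := k) h = w
  induction w with
  | zero => simp
  | add a b ha hb => simp only [map_add, ha, hb]
  | tmul c d => simp

lemma rcontr_map (f : H' →ₐc[k] H) (p : H →ₗ[k] k) (h : H') :
    rcontr p (f h) = f (rcontr (p ∘ₗ (f : H' →ₐ[k] H).toLinearMap) h) := by
  simp only [rcontr, LinearMap.comp_apply, BialgHom.map_comul]
  generalize Coalgebra.comul (R := k) h = w
  induction w with
  | zero => simp
  | add a b ha hb => simp only [map_add, ha, hb]
  | tmul c d => simp

section Comap

variable (F : Bos X' →ₐc[k] Bos X)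

/-- The preimage of an ideal. -/
abbrev comapIdeal (I : TwoSidedIdeal (Bos X)) : TwoSidedIdeal (Bos X') := I.comap F

lemma mem_comapIdeal {I : TwoSidedIdeal (Bos X)} {t : Bos X'} : t ∈ comapIdeal F I ↔ F t ∈ I :=
  TwoSidedIdeal.mem_comap F

/-- Over a field, tensor products of the injections `e` remain injective. So the conditions in
`IsBigalois` pass to preimages under any bialgebra map. -/
lemma exists_quot_comap (I : TwoSidedIdeal (Bos X)) :
    ∃ e : (Bos X' ⧸ (comapIdeal F I).asIdeal) →ₗ[k] (Bos X ⧸ I.asIdeal), Function.Injective e ∧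
      ∀ t, e (quot _ t) = quot I (F t) := by
  obtain ⟨e, he⟩ := exists_factor (p := (quot (comapIdeal F I)).toLinearMap) (quot_surjective _)
    ((quot I).toLinearMap ∘ₗ (F : Bos X' →ₐ[k] Bos X).toLinearMap)
    fun t ht => quot_eq_zero.mpr ((mem_comapIdeal F).mp (quot_eq_zero.mp ht))
  refine ⟨e, (injective_iff_map_eq_zero e).mpr fun y hy => ?_, he⟩
  obtain ⟨t, rfl⟩ := quot_surjective _ y
  exact quot_eq_zero.mpr ((mem_comapIdeal F).mpr (quot_eq_zero.mp ((he t).symm.trans hy)))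

lemma quotComul_comap (I J : TwoSidedIdeal (Bos X)) (t : Bos X') :
    quotComul (comapIdeal F I) (comapIdeal F J) t = 0 ↔ quotComul I J (F t) = 0 := by
  obtain ⟨e, hei, he⟩ := exists_quot_comap F I
  obtain ⟨f, hfi, hf⟩ := exists_quot_comap F J
  rw [← map_eq_zero_iff _ (TensorProduct.map_injective_of_flat_flat e f hei hfi), quotComul_eq,
    quotComul_eq, coact_eq, coact_eq, BialgHom.map_comul,
    map_factor (f := (quot I).toLinearMap ∘ₗ (F : Bos X' →ₐ[k] Bos X).toLinearMap)
      (h := (quot J).toLinearMap ∘ₗ (F : Bos X' →ₐ[k] Bos X).toLinearMap) he hf,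
    map_factor (f := (quot I).toLinearMap ∘ₗ (F : Bos X' →ₐ[k] Bos X).toLinearMap)
      (h := (quot J).toLinearMap ∘ₗ (F : Bos X' →ₐ[k] Bos X).toLinearMap) (fun _ => rfl)
      (fun _ => rfl)]

lemma transl_comap (I J : TwoSidedIdeal (Bos X)) (t : Bos X') :
    transl (quot (comapIdeal F I)) (quot (comapIdeal F J)) t = 0 ↔
      transl (quot I) (quot J) (F t) = 0 := by
  obtain ⟨e, hei, he⟩ := exists_quot_comap F I
  obtain ⟨f, hfi, hf⟩ := exists_quot_comap F J
  rw [← map_eq_zero_iff _ (TensorProduct.map_injective_of_flat_flat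
    ((MulOpposite.opLinearEquiv k).toLinearMap ∘ₗ e ∘ₗ
      (MulOpposite.opLinearEquiv k).symm.toLinearMap) f
    ((MulOpposite.opLinearEquiv k).injective.comp
      (hei.comp (MulOpposite.opLinearEquiv k).symm.injective)) hfi),
    transl_eq, transl_eq, BialgHom.map_comul]
  let f₁ := (MulOpposite.opLinearEquiv k).toLinearMap ∘ₗ (quot I).toLinearMap ∘ₗ
    HopfAlgebra.antipode k ∘ₗ (F : Bos X' →ₐ[k] Bos X).toLinearMap
  let f₂ := (quot J).toLinearMap ∘ₗ (F : Bos X' →ₐ[k] Bos X).toLinearMap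
  rw [map_factor (f := f₁) (h := f₂) (fun t => ?_) hf,
    map_factor (f := f₁) (h := f₂) (fun _ => rfl) (fun _ => rfl)]
  simp [f₁, he, BialgHom.map_antipode]

lemma cotransl_comap (I J : TwoSidedIdeal (Bos X)) (t : Bos X') :
    cotransl (quot (comapIdeal F I)) (quot (comapIdeal F J)) t = 0 ↔
      cotransl (quot I) (quot J) (F t) = 0 := by
  obtain ⟨e, hei, he⟩ := exists_quot_comap F I
  obtain ⟨f, hfi, hf⟩ := exists_quot_comap F J
  rw [← map_eq_zero_iff _ (TensorProduct.map_injective_of_flat_flat e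
    ((MulOpposite.opLinearEquiv k).toLinearMap ∘ₗ f ∘ₗ
      (MulOpposite.opLinearEquiv k).symm.toLinearMap) hei
    ((MulOpposite.opLinearEquiv k).injective.comp
      (hfi.comp (MulOpposite.opLinearEquiv k).symm.injective))),
    cotransl_eq, cotransl_eq, BialgHom.map_comul]
  let f₁ := (quot I).toLinearMap ∘ₗ (F : Bos X' →ₐ[k] Bos X).toLinearMap
  let f₂ := (MulOpposite.opLinearEquiv k).toLinearMap ∘ₗ (quot J).toLinearMap ∘ₗ
    HopfAlgebra.antipode k ∘ₗ (F : Bos X' →ₐ[k] Bos X).toLinearMap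
  rw [map_factor (f := f₁) (h := f₂) he (fun t => ?_),
    map_factor (f := f₁) (h := f₂) (fun _ => rfl) (fun _ => rfl)]
  simp [f₂, hf, BialgHom.map_antipode]

lemma IsBigalois.comap {I K J : TwoSidedIdeal (Bos X)} (h : IsBigalois I K J) :
    IsBigalois (comapIdeal F I) (comapIdeal F K) (comapIdeal F J) where
  rho t ht := (quotComul_comap F I K t).mpr (h.rho _ ((mem_comapIdeal F).mp ht))
  tra t ht := (transl_comap F I I t).mpr (h.tra _ ((mem_comapIdeal F).mp ht))
  del t ht := (quotComul_comap F J I t).mpr (h.del _ ((mem_comapIdeal F).mp ht))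
  cot t ht := (cotransl_comap F I I t).mpr (h.cot _ ((mem_comapIdeal F).mp ht))
  comul t ht := (quotComul_comap F J J t).mpr (h.comul _ ((mem_comapIdeal F).mp ht))
  counit t ht := (CoalgHomClass.counit_comp_apply F t).symm.trans
    (h.counit _ ((mem_comapIdeal F).mp ht))
  antipode t ht := (mem_comapIdeal F).mpr (by
    rw [BialgHom.map_antipode]
    exact h.antipode _ ((mem_comapIdeal F).mp ht))

lemma comapIdeal_ne_top {I : TwoSidedIdeal (Bos X)} (hI : I ≠ ⊤) : comapIdeal F I ≠ ⊤ := by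
  intro h
  have h1 : (1 : Bos X') ∈ comapIdeal F I := h ▸ TwoSidedIdeal.mem_top _
  rw [mem_comapIdeal, map_one] at h1
  exact hI (TwoSidedIdeal.one_mem_iff _ |>.mp h1)

end Comap

/-- A bialgebra map `H' → H` together with a compatible linear map `V' → V`. -/
structure BosHomData (X' : Fin θ' → YDPair k H') (X : Fin θ → YDPair k H) where
  f : H' →ₐc[k] H
  M : Matrix (Fin θ') (Fin θ) k
  compat : ∀ i j, M i j ≠ 0 → f (X' i).g = (X j).g ∧ ∀ h, (X j).χ (f h) = (X' i).χ h

namespace BosHomData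

variable (D : BosHomData X' X)

/-- The induced algebra map between the bosonizations. -/
def algHom : Bos X' →ₐ[k] Bos X :=
  Bos.lift ((Bos.ofH X).comp (D.f : H' →ₐ[k] H)) (fun i => ∑ j, D.M i j • Bos.x X j) (by
    intro i h
    rw [Finset.mul_sum, Finset.sum_mul]
    refine Finset.sum_congr rfl fun j _ => ?_
    by_cases hij : D.M i j = 0
    · simp [hij]
    · have h1 : ((X j).χ).comp (D.f : H' →ₐ[k] H) = (X' i).χ :=
        AlgHom.ext (D.compat i j hij).2
      rw [mul_smul_comm, smul_mul_assoc, AlgHom.comp_apply, Bos.ofH_mul_x, ← h1]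
      exact congrArg (fun z => D.M i j • (Bos.x X j * Bos.ofH X z)) (leftTwist_map D.f _ h))

@[simp] lemma algHom_ofH (h : H') : D.algHom (Bos.ofH X' h) = Bos.ofH X (D.f h) :=
  Bos.lift_ofH _ _ _ h

@[simp] lemma algHom_x (i : Fin θ') : D.algHom (Bos.x X' i) = ∑ j, D.M i j • Bos.x X j :=
  Bos.lift_x _ _ _ i

/-- The induced bialgebra map between the bosonizations. -/
def hom : Bos X' →ₐc[k] Bos X :=
  BialgHom.ofAlgHom D.algHom
    (by
      apply Bos.algHom_ext
      · intro h
        simp [Bos.counit_ofH]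
      · intro i
        simp [Bos.counit_x])
    (by
      apply Bos.algHom_ext
      · intro h
        simp only [AlgHom.comp_apply, Bialgebra.comulAlgHom_apply, algHom_ofH, Bos.comul_ofH,
          BialgHom.map_comul]
        generalize Coalgebra.comul (R := k) h = w
        induction w with
        | zero => simp
        | add a b ha hb => simp only [map_add, ha, hb]
        | tmul c d => simp [Bos.ofHH]
      · intro i
        simp only [AlgHom.comp_apply, Bialgebra.comulAlgHom_apply, algHom_x, Bos.comul_x, map_add,
          Algebra.TensorProduct.map_tmul, map_one, algHom_ofH, map_sum, map_smul,
          TensorProduct.sum_tmul, TensorProduct.tmul_sum, ← Finset.sum_add_distrib]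
        refine Finset.sum_congr rfl fun j _ => ?_
        by_cases hij : D.M i j = 0
        · simp [hij]
        · rw [(D.compat i j hij).1, smul_add, TensorProduct.tmul_smul, TensorProduct.smul_tmul',
            TensorProduct.smul_tmul'])

@[simp] lemma hom_ofH (h : H') : D.hom (Bos.ofH X' h) = Bos.ofH X (D.f h) := D.algHom_ofH h

@[simp] lemma hom_x (i : Fin θ') : D.hom (Bos.x X' i) = ∑ j, D.M i j • Bos.x X j := D.algHom_x i

lemma toH_hom (t : Bos X') : Bos.toH X (D.hom t) = D.f (Bos.toH X' t) := by
  have : (Bos.toH X).comp (D.hom : Bos X' →ₐ[k] Bos X) =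
      (D.f : H' →ₐ[k] H).comp (Bos.toH X') := by
    apply Bos.algHom_ext
    · intro h; simp
    · intro i; simp
  exact AlgHom.congr_fun this t

lemma char_hom {i : Fin θ} {j : Fin θ'} (hij : D.M j i ≠ 0) (t : Bos X') :
    Bos.char X i (D.hom t) = Bos.char X' j t := by
  have : (Bos.char X i).comp (D.hom : Bos X' →ₐ[k] Bos X) = Bos.char X' j := by
    apply Bos.algHom_ext
    · intro h; simp [(D.compat j i hij).2]
    · intro i; simp
  exact AlgHom.congr_fun this t

lemma coord_hom (i : Fin θ) (t : Bos X') :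
    Bos.coord X i (D.hom t) = ∑ j, D.M j i * Bos.coord X' j t := by
  induction t using Bos.induction with
  | hH h => simp
  | hx j => simp
  | hadd a b ha hb => simp only [map_add, ha, hb, mul_add, Finset.sum_add_distrib]
  | hmul a b ha hb =>
    rw [map_mul, Bos.coord_mul, ha, hb, Finset.mul_sum, Finset.sum_mul, ← Finset.sum_add_distrib]
    refine Finset.sum_congr rfl fun j _ => ?_
    by_cases hij : D.M j i = 0
    · simp [hij]
    · rw [D.char_hom hij, Bos.coord_mul, CoalgHomClass.counit_comp_apply]
      ring

/-- A chain rule: the functional dual to x_i pulls back to the combination of dual functionals given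
by column `i` of the matrix. -/
lemma der_hom (i : Fin θ) (t : Bos X') :
    Bos.der X i (D.hom t) = ∑ j, D.M j i • D.hom (Bos.der X' j t) := by
  have h1 : Bos.coord X i ∘ₗ (D.hom : Bos X' →ₐ[k] Bos X).toLinearMap =
      ∑ j, D.M j i • Bos.coord X' j := by
    ext t
    simpa using D.coord_hom i t
  rw [Bos.der, rcontr_map, h1]
  have h2 : ∀ p : Fin θ' → (Bos X' →ₗ[k] k), rcontr (∑ j, D.M j i • p j) t =
      ∑ j, D.M j i • rcontr (p j) t := by
    intro p
    simp only [rcontr, LinearMap.comp_apply]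
    generalize Coalgebra.comul (R := k) t = w
    induction w with
    | zero => simp
    | add a b ha hb => simp only [map_add, ha, hb, smul_add, Finset.sum_add_distrib]
    | tmul c d => simp [Finset.sum_smul, smul_smul]
  rw [h2, map_sum]
  simp [Bos.der]

/-- Membership is tested by skew derivations, which transform by `der_hom`, so the two generating
sets need not correspond. -/
lemma hom_mem_ideal {ι ι' : Type*} {𝒢 : Relations X ι} {𝒢' : Relations X' ι'} {t : Bos X'}
    (ht : t ∈ 𝒢'.ideal 𝒢'.len) : D.hom t ∈ 𝒢.ideal 𝒢.len := by
  rw [Relations.mem_ideal_len_iff] at ht ⊢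
  intro w
  induction w using List.reverseRecOn generalizing t with
  | nil =>
    have := ht []
    simp only [List.map_nil, List.prod_nil, Module.End.one_apply] at this ⊢
    rw [D.toH_hom, this, map_zero]
  | append_singleton w i ih =>
    rw [List.map_append, List.prod_append, Module.End.mul_apply, List.map_singleton,
      List.prod_singleton, D.der_hom, map_sum, map_sum]
    refine Finset.sum_eq_zero fun j _ => ?_
    rw [map_smul, map_smul, ih, smul_zero]
    intro v
    simpa using ht (v ++ [j])

/-- The composite is the identity if the composites of the maps on `H` and `V` are. -/
lemma hom_hom (E : BosHomData X X') (hf : ∀ h, D.f (E.f h) = h) (hM : E.M * D.M = 1) (t : Bos X) :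
    D.hom (E.hom t) = t := by
  have : (D.hom : Bos X' →ₐ[k] Bos X).comp (E.hom : Bos X →ₐ[k] Bos X') = AlgHom.id k _ := by
    apply Bos.algHom_ext
    · intro h; simp [hf]
    · intro i
      simp only [AlgHom.comp_apply, BialgHom.coe_toAlgHom, hom_x, map_sum, map_smul,
        Finset.smul_sum, smul_smul, AlgHom.id_apply]
      rw [Finset.sum_comm]
      simp only [← Finset.sum_smul, ← Matrix.mul_apply, hM, Matrix.one_apply]
      simp
  exact AlgHom.congr_fun this t

lemma comapIdeal_ideal {ι ι' : Type*} (𝒢 : Relations X ι) (𝒢' : Relations X' ι')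
    (E : BosHomData X X') (hf : ∀ h, E.f (D.f h) = h) (hM : D.M * E.M = 1) :
    comapIdeal D.hom (𝒢.ideal 𝒢.len) = 𝒢'.ideal 𝒢'.len := by
  ext t
  rw [mem_comapIdeal]
  refine ⟨fun h => ?_, D.hom_mem_ideal⟩
  rw [← E.hom_hom D hf hM t]
  exact E.hom_mem_ideal h

end BosHomData

end Functoriality

/-! ### Transport of cleft objects and liftings -/

section Transport

open Relations

variable {k : Type*} [Field k] {H H' : Type*} [Ring H] [HopfAlgebra k H] [Ring H']
  [HopfAlgebra k H'] {θ θ' : ℕ} {X : Fin θ → YDPair k H} {X' : Fin θ' → YDPair k H'}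
  {ι ι' : Type*} {𝒢 : Relations X ι} {𝒢' : Relations X' ι'}

lemma BosHomData.hom_surjective (D : BosHomData X' X) (hf : Function.Surjective D.f)
    (N : Matrix (Fin θ) (Fin θ') k) (hN : N * D.M = 1) : Function.Surjective D.hom := by
  intro t
  change t ∈ (D.hom : Bos X' →ₐ[k] Bos X).range
  induction t using Bos.induction with
  | hH h =>
    obtain ⟨h', rfl⟩ := hf h
    exact ⟨Bos.ofH X' h', D.hom_ofH h'⟩
  | hx i =>
    refine ⟨∑ j, N i j • Bos.x X' j, ?_⟩
    rw [map_sum]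
    change ∑ j, D.hom (N i j • Bos.x X' j) = _
    simp only [map_smul, D.hom_x, Finset.smul_sum, smul_smul]
    rw [Finset.sum_comm]
    simp only [← Finset.sum_smul, ← Matrix.mul_apply, hN, Matrix.one_apply]
    simp
  | hadd a b ha hb => exact add_mem ha hb
  | hmul a b ha hb => exact mul_mem ha hb

lemma exists_quotEquiv (F : Bos X' →ₐc[k] Bos X) (hF : Function.Surjective F)
    {I' : TwoSidedIdeal (Bos X')} {I : TwoSidedIdeal (Bos X)} (h : I' = comapIdeal F I) :
    ∃ e : (Bos X' ⧸ I'.asIdeal) ≃ₐ[k] (Bos X ⧸ I.asIdeal), ∀ t, e (quot I' t) = quot I (F t) := by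
  let f : (Bos X' ⧸ I'.asIdeal) →ₐ[k] (Bos X ⧸ I.asIdeal) :=
    Ideal.Quotient.liftₐ I'.asIdeal ((quot I).comp (F : Bos X' →ₐ[k] Bos X)) fun t ht =>
      quot_eq_zero.mpr ((mem_comapIdeal F).mp (h ▸ TwoSidedIdeal.mem_asIdeal.mp ht))
  have hf : ∀ t, f (quot I' t) = quot I (F t) := fun t => Ideal.Quotient.liftₐ_apply _ _ _ _
  refine ⟨AlgEquiv.ofBijective f ⟨(injective_iff_map_eq_zero f).mpr fun y hy => ?_, fun y => ?_⟩,
    hf⟩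
  · obtain ⟨t, rfl⟩ := quot_surjective _ y
    rw [hf, quot_eq_zero] at hy
    rw [quot_eq_zero, h]
    exact (mem_comapIdeal F).mpr hy
  · obtain ⟨t, rfl⟩ := quot_surjective _ y
    obtain ⟨s, rfl⟩ := hF t
    exact ⟨_, hf s⟩

lemma exists_quotBialgEquiv (F : Bos X' →ₐc[k] Bos X) (hF : Function.Surjective F)
    {I' : TwoSidedIdeal (Bos X')} {I : TwoSidedIdeal (Bos X)} [I'.asIdeal.IsHopfIdeal k]
    [I.asIdeal.IsHopfIdeal k] (h : I' = comapIdeal F I) :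
    ∃ e : (Bos X' ⧸ I'.asIdeal) ≃ₐc[k] (Bos X ⧸ I.asIdeal),
      ∀ t, e (quot I' t) = quot I (F t) := by
  obtain ⟨e, he⟩ := exists_quotEquiv F hF h
  refine ⟨BialgEquiv.ofAlgEquiv e ?_ ?_, he⟩
  · ext y
    obtain ⟨t, rfl⟩ := quot_surjective _ y
    change Coalgebra.counit (R := k) (e (quot I' t)) = Coalgebra.counit (R := k) (quot I' t)
    rw [he, IsLiftingIdeal.counit_quot, IsLiftingIdeal.counit_quot,
      CoalgHomClass.counit_comp_apply]
  · ext y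
    obtain ⟨t, rfl⟩ := quot_surjective _ y
    change TensorProduct.map e.toLinearMap e.toLinearMap (Coalgebra.comul (R := k) (quot I' t)) =
      Coalgebra.comul (R := k) (e (quot I' t))
    let f := (quot I).toLinearMap ∘ₗ (F : Bos X' →ₐ[k] Bos X).toLinearMap
    rw [he, IsLiftingIdeal.comul_quot, IsLiftingIdeal.comul_quot, BialgHom.map_comul,
      map_factor (f := f) (h := f) he he,
      map_factor (f := f) (h := f) (fun _ => rfl) (fun _ => rfl)]

lemma ne_top_of_le {I I' : TwoSidedIdeal (Bos X)} (h : I ≤ I') (hI : I' ≠ ⊤) : I ≠ ⊤ :=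
  fun h' => hI (top_le_iff.mp (h' ▸ h))

/-- The lifting is determined by the cleft object. -/
lemma liftingIdeal_eq_comap {γ : 𝒢.Sections} {γ' : 𝒢'.Sections} {Λ : ι → k} {c : ι' → k}
    (F : Bos X' →ₐc[k] Bos X) (hΛ : ∀ m ≤ 𝒢.len, cleftIdeal γ Λ m ≠ ⊤)
    (h : cleftIdeal γ' c 𝒢'.len = comapIdeal F (cleftIdeal γ Λ 𝒢.len)) :
    liftingIdeal γ' c 𝒢'.len = comapIdeal F (liftingIdeal γ Λ 𝒢.len) := by
  have h1 : cleftIdeal γ' c 𝒢'.len ≠ ⊤ := h ▸ comapIdeal_ne_top F (hΛ _ le_rfl)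
  have h2 := isBigalois γ' c 𝒢'.len fun m hm => ne_top_of_le (cleftIdeal_mono γ' c hm.le) h1
  have h3 := (isBigalois γ Λ 𝒢.len fun m hm => hΛ m hm.le).comap F
  ext t
  -- Both ideals are the kernel of t ↦ t₁ ⊗ S(t₂) for the same cleft object.
  rw [h2.mem_iff h1, h3.mem_iff (comapIdeal_ne_top F (hΛ _ le_rfl)), h]

lemma cleftIdeal_congr (γ : 𝒢.Sections) {c d : ι → k} {n : ℕ}
    (h : ∀ r, 𝒢.level r < n → c r = d r) : cleftIdeal γ c n = cleftIdeal γ d n := by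
  induction n with
  | zero => rfl
  | succ n ih =>
    rw [cleftIdeal, cleftIdeal, ih fun r hr => h r (by omega)]
    congr 2
    ext z
    refine exists_congr fun r => and_congr_right fun hr => ?_
    rw [h r (by omega)]

/-- A biGalois object over the graded Hopf algebra is one of the `𝒜(c)`. -/
lemma exists_cleftIdeal_eq (γ : 𝒢.Sections) {I J : TwoSidedIdeal (Bos X)}
    (h : IsBigalois I (𝒢.ideal 𝒢.len) J) (hI : I ≠ ⊤) : ∃ c, cleftIdeal γ c 𝒢.len = I := by
  classical
  -- The parameters are found stratum by stratum. As r vanishes in 𝔅(V) # H, its lift r' becomes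
  -- coinvariant modulo `I`, hence a scalar, and this scalar is the parameter.
  have h1 : ∀ n, ∃ c, cleftIdeal γ c n ≤ I := by
    intro n
    induction n with
    | zero => exact ⟨0, bot_le⟩
    | succ n ih =>
      obtain ⟨c, hc⟩ := ih
      have hb := isBigalois γ c n fun m hm =>
        ne_top_of_le ((cleftIdeal_mono γ c hm.le).trans hc) hI
      have h2 : ∀ r, 𝒢.level r = n → ∃ d : k,
          γ.lift (cleftIdeal γ c n) r - algebraMap k (Bos X) d ∈ I := by
        intro r hr
        have h3 := (γ.lift_spec (ne_top_of_le hc hI) r (hr ▸ hb.tra)).1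
        refine exists_scalar_of_quotComul hI h.tra ?_
        have h4 := quotComul_of_le hc (𝒢.ideal_le_len (𝒢.level r)) h3
        have h5 : quot (𝒢.ideal 𝒢.len) (Bos.ofV X (𝒢.rel r)) = 0 :=
          quot_eq_zero.mpr (TwoSidedIdeal.subset_span ⟨r, 𝒢.level_lt r, rfl⟩)
        rw [h4, h5, TensorProduct.tmul_zero, add_zero]
      choose! d hd using h2
      -- Changing parameters at level `n` leaves the ideal of stage `n` alone, which involves lower
      -- levels only.
      refine ⟨fun r => if 𝒢.level r = n then d r else c r, ?_⟩
      rw [cleftIdeal, cleftIdeal_congr γ (d := c) fun r hr => if_neg hr.ne]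
      refine sup_le hc (TwoSidedIdeal.span_le.mpr ?_)
      rintro _ ⟨r, hr, rfl⟩
      simp only [hr, if_true]
      exact hd r hr
  obtain ⟨c, hc⟩ := h1 𝒢.len
  -- The projection 𝒜(c) → 𝒯/I is a map of Galois objects with nonzero target, hence injective.
  refine ⟨c, le_antisymm hc fun t ht => ?_⟩
  have hb := isBigalois γ c 𝒢.len fun m hm =>
    ne_top_of_le ((cleftIdeal_mono γ c hm.le).trans hc) hI
  have := nontrivial_quot hI
  exact quot_eq_zero.mp (eq_zero_of_galois (quot_surjective _)
    (fun s hs => quot_eq_zero.mpr (hc (quot_eq_zero.mp hs))) (quot_surjective (𝒢.ideal 𝒢.len))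
    (fun s hs => hb.tra s (quot_eq_zero.mp hs)) (fun s hs => h.rho s (quot_eq_zero.mp hs))
    (quot_eq_zero.mpr ht))

variable {γ : 𝒢.Sections} {γ' : 𝒢'.Sections} {Λ : ι → k} {Λ' : ι' → k}

/-- The matrix of `V' → V`, `x'_i ↦ ∑_j s_{ij} x_{σ(j)}`. -/
def transferMatrix (σ : Fin θ' ≃ Fin θ) (s : GL (Fin θ') k) : Matrix (Fin θ') (Fin θ) k :=
  (s : Matrix (Fin θ') (Fin θ') k).submatrix id σ.symm

lemma sum_transferMatrix {M : Type*} [AddCommGroup M] [Module k M] (σ : Fin θ' ≃ Fin θ)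
    (s : GL (Fin θ') k) (v : Fin θ → M) (i : Fin θ') :
    ∑ j, transferMatrix σ s i j • v j = ∑ j, s i j • v (σ j) := by
  rw [← σ.sum_comp]
  simp [transferMatrix]

namespace LiftingDataIso

variable (a : LiftingDataIso γ γ' Λ Λ')

/-- The map of bosonizations defined by a lifting data isomorphism. -/
def homData : BosHomData X' X where
  f := a.φ.symm
  M := transferMatrix a.σ a.s
  compat i j hij := by
    have h1 : a.σ.symm j ∈ block X' i := by
      by_contra h
      exact hij (a.s_mem _ _ h)
    have h2 := a.groupLike (a.σ.symm j)
    have h3 := a.character (a.σ.symm j)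
    rw [Equiv.apply_symm_apply] at h2 h3
    rw [h1.1] at h2
    rw [h1.2] at h3
    refine ⟨?_, fun h => ?_⟩
    · rw [h2]
      exact a.φ.symm_apply_apply _
    · rw [← h3]
      exact congrArg _ (a.φ.apply_symm_apply h)

lemma hom_surjective : Function.Surjective a.homData.hom := by
  refine a.homData.hom_surjective a.φ.symm.surjective
    (((a.s⁻¹ : GL (Fin θ') k) : Matrix (Fin θ') (Fin θ') k).submatrix a.σ.symm id) ?_
  change Matrix.submatrix _ _ _ * Matrix.submatrix _ _ _ = _
  rw [← Matrix.submatrix_mul _ _ a.σ.symm id a.σ.symm Function.bijective_id, ← Units.val_mul,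
    inv_mul_cancel]
  exact Matrix.submatrix_one_equiv a.σ.symm

/-- The isomorphism of cleft objects in `parameter` makes the ideal of 𝒜(c) the preimage of that of
𝒜(Λ). The liftings follow by `liftingIdeal_eq_comap`, and `SameLifting` replaces `c` by `Λ'`. -/
lemma liftingIdeal_eq (hΛ : ∀ m ≤ 𝒢.len, cleftIdeal γ Λ m ≠ ⊤) :
    liftingIdeal γ' Λ' 𝒢'.len = comapIdeal a.homData.hom (liftingIdeal γ Λ 𝒢.len) := by
  obtain ⟨c, ⟨f, hfH, hfy⟩, hc⟩ := a.parameter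
  rw [← hc]
  refine liftingIdeal_eq_comap _ hΛ ?_
  have h1 : (f : Cleft γ' c →ₐ[k] Cleft γ Λ).comp (quot (cleftIdeal γ' c 𝒢'.len)) =
      (quot (cleftIdeal γ Λ 𝒢.len)).comp (a.homData.hom : Bos X' →ₐ[k] Bos X) := by
    apply Bos.algHom_ext
    · intro h
      have h2 := hfH (a.φ.symm h)
      have h3 : a.φ (a.φ.symm h) = h := a.φ.apply_symm_apply h
      rw [h3] at h2
      simp only [AlgHom.comp_apply, BialgHom.coe_toAlgHom, BosHomData.hom_ofH]
      exact h2
    · intro i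
      simp only [AlgHom.comp_apply, BialgHom.coe_toAlgHom, BosHomData.hom_x, map_sum, map_smul]
      exact (hfy i).trans (sum_transferMatrix a.σ a.s (Cleft.y γ Λ) i).symm
  ext t
  rw [mem_comapIdeal, ← quot_eq_zero, ← quot_eq_zero]
  exact (map_eq_zero_iff f f.injective).symm.trans
    (iff_of_eq (congrArg (· = 0) (AlgHom.congr_fun h1 t)))

lemma exists_equiv [(liftingIdeal γ Λ 𝒢.len).asIdeal.IsHopfIdeal k]
    [(liftingIdeal γ' Λ' 𝒢'.len).asIdeal.IsHopfIdeal k]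
    (hΛ : ∀ m ≤ 𝒢.len, cleftIdeal γ Λ m ≠ ⊤) :
    ∃ Ψ : Lifting γ Λ ≃ₐc[k] Lifting γ' Λ',
      (∀ h, Ψ (Lifting.ofH γ Λ h) = Lifting.ofH γ' Λ' (a.φ h)) ∧
        ∀ i, Ψ.symm (Lifting.a γ' Λ' i) = ∑ j, a.s i j • Lifting.a γ Λ (a.σ j) := by
  obtain ⟨e, he⟩ := exists_quotBialgEquiv a.homData.hom a.hom_surjective (a.liftingIdeal_eq hΛ)
  refine ⟨e.symm, fun h => ?_, fun i => ?_⟩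
  · apply e.injective
    have h1 := he (Bos.ofH X' (a.φ h))
    rw [BosHomData.hom_ofH] at h1
    have h2 : a.homData.f (a.φ h) = h := a.φ.symm_apply_apply h
    rw [h2] at h1
    exact (e.apply_symm_apply _).trans h1.symm
  · refine (he (Bos.x X' i)).trans ?_
    rw [BosHomData.hom_x, map_sum]
    simp only [map_smul]
    exact sum_transferMatrix a.σ a.s (Lifting.a γ Λ) i

end LiftingDataIso

end Transport

/-! ### Isomorphisms of liftings and lifting data -/

section Classification

open Relations

variable {k : Type*} [Field k] {H H' : Type*} [Ring H] [HopfAlgebra k H] [Ring H']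
  [HopfAlgebra k H'] {θ θ' : ℕ} {X : Fin θ → YDPair k H} {X' : Fin θ' → YDPair k H'}

/-- The Leibniz expansion of a nonzero determinant has a nonzero term. Its permutation will serve as
the σ of a lifting data isomorphism. -/
lemma exists_equiv_of_mul_eq_one {m n : ℕ} {M : Matrix (Fin m) (Fin n) k}
    {N : Matrix (Fin n) (Fin m) k} (h : M * N = 1) (h' : N * M = 1) :
    ∃ σ : Fin m ≃ Fin n, ∀ i, M i (σ i) ≠ 0 := by
  have hmn : m = n := by simpa using Matrix.square_of_invertible M N h h'
  subst hmn
  have hdet : M.det ≠ 0 := by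
    have := congrArg Matrix.det h
    rw [Matrix.det_mul, Matrix.det_one] at this
    exact left_ne_zero_of_mul (this ▸ one_ne_zero)
  rw [← Matrix.det_transpose, Matrix.det_apply] at hdet
  obtain ⟨σ, -, hσ⟩ := Finset.exists_ne_zero_of_sum_ne_zero hdet
  refine ⟨σ, fun i hi => hσ ?_⟩
  rw [Finset.prod_eq_zero (Finset.mem_univ i) (by simpa using hi), smul_zero]

namespace IsLiftingIdeal

variable {J : TwoSidedIdeal (Bos X)} {J' : TwoSidedIdeal (Bos X')} [J.asIdeal.IsHopfIdeal k]
  [J'.asIdeal.IsHopfIdeal k]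

/-- Injective maps between liftings of cosemisimple Hopf algebras preserve these. -/
lemma exists_bialgHom (hJ : IsLiftingIdeal J) (hJ' : IsLiftingIdeal J') (hH : IsCosemisimple k H)
    (Ψ : (Bos X ⧸ J.asIdeal) →ₐc[k] (Bos X' ⧸ J'.asIdeal)) (hΨ : Function.Injective Ψ) :
    ∃ f : H →ₐc[k] H', ∀ h, Ψ (quot J (Bos.ofH X h)) = quot J' (Bos.ofH X' (f h)) := by
  let l : H →ₐ[k] (Bos X ⧸ J.asIdeal) := (quot J).comp (Bos.ofH X)
  let l' : H' →ₐ[k] (Bos X' ⧸ J'.asIdeal) := (quot J').comp (Bos.ofH X')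
  let p : H →ₐ[k] (Bos X' ⧸ J'.asIdeal) :=
    (Ψ : (Bos X ⧸ J.asIdeal) →ₐ[k] (Bos X' ⧸ J'.asIdeal)).comp l
  have hl : Function.Injective l := hJ.ofH_injective
  have hl' : Function.Injective l' := hJ'.ofH_injective
  have hp : Function.Injective p := hΨ.comp hl
  have hpΔ : ∀ h, Coalgebra.comul (R := k) (p h) =
      TensorProduct.map p.toLinearMap p.toLinearMap (Coalgebra.comul (R := k) h) := by
    intro h
    change Coalgebra.comul (R := k) (Ψ (quot J (Bos.ofH X h))) = _
    rw [BialgHom.map_comul, comul_quot_ofH]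
    exact map_factor (fun _ => rfl) (fun _ => rfl) _
  have h1 : ∀ h, ∃ h', p h = l' h' := by
    -- H is the sum of its simple subcoalgebras. Their images are again simple, so they lie in H'.
    have h2 : (⊤ : Submodule k H) ≤ (LinearMap.range l'.toLinearMap).comap p.toLinearMap := by
      rw [← hH]
      refine sSup_le fun C hC c hc => ?_
      obtain ⟨h', hh'⟩ := exists_ofH_of_isSimpleSubcoalgebra (J := J')
        (hC.map p.toLinearMap hp hpΔ) (Submodule.mem_map_of_mem hc)
      exact ⟨h', hh'.symm⟩
    intro h
    obtain ⟨h', hh'⟩ := h2 (x := h) trivial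
    exact ⟨h', hh'.symm⟩
  choose f hf using h1
  let g : H →ₐ[k] H' := AlgHom.ofLinearMap
    { toFun := f
      map_add' := fun a b => hl' (by simp only [map_add, ← hf])
      map_smul' := fun c a => hl' (by simp only [map_smul, ← hf, RingHom.id_apply]) }
    (hl' (by simp only [LinearMap.coe_mk, AddHom.coe_mk, map_one, ← hf]))
    (fun a b => hl' (by simp only [LinearMap.coe_mk, AddHom.coe_mk, map_mul, ← hf]))
  have hg : ∀ h, l' (g h) = p h := fun h => (hf h).symm
  refine ⟨BialgHom.ofAlgHom g ?_ ?_, hf⟩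
  · ext h
    change Coalgebra.counit (R := k) (g h) = Coalgebra.counit (R := k) h
    rw [← Bos.counit_ofH X, ← Bos.counit_ofH X', ← counit_quot (J := J), ← counit_quot (J := J'),
      ← CoalgHomClass.counit_comp_apply Ψ]
    exact congrArg _ (hg h)
  · ext h
    apply TensorProduct.map_injective_of_flat_flat l'.toLinearMap l'.toLinearMap hl' hl'
    change TensorProduct.map l'.toLinearMap l'.toLinearMap (TensorProduct.map g.toLinearMap
      g.toLinearMap (Coalgebra.comul (R := k) h)) = TensorProduct.map l'.toLinearMap l'.toLinearMap
      (Coalgebra.comul (R := k) (g h))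
    rw [map_factor (f := p.toLinearMap) (h := p.toLinearMap) hg hg, ← hpΔ, ← hg]
    exact comul_quot_ofH _

/-- An isomorphism between liftings is linear on the generators. -/
lemma exists_homData (hJ : IsLiftingIdeal J) (hH : IsCosemisimple k H) (φ : H' ≃ₐc[k] H)
    (hq : ∀ i, braidingMatrix X' i i ≠ 1) (Ψ : (Bos X' ⧸ J'.asIdeal) →ₐc[k] (Bos X ⧸ J.asIdeal))
    (hφ : ∀ h, Ψ (quot J' (Bos.ofH X' h)) = quot J (Bos.ofH X (φ h))) :
    ∃ D : BosHomData X' X, (∀ h, D.f h = φ h) ∧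
      ∀ i, Ψ (quot J' (Bos.x X' i)) = ∑ j, D.M i j • quot J (Bos.x X j) := by
  have h1 : ∀ i, ∃ c : Fin θ → k, Ψ (quot J' (Bos.x X' i)) = ∑ j, c j • quot J (Bos.x X j) ∧
      ∀ j, c j ≠ 0 → φ (X' i).g = (X j).g ∧ ∀ h, (X j).χ (φ h) = (X' i).χ h := by
    intro i
    have hs : ∀ h, φ.symm (φ h) = h := φ.symm_apply_apply
    have hlt : ∀ h, φ (leftTwist (X' i).χ h) =
        leftTwist ((X' i).χ.comp (φ.symm : H →ₐ[k] H')) (φ h) := by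
      intro h
      have := leftTwist_map (φ : H' →ₐc[k] H) ((X' i).χ.comp (φ.symm : H →ₐ[k] H')) h
      refine Eq.trans ?_ this.symm
      refine congrArg φ (congrArg (fun χ => leftTwist χ h) (AlgHom.ext fun a => ?_))
      exact congrArg _ (hs a).symm
    have hrt : ∀ h, φ (rightTwist (X' i).χ h) =
        rightTwist ((X' i).χ.comp (φ.symm : H →ₐ[k] H')) (φ h) := by
      intro h
      have := rcontr_map (φ : H' →ₐc[k] H) ((X' i).χ.comp (φ.symm : H →ₐ[k] H')).toLinearMap h
      refine Eq.trans ?_ this.symm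
      refine congrArg φ (congrArg (fun p => rcontr p h) (LinearMap.ext fun a => ?_))
      exact congrArg (X' i).χ (hs a).symm
    -- The pair of x'_i transported along `φ`. The image of the i-th generator is skew-primitive of
    -- this type, and χ(g) = q'_ii ≠ 1.
    let y : YDPair k H :=
      { g := φ (X' i).g
        χ := (X' i).χ.comp (φ.symm : H →ₐ[k] H')
        isGroupLike := (X' i).isGroupLike.map φ
        compat := fun h => by
          obtain ⟨h, rfl⟩ := EquivLike.surjective φ h
          rw [← hlt, ← hrt, ← map_mul, (X' i).compat, map_mul] }
    have hy : y.χ y.g ≠ 1 := by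
      have : y.χ y.g = braidingMatrix X' i i := congrArg (X' i).χ (hs _)
      rw [this]
      exact hq i
    obtain ⟨c, hc, hc'⟩ := hJ.exists_eq_sum hH y hy (b := Ψ (quot J' (Bos.x X' i)))
      (by
        rw [BialgHom.map_comul, comul_quot, Bos.comul_x, map_add, map_add]
        simp only [TensorProduct.map_tmul, AlgHom.toLinearMap_apply, map_one]
        exact congrArg₂ _ rfl (congrArg (· ⊗ₜ _) (hφ _)))
      (fun h => by
        obtain ⟨h, rfl⟩ := EquivLike.surjective φ h
        change _ = _ * quot J (Bos.ofH X (leftTwist ((X' i).χ.comp (φ.symm : H →ₐ[k] H')) (φ h)))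
        rw [← hlt, ← hφ, ← hφ, ← map_mul, ← map_mul, ← map_mul, Bos.ofH_mul_x, map_mul])
    refine ⟨c, hc, fun j hj => ⟨(hc' j hj).1.symm, fun h => ?_⟩⟩
    rw [(hc' j hj).2]
    exact congrArg (X' i).χ (hs h)
  choose c hc hc' using h1
  exact ⟨⟨φ, c, hc'⟩, fun _ => rfl, hc⟩

omit [J.asIdeal.IsHopfIdeal k] in
lemma coeff_eq (hJ : IsLiftingIdeal J) {c d : Fin θ → k}
    (h : ∑ i, c i • quot J (Bos.x X i) = ∑ i, d i • quot J (Bos.x X i)) (i : Fin θ) :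
    c i = d i := by
  refine sub_eq_zero.mp (hJ.coeff_eq_zero (c := fun i => c i - d i) ?_ i)
  simp only [sub_smul, Finset.sum_sub_distrib, h, sub_self]

lemma mul_eq_one (hJ : IsLiftingIdeal J) {Ψ : (Bos X ⧸ J.asIdeal) →ₐc[k] (Bos X' ⧸ J'.asIdeal)}
    {Ψ' : (Bos X' ⧸ J'.asIdeal) →ₐc[k] (Bos X ⧸ J.asIdeal)} (h : ∀ y, Ψ' (Ψ y) = y)
    {M : Matrix (Fin θ) (Fin θ') k} {N : Matrix (Fin θ') (Fin θ) k}
    (hM : ∀ i, Ψ (quot J (Bos.x X i)) = ∑ j, M i j • quot J' (Bos.x X' j))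
    (hN : ∀ i, Ψ' (quot J' (Bos.x X' i)) = ∑ j, N i j • quot J (Bos.x X j)) : M * N = 1 := by
  ext i l
  refine hJ.coeff_eq (c := (M * N) i) (d := (1 : Matrix _ _ k) i) ?_ l
  have h1 := h (quot J (Bos.x X i))
  rw [hM, map_sum] at h1
  simp only [map_smul, hN, Finset.smul_sum, smul_smul] at h1
  rw [Finset.sum_comm] at h1
  simp only [Matrix.mul_apply, Finset.sum_smul, h1, Matrix.one_apply, ite_smul, one_smul, zero_smul]
  simp

end IsLiftingIdeal

variable {ι ι' : Type*} {𝒢 : Relations X ι} {𝒢' : Relations X' ι'} {γ : 𝒢.Sections}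
  {γ' : 𝒢'.Sections} {Λ : ι → k} {Λ' : ι' → k}

lemma Lifting.equiv_ext [(liftingIdeal γ Λ 𝒢.len).asIdeal.IsHopfIdeal k]
    [(liftingIdeal γ' Λ' 𝒢'.len).asIdeal.IsHopfIdeal k] {Ψ₁ Ψ₂ : Lifting γ Λ ≃ₐc[k] Lifting γ' Λ'}
    (φ : H ≃ₐc[k] H') (h₁ : ∀ h, Ψ₁ (Lifting.ofH γ Λ h) = Lifting.ofH γ' Λ' (φ h))
    (h₂ : ∀ h, Ψ₂ (Lifting.ofH γ Λ h) = Lifting.ofH γ' Λ' (φ h))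
    (hx : ∀ i, Ψ₁.symm (Lifting.a γ' Λ' i) = Ψ₂.symm (Lifting.a γ' Λ' i)) : Ψ₁ = Ψ₂ := by
  have h3 : (Ψ₁.symm : Lifting γ' Λ' →ₐ[k] Lifting γ Λ).comp (quot _) =
      (Ψ₂.symm : Lifting γ' Λ' →ₐ[k] Lifting γ Λ).comp (quot _) := by
    apply Bos.algHom_ext
    · intro h
      obtain ⟨h, rfl⟩ := EquivLike.surjective φ h
      change Ψ₁.symm (Lifting.ofH γ' Λ' (φ h)) = Ψ₂.symm (Lifting.ofH γ' Λ' (φ h))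
      rw [← h₁]
      conv_rhs => rw [h₁, ← h₂]
      exact (Ψ₁.symm_apply_apply _).trans (Ψ₂.symm_apply_apply _).symm
    · exact hx
  have h4 : ∀ y, Ψ₁.symm y = Ψ₂.symm y := by
    intro y
    obtain ⟨t, rfl⟩ := quot_surjective _ y
    exact AlgHom.congr_fun h3 t
  refine DFunLike.ext _ _ fun y => EquivLike.injective Ψ₂.symm ?_
  rw [← h4]
  exact (Ψ₁.symm_apply_apply y).trans (Ψ₂.symm_apply_apply y).symm

/-- Isomorphisms between liftings come from lifting data isomorphisms. -/
lemma exists_liftingDataIso [(liftingIdeal γ Λ 𝒢.len).asIdeal.IsHopfIdeal k]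
    [(liftingIdeal γ' Λ' 𝒢'.len).asIdeal.IsHopfIdeal k]
    (hΛ : ∀ m ≤ 𝒢.len, cleftIdeal γ Λ m ≠ ⊤) (hΛ' : ∀ m ≤ 𝒢'.len, cleftIdeal γ' Λ' m ≠ ⊤)
    (hH : IsCosemisimple k H) (hH' : IsCosemisimple k H')
    (hq : ∀ i, braidingMatrix X i i ≠ 1) (hq' : ∀ i, braidingMatrix X' i i ≠ 1)
    (Ψ : Lifting γ Λ ≃ₐc[k] Lifting γ' Λ') :
    ∃ a : LiftingDataIso γ γ' Λ Λ', (∀ h, Ψ (Lifting.ofH γ Λ h) = Lifting.ofH γ' Λ' (a.φ h)) ∧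
        ∀ i, Ψ.symm (Lifting.a γ' Λ' i) = ∑ j, a.s i j • Lifting.a γ Λ (a.σ j) := by
  have hJ := isLiftingIdeal γ Λ hΛ
  have hJ' := isLiftingIdeal γ' Λ' hΛ'
  obtain ⟨f, hf⟩ := hJ.exists_bialgHom hJ' hH (Ψ : Lifting γ Λ →ₐc[k] Lifting γ' Λ') Ψ.injective
  obtain ⟨g, hg⟩ := hJ'.exists_bialgHom hJ hH' (Ψ.symm : Lifting γ' Λ' →ₐc[k] Lifting γ Λ)
    Ψ.symm.injective
  have hfg : ∀ h, f (g h) = h := fun h => hJ'.ofH_injective <| by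
    change quot _ (Bos.ofH X' _) = quot _ (Bos.ofH X' h)
    rw [← hf, ← hg]
    exact Ψ.apply_symm_apply _
  have hgf : ∀ h, g (f h) = h := fun h => hJ.ofH_injective <| by
    change quot _ (Bos.ofH X _) = quot _ (Bos.ofH X h)
    rw [← hg, ← hf]
    exact Ψ.symm_apply_apply _
  let φ : H ≃ₐc[k] H' := BialgEquiv.ofBialgHom f g (BialgHom.ext hfg) (BialgHom.ext hgf)
  obtain ⟨D, hD, hDx⟩ := hJ.exists_homData hH φ.symm hq'
    (Ψ.symm : Lifting γ' Λ' →ₐc[k] Lifting γ Λ) hg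
  obtain ⟨E, hE, hEx⟩ := hJ'.exists_homData hH' φ hq (Ψ : Lifting γ Λ →ₐc[k] Lifting γ' Λ') hf
  have hED : E.M * D.M = 1 := hJ.mul_eq_one Ψ.symm_apply_apply hEx hDx
  have hDE : D.M * E.M = 1 := hJ'.mul_eq_one Ψ.apply_symm_apply hDx hEx
  -- Nonzero entries occur only between pairs that correspond under `φ`. So any `σ` along nonzero
  -- entries matches the pairs, and the permuted matrix `s` is supported on blocks.
  obtain ⟨σ, hσ⟩ := exists_equiv_of_mul_eq_one hDE hED
  let s : GL (Fin θ') k :=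
    { val := D.M.submatrix id σ
      inv := E.M.submatrix σ id
      val_inv := by
        rw [← Matrix.submatrix_mul _ _ id σ id σ.bijective, hDE, Matrix.submatrix_id_id]
      inv_val := by
        rw [← Matrix.submatrix_mul _ _ σ id σ Function.bijective_id, hED,
          Matrix.submatrix_one_equiv] }
  have hg₀ : ∀ h, D.f (φ h) = h := fun h => (hD _).trans (hgf h)
  have hf₀ : ∀ h, φ (D.f h) = h := fun h => (congrArg φ (hD h)).trans (hfg h)
  have hgl : ∀ i, (X' i).g = φ (X (σ i)).g := fun i => by
    rw [← (D.compat i (σ i) (hσ i)).1, hf₀]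
  have hch : ∀ i h, (X' i).χ (φ h) = (X (σ i)).χ h := fun i h => by
    rw [← (D.compat i (σ i) (hσ i)).2, hg₀]
  have hsum : ∀ {M : Type _} [AddCommGroup M] [Module k M] (v : Fin θ → M) (i : Fin θ'),
      ∑ j, D.M i j • v j = ∑ j, s i j • v (σ j) := fun v i => (σ.sum_comp _).symm
  have hF : Function.Surjective D.hom := D.hom_surjective (fun h => ⟨φ h, hg₀ h⟩) _ hED
  have hne := comapIdeal_ne_top D.hom (hΛ _ le_rfl)
  -- The preimage of 𝒜(Λ) in T(V') # H' is a biGalois object over 𝔅(V') # H', so it is 𝒜(c) for some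
  -- c.
  have hb := (isBigalois γ Λ 𝒢.len fun m hm => hΛ m hm.le).comap D.hom
  rw [D.comapIdeal_ideal 𝒢 𝒢' E (fun h => (hE _).trans (hf₀ h)) hDE] at hb
  obtain ⟨c, hc⟩ := exists_cleftIdeal_eq γ' hb hne
  have hlift : liftingIdeal γ' Λ' 𝒢'.len = comapIdeal D.hom (liftingIdeal γ Λ 𝒢.len) := by
    have h1 : (Ψ.symm : Lifting γ' Λ' →ₐ[k] Lifting γ Λ).comp (quot _) =
        (quot (liftingIdeal γ Λ 𝒢.len)).comp (D.hom : Bos X' →ₐ[k] Bos X) := by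
      apply Bos.algHom_ext
      · intro h
        refine (hg h).trans ?_
        simp only [AlgHom.comp_apply, BialgHom.coe_toAlgHom, BosHomData.hom_ofH, hD]
        rfl
      · intro i
        refine (hDx i).trans ?_
        simp
    ext t
    rw [mem_comapIdeal, ← quot_eq_zero, ← quot_eq_zero]
    exact (map_eq_zero_iff Ψ.symm Ψ.symm.injective).symm.trans
      (iff_of_eq (congrArg (· = 0) (AlgHom.congr_fun h1 t)))
  refine ⟨⟨φ, σ, s, fun i j hij => ?_, fun i j => ?_, hgl, hch, c, ?_, ?_⟩, hf, fun i => ?_⟩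
  · by_contra h
    have h1 : D.M i (σ j) ≠ 0 := h
    have h2 := D.compat i (σ j) h1
    have h3 := D.compat j (σ j) (hσ j)
    refine hij ⟨?_, AlgHom.ext fun h => ?_⟩
    · rw [← hf₀ (X' j).g, h3.1, ← h2.1, hf₀]
    · rw [← h2.2, h3.2]
  · change (X' j).χ (X' i).g = (X (σ j)).χ (X (σ i)).g
    rw [hgl i, hch]
  · obtain ⟨e, he⟩ := exists_quotEquiv D.hom hF hc
    refine ⟨e, fun h => (he (Bos.ofH X' (φ h))).trans ?_, fun i => (he (Bos.x X' i)).trans ?_⟩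
    · rw [D.hom_ofH, hg₀]
      rfl
    · rw [D.hom_x, map_sum]
      simp only [map_smul]
      exact hsum (Cleft.y γ Λ) i
  -- ℒ(c) and ℒ(Λ') are both defined by the preimage of the ideal of ℒ(Λ).
  · exact (liftingIdeal_eq_comap D.hom hΛ hc).trans hlift.symm
  · exact (hDx i).trans (hsum (Lifting.a γ Λ) i)

/-- The generators a_j are linearly independent, so the sums determine the matrix with s_ij in
column σ(j). Two presentations of one matrix differ by τ = σ_a⁻¹ σ_b, which preserves blocks because
both bijections match the pairs. -/
lemma LiftingDataIso.blockEquiv_iff (hΛ : ∀ m ≤ 𝒢.len, cleftIdeal γ Λ m ≠ ⊤)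
    (a b : LiftingDataIso γ γ' Λ Λ') : a.BlockEquiv b ↔ a.φ = b.φ ∧
      ∀ i, ∑ j, a.s i j • Lifting.a γ Λ (a.σ j) = ∑ j, b.s i j • Lifting.a γ Λ (b.σ j) := by
  constructor
  · rintro ⟨τ, -, h1, h2, h3⟩
    refine ⟨h1.symm, fun i => ?_⟩
    rw [← Equiv.sum_comp τ]
    simp [h2, h3]
  · rintro ⟨h1, h2⟩
    have h3 : ∀ i l, transferMatrix a.σ a.s i l = transferMatrix b.σ b.s i l := by
      intro i l
      refine (isLiftingIdeal γ Λ hΛ).coeff_eq ?_ l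
      exact (sum_transferMatrix a.σ a.s (Lifting.a γ Λ) i).trans
        ((h2 i).trans (sum_transferMatrix b.σ b.s (Lifting.a γ Λ) i).symm)
    refine ⟨b.σ.trans a.σ.symm, fun i => ⟨?_, AlgHom.ext fun h => ?_⟩, h1.symm, ?_, fun i j => ?_⟩
    · rw [a.groupLike, b.groupLike, h1]
      simp
    · obtain ⟨h, rfl⟩ := EquivLike.surjective a.φ h
      rw [a.character, h1, b.character]
      simp
    · ext i
      simp
    · have := h3 i (b.σ j)
      simpa [transferMatrix] using this.symm

lemma LiftingDataIso.eq_of_blockEquiv (hX : ∀ i, block X i = {i})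
    {a b : LiftingDataIso γ γ' Λ Λ'} (h : a.BlockEquiv b) : a = b := by
  obtain ⟨τ, h1, h2, h3, h4⟩ := h
  have hτ : ∀ i, τ i = i := by
    intro i
    have h5 : a.σ (τ i) ∈ block X (a.σ i) := by
      refine ⟨EquivLike.injective a.φ ?_, AlgHom.ext fun h => ?_⟩
      · rw [← a.groupLike, ← a.groupLike, (h1 i).1]
      · rw [← a.character, ← a.character, (h1 i).2]
    rw [hX] at h5
    exact a.σ.injective h5
  have h5 : b.σ = a.σ := by
    rw [h3]
    ext i
    simp [hτ]
  have h6 : b.s = a.s := by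
    ext i j
    rw [h4, hτ]
  cases a
  cases b
  simp only at h2 h5 h6
  subst h2 h5 h6
  rfl

end Classification

end DiagonalLifting

end

/-! ### The main theorem -/

open DiagonalLifting DiagonalLifting.Relations in
theorem mainTheorem5 {k : Type*} [Field k] [IsAlgClosed k] [CharZero k]
    {H H' : Type*} [Ring H] [HopfAlgebra k H] [Ring H'] [HopfAlgebra k H']
    (hS : Function.Bijective (HopfAlgebra.antipode k (A := H)))
    (hS' : Function.Bijective (HopfAlgebra.antipode k (A := H')))
    (hH : IsCosemisimple k H) (hH' : IsCosemisimple k H')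
    {θ θ' : ℕ} (X : Fin θ → YDPair k H) (X' : Fin θ' → YDPair k H')
    (hfin : Module.Finite k (FreeAlgebra k (Fin θ) ⧸ nicholsIdeal (braidingMatrix X)))
    (hfin' : Module.Finite k (FreeAlgebra k (Fin θ') ⧸ nicholsIdeal (braidingMatrix X')))
    (hconn : (dynkinGraph (braidingMatrix X)).Connected)
    {ι ι' : Type*} [Finite ι] [Finite ι'] (𝒢 : Relations X ι) (𝒢' : Relations X' ι')
    (γ : 𝒢.Sections) (γ' : 𝒢'.Sections)
    (Λ : ι → k) (hΛ : Λ ∈ parameters γ) (Λ' : ι' → k) (hΛ' : Λ' ∈ parameters γ') :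
    ∃ (_ : IsHopfQuotient γ Λ) (_ : IsHopfQuotient γ' Λ'),
      ∃ Φ : LiftingDataIso γ γ' Λ Λ' → (Lifting γ Λ ≃ₐc[k] Lifting γ' Λ'),
        (∀ a, (∀ h, Φ a (Lifting.ofH γ Λ h) = Lifting.ofH γ' Λ' (a.φ h)) ∧
          ∀ i, (Φ a).symm (Lifting.a γ' Λ' i) = ∑ j, a.s i j • Lifting.a γ Λ (a.σ j)) ∧
        Function.Surjective Φ ∧
        (∀ a b, Φ a = Φ b ↔ a.BlockEquiv b) ∧
        ((∀ i, block X i = {i}) → Function.Bijective Φ) := by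
  have hb := (isBigalois γ Λ 𝒢.len fun m hm => hΛ.1 m hm.le).isHopfIdeal
  have hb' := (isBigalois γ' Λ' 𝒢'.len fun m hm => hΛ'.1 m hm.le).isHopfIdeal
  refine ⟨hb, hb', ?_⟩
  choose Φ hΦH hΦx using fun a : LiftingDataIso γ γ' Λ Λ' => a.exists_equiv hΛ.1
  have hsurj : Function.Surjective Φ := by
    intro Ψ
    obtain ⟨a, haH, hax⟩ := exists_liftingDataIso hΛ.1 hΛ'.1 hH hH' (ne_one_of_finite hfin)
      (ne_one_of_finite hfin') Ψ
    exact ⟨a, Lifting.equiv_ext a.φ (hΦH a) haH fun i => (hΦx a i).trans (hax i).symm⟩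
  have hiff : ∀ a b, Φ a = Φ b ↔ a.BlockEquiv b := by
    intro a b
    rw [a.blockEquiv_iff hΛ.1]
    constructor
    · intro h
      -- H' embeds in ℒ(Λ'), so the isomorphism determines φ.
      refine ⟨DFunLike.ext _ _ fun y => (isLiftingIdeal γ' Λ' hΛ'.1).ofH_injective ?_, fun i => ?_⟩
      · exact ((hΦH a y).symm.trans (by rw [h])).trans (hΦH b y)
      · rw [← hΦx, ← hΦx, h]
    · rintro ⟨h1, h2⟩
      refine Lifting.equiv_ext a.φ (hΦH a) (fun h => ?_) fun i => ?_
      · rw [hΦH, h1]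
      · rw [hΦx, hΦx, h2]
  exact ⟨Φ, fun a => ⟨hΦH a, hΦx a⟩, hsurj, hiff, fun hX =>
    ⟨fun a b h => LiftingDataIso.eq_of_blockEquiv hX ((hiff a b).mp h), hsurj⟩⟩
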